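/- Let $\mathcal P=\{I,\sigma_x,\sigma_y,\sigma_z\}^{\otimes n}$ be the $n$-qubit Pauli operators, $\mathcal P_k\subset\mathcal P$ those acting non-trivially on at most $k$ qubits, and $\|\cdot\|_F$ the Frobenius norm. For a Hamiltonian $\hat H=\sum_{Q}\lambda_Q Q$ with real coefficients, and $\varepsilon>0$, define its effective sparsity $$\mathfrak s_\varepsilon=\max\Big(1,\ \max_{1\le i\le n}\ \sum_{Q\in\mathcal P:\ i\in\mathrm{supp}(Q)}\min(1,\lambda_Q^2/\varepsilon^2)\Big).$$ There are a universal constant $C>0$ and a single (uniform) quantum algorithm with the following properties. Its input consists of the number of qubits $n$, a locality parameter $k\in\mathbb N$, parameters $0<\varepsilon\le 1$ and $0<\delta<1$ with $2\delta\le n$ (that is, $n\ge 1$, and $\delta\le 1/2$ if $n=1$), and black-box access to an $n$-qubit unitary $Z$. 1. **Applications of $Z$.** The algorithm always uses $Z$ at most $$C\,\frac{e^{8k}}{\varepsilon^2}\log\frac n\delta$$ times, through non-adaptive circuits that each prepare a product of single-qubit Pauli eigenstates, apply $Z$ once, and measure every qubit in a Pauli basis. All circuits are chosen (at random) before the first measurement.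 2. **Guarantee.** Suppose that there is a Hamiltonian $\hat H=\sum_{Q\in\mathcal P_k\setminus\{I\}}\lambda_Q Q$ with real coefficients $\lambda_Q$ such that for every $P\in\mathcal P_1$ $$Z^\dagger P Z=P+[i\hat H,P]+E^{(P)}\qquad\text{with}\qquad \frac1{\sqrt{2^n}}\|E^{(P)}\|_F<\frac{\varepsilon}{20^{k+2}} .$$ Then with probability at least $1-\delta$ (over the algorithm's random choices and the measurement outcomes) the algorithm outputs a vector $\tilde\lambda$ such that all of the following hold: * $\|\lambda-\tilde\lambda\|_\infty<\varepsilon$; * the classical running time (choosing the circuits and processing the outcomes, on a unit-cost random access machine with real arithmetic) is at most $$C\,n^2\,\mathfrak s_\varepsilon\,\frac{e^{15k}}{\varepsilon^2}\log\frac n\delta ;$$ * $\tilde\lambda$ has at most $C\,e^{7k}\,\mathfrak s_\varepsilon\,n$ non-zero entries. The algorithm is not given $\hat H$ or $\mathfrak s_\varepsilon$. -/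

import Mathlib

open MeasureTheory
open scoped ENNReal Matrix

namespace HamLearn

/-! ## Qubits and Pauli operators -/

/-- Operators on `n` qubits, in the computational basis indexed by `Fin n → Fin 2`. -/
abbrev Op (n : ℕ) := Matrix (Fin n → Fin 2) (Fin n → Fin 2) ℂ

/-- The single-qubit Pauli matrices `I, X, Y, Z`, numbered `0, 1, 2, 3`. -/
def pauli : Fin 4 → Matrix (Fin 2) (Fin 2) ℂ :=
  ![1, !![0, 1; 1, 0], !![0, -Complex.I; Complex.I, 0], !![1, 0; 0, -1]]

/-- The tensor product of `n` single-qubit operators. -/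
def tensor {n : ℕ} (M : Fin n → Matrix (Fin 2) (Fin 2) ℂ) : Op n :=
  fun x y => ∏ i, M i (x i) (y i)

/-- A label of a tensor product of Pauli matrices. The identity has label `0`. -/
abbrev PauliString (n : ℕ) := Fin n → Fin 4

/-- The tensor product of Pauli matrices with label `Q`. -/
def PauliString.op {n : ℕ} (Q : PauliString n) : Op n := tensor fun i => pauli (Q i)

/-- The size of the support. -/
def PauliString.weight {n : ℕ} (Q : PauliString n) : ℕ :=
  (Finset.univ.filter fun i => Q i ≠ 0).card

/-- The Hamiltonian with real Pauli coefficients `lam`. -/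
noncomputable def hamiltonian {n : ℕ} (lam : PauliString n → ℝ) : Op n :=
  ∑ Q, (lam Q : ℂ) • Q.op

/-- All terms are non-identity Paulis supported on at most `k` qubits. -/
def IsLocalHamiltonian {n : ℕ} (k : ℕ) (lam : PauliString n → ℝ) : Prop :=
  lam 0 = 0 ∧ ∀ Q : PauliString n, k < Q.weight → lam Q = 0

/-- The normalized Frobenius norm `‖A‖_F / √(2 ^ n)`. -/
noncomputable def normalizedFrobenius {n : ℕ} (A : Op n) : ℝ :=
  Real.sqrt (∑ x, ∑ y, ‖A x y‖ ^ 2) / Real.sqrt (2 ^ n)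

/-- `Z` agrees with `exp (i H)` to first order on single-qubit Paulis, up to error `η`:
`Z† P Z = P + [i H, P] + E` with normalized Frobenius norm of `E` less than `η`. -/
def FirstOrderApprox {n : ℕ} (Z H : Op n) (η : ℝ) : Prop :=
  ∀ P : PauliString n, P.weight ≤ 1 →
    ∃ E : Op n, Zᴴ * P.op * Z = P.op + ⁅Complex.I • H, P.op⁆ + E ∧ normalizedFrobenius E < η

/-- The real number `x` clipped to `[-ε, ε]`. -/
def clip (ε x : ℝ) : ℝ := max (-ε) (min x ε)

/-- The local 2-norm: the maximum over the qubits `i` of the 2-norm of the coefficients of those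
terms whose support contains `i`. -/
noncomputable def localTwoNorm {n : ℕ} (lam : PauliString n → ℝ) : ℝ :=
  ⨆ i : Fin n, Real.sqrt (∑ Q : PauliString n with Q i ≠ 0, lam Q ^ 2)

/-- The effective sparsity of the Hamiltonian with coefficients `lam`. -/
noncomputable def effSparsity {n : ℕ} (ε : ℝ) (lam : PauliString n → ℝ) : ℝ :=
  max 1 (localTwoNorm (fun Q => clip ε (lam Q)) ^ 2 / ε ^ 2)

/-- The number of non-zero coefficients. -/
noncomputable def sparsity {n : ℕ} (lam : PauliString n → ℝ) : ℕ := Set.ncard {Q | lam Q ≠ 0}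

/-! ## Prepare-apply-measure circuits -/

/-- Sign of a bit: `false` is `+1`, `true` is `-1`. -/
def bitSign (b : Bool) : ℂ := if b then -1 else 1

/-- The projector onto the product state whose qubit `i` is the eigenvector with eigenvalue
`bitSign (v i)` of the Pauli matrix `X`, `Y` or `Z` with number `A i + 1`. -/
noncomputable def eigenProjector {n : ℕ} (A : Fin n → Fin 3) (v : Fin n → Bool) : Op n :=
  tensor fun i => (1 / 2 : ℂ) • (1 + bitSign (v i) • pauli (A i).succ)

/-- A circuit that prepares a product of Pauli eigenstates, applies the unknown unitary once, and
measures every qubit in the eigenbasis of a Pauli matrix. It is described by the axes and the signs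
of the prepared eigenstates and the axes of the measurement. -/
structure Circuit (n : ℕ) where
  prepAxis : Fin n → Fin 3
  prepSign : Fin n → Bool
  measAxis : Fin n → Fin 3

/-- The probability (Born rule) that the circuit outputs the eigenvalues `bitSign (w i)`. -/
noncomputable def Circuit.outcomeProb {n : ℕ} (c : Circuit n) (Z : Op n) (w : Fin n → Bool) : ℝ :=
  (Matrix.trace (eigenProjector c.measAxis w *
    (Z * eigenProjector c.prepAxis c.prepSign * Zᴴ))).re

/-! ## Classical computation: a unit-cost random access machine

A structured programming language over finitely many named, unbounded arrays of natural numbers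
and of real numbers. Natural numbers can be added, (truncatedly) subtracted and compared, and may
be used as array indices; they cannot be multiplied in one step. Real numbers can be added,
subtracted, multiplied, divided and compared; there is no rounding of a real number to an integer.
A coin toss yields a uniformly random element of `{0, …, 5}` (an axis and a sign). Every operation,
every memory access, every test and every coin toss costs one unit of time. -/

/-- The memory contents, and the number of coins tossed so far. `nat a i` and `real a i` are the
entries with index `i` of the arrays with name `a`. -/
structure State where
  nat : ℕ → ℕ → ℕ
  real : ℕ → ℕ → ℝ
  coins : ℕ

/-- Assignment to an entry of an array of natural numbers. -/
def State.setNat (σ : State) (a i v : ℕ) : State :=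
  { σ with nat := Function.update σ.nat a (Function.update (σ.nat a) i v) }

/-- Assignment to an entry of an array of real numbers. -/
def State.setReal (σ : State) (a i : ℕ) (v : ℝ) : State :=
  { σ with real := Function.update σ.real a (Function.update (σ.real a) i v) }

/-- Expressions of natural number type. -/
inductive NExp where
  | const (c : ℕ)
  | get (a : ℕ) (i : NExp)
  | add (e f : NExp)
  | sub (e f : NExp)

def NExp.eval (σ : State) : NExp → ℕ
  | .const c => c
  | .get a i => σ.nat a (i.eval σ)
  | .add e f => e.eval σ + f.eval σ
  | .sub e f => e.eval σ - f.eval σ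

def NExp.cost : NExp → ℕ
  | .const _ => 1
  | .get _ i => i.cost + 1
  | .add e f => e.cost + f.cost + 1
  | .sub e f => e.cost + f.cost + 1

/-- Expressions of real number type; only rational constants may appear in a program. -/
inductive RExp where
  | const (q : ℚ)
  | ofNat (e : NExp)
  | get (a : ℕ) (i : NExp)
  | add (e f : RExp)
  | sub (e f : RExp)
  | mul (e f : RExp)
  | div (e f : RExp)

noncomputable def RExp.eval (σ : State) : RExp → ℝ
  | .const q => q
  | .ofNat e => e.eval σ
  | .get a i => σ.real a (i.eval σ)
  | .add e f => e.eval σ + f.eval σ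
  | .sub e f => e.eval σ - f.eval σ
  | .mul e f => e.eval σ * f.eval σ
  | .div e f => e.eval σ / f.eval σ

def RExp.cost : RExp → ℕ
  | .const _ => 1
  | .ofNat e => e.cost + 1
  | .get _ i => i.cost + 1
  | .add e f => e.cost + f.cost + 1
  | .sub e f => e.cost + f.cost + 1
  | .mul e f => e.cost + f.cost + 1
  | .div e f => e.cost + f.cost + 1

/-- Tests. -/
inductive BExp where
  | natLt (e f : NExp)
  | natEq (e f : NExp)
  | realLt (e f : RExp)
  | not (b : BExp)
  | and (b c : BExp)

def BExp.eval (σ : State) : BExp → Prop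
  | .natLt e f => e.eval σ < f.eval σ
  | .natEq e f => e.eval σ = f.eval σ
  | .realLt e f => e.eval σ < f.eval σ
  | .not b => ¬ b.eval σ
  | .and b c => b.eval σ ∧ c.eval σ

def BExp.cost : BExp → ℕ
  | .natLt e f => e.cost + f.cost + 1
  | .natEq e f => e.cost + f.cost + 1
  | .realLt e f => e.cost + f.cost + 1
  | .not b => b.cost + 1
  | .and b c => b.cost + c.cost + 1

/-- Programs. -/
inductive Prog where
  | skip
  | setNat (a : ℕ) (i e : NExp)
  | setReal (a : ℕ) (i : NExp) (e : RExp)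
  | toss (a : ℕ) (i : NExp)
  | seq (p q : Prog)
  | ite (b : BExp) (p q : Prog)
  | while (b : BExp) (p : Prog)

/-- `Exec ω p σ t σ'`: if the coins fall as in the sequence `ω`, then the program `p`, started in
the state `σ`, halts after `t` units of time in the state `σ'`. -/
inductive Exec (ω : ℕ → Fin 6) : Prog → State → ℕ → State → Prop where
  | skip (σ : State) : Exec ω .skip σ 1 σ
  | setNat (a : ℕ) (i e : NExp) (σ : State) :
      Exec ω (.setNat a i e) σ (i.cost + e.cost + 1) (σ.setNat a (i.eval σ) (e.eval σ))
  | setReal (a : ℕ) (i : NExp) (e : RExp) (σ : State) :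
      Exec ω (.setReal a i e) σ (i.cost + e.cost + 1) (σ.setReal a (i.eval σ) (e.eval σ))
  | toss (a : ℕ) (i : NExp) (σ : State) :
      Exec ω (.toss a i) σ (i.cost + 1)
        { σ.setNat a (i.eval σ) (ω σ.coins) with coins := σ.coins + 1 }
  | seq {p q : Prog} {σ σ' σ'' : State} {s t : ℕ} :
      Exec ω p σ s σ' → Exec ω q σ' t σ'' → Exec ω (.seq p q) σ (s + t) σ''
  | iteTrue {b : BExp} {p q : Prog} {σ σ' : State} {t : ℕ} :
      b.eval σ → Exec ω p σ t σ' → Exec ω (.ite b p q) σ (b.cost + 1 + t) σ'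
  | iteFalse {b : BExp} {p q : Prog} {σ σ' : State} {t : ℕ} :
      ¬ b.eval σ → Exec ω q σ t σ' → Exec ω (.ite b p q) σ (b.cost + 1 + t) σ'
  | whileFalse {b : BExp} {p : Prog} {σ : State} :
      ¬ b.eval σ → Exec ω (.while b p) σ (b.cost + 1) σ
  | whileTrue {b : BExp} {p : Prog} {σ σ' σ'' : State} {s t : ℕ} :
      b.eval σ → Exec ω p σ s σ' → Exec ω (.while b p) σ' t σ'' →
      Exec ω (.while b p) σ (b.cost + 1 + s + t) σ''

/-- Given the coins, the running time and the final state are unique. -/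
theorem Exec.deterministic {ω : ℕ → Fin 6} {p : Prog} {σ σ₁ σ₂ : State} {t₁ t₂ : ℕ}
    (h₁ : Exec ω p σ t₁ σ₁) (h₂ : Exec ω p σ t₂ σ₂) : t₁ = t₂ ∧ σ₁ = σ₂ := by
  induction h₁ generalizing t₂ σ₂ with
  | skip => cases h₂; exact ⟨rfl, rfl⟩
  | setNat => cases h₂; exact ⟨rfl, rfl⟩
  | setReal => cases h₂; exact ⟨rfl, rfl⟩
  | toss => cases h₂; exact ⟨rfl, rfl⟩
  | seq _ _ ih₁ ih₂ =>
    cases h₂ with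
    | seq k₁ k₂ =>
      obtain ⟨rfl, rfl⟩ := ih₁ k₁
      obtain ⟨rfl, rfl⟩ := ih₂ k₂
      exact ⟨rfl, rfl⟩
  | iteTrue hb _ ih =>
    cases h₂ with
    | iteTrue _ k => obtain ⟨rfl, rfl⟩ := ih k; exact ⟨rfl, rfl⟩
    | iteFalse hb' _ => exact absurd hb hb'
  | iteFalse hb _ ih =>
    cases h₂ with
    | iteTrue hb' _ => exact absurd hb' hb
    | iteFalse _ k => obtain ⟨rfl, rfl⟩ := ih k; exact ⟨rfl, rfl⟩
  | whileFalse hb =>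
    cases h₂ with
    | whileFalse _ => exact ⟨rfl, rfl⟩
    | whileTrue hb' _ _ => exact absurd hb' hb
  | whileTrue hb _ _ ih₁ ih₂ =>
    cases h₂ with
    | whileFalse hb' => exact absurd hb hb'
    | whileTrue _ k₁ k₂ =>
      obtain ⟨rfl, rfl⟩ := ih₁ k₁
      obtain ⟨rfl, rfl⟩ := ih₂ k₂
      exact ⟨rfl, rfl⟩

/-! ## Learning algorithms with non-adaptive experiments -/

/-- The initial memory: the numbers `n` and `k` in the array `0` of natural numbers, the numbers
`ε` and `δ` in the array `0` of real numbers, zeros elsewhere. -/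
noncomputable def initState (n k : ℕ) (ε δ : ℝ) : State where
  nat a i := if a = 0 then (if i = 0 then n else if i = 1 then k else 0) else 0
  real a i := if a = 0 then (if i = 0 then ε else if i = 1 then δ else 0) else 0
  coins := 0

/-- The number of experiments that the memory asks for (entry `0` of array `1`). -/
def State.numExperiments (σ : State) : ℕ := σ.nat 1 0

/-- The `j`-th circuit that the memory describes: the data for qubit `i` are the entries
`j * n + i` of the arrays `2` (axis of the prepared state), `3` (its sign, `0` for `+1`) and
`4` (axis of the measurement). -/
def State.circuit (σ : State) (n j : ℕ) : Circuit n where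
  prepAxis i := Fin.ofNat 3 (σ.nat 2 (j * n + i))
  prepSign i := decide (σ.nat 3 (j * n + i) ≠ 0)
  measAxis i := Fin.ofNat 3 (σ.nat 4 (j * n + i))

/-- The memory after the outcomes of the `N` experiments have been written to array `5`: its
entry `j * n + i` is `0` if the outcome for qubit `i` in experiment `j` is `+1`, and `1` if it
is `-1`. -/
def State.record (σ : State) {n N : ℕ} (w : Fin N → Fin n → Bool) : State :=
  { σ with nat := Function.update σ.nat 5 fun c =>
      if h : c / n < N ∧ 0 < n then
        (if w ⟨c / n, h.1⟩ ⟨c % n, Nat.mod_lt c h.2⟩ then 1 else 0)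
      else 0 }

/-- The output that the memory describes: a list of assignments of real numbers to Pauli strings,
to be carried out in order starting from the zero vector. Entry `0` of array `6` is the length of
the list, the entries `r * n + i` of array `7` are the Pauli string of assignment number `r`, and
entry `r` of the array `1` of real numbers is its value. -/
noncomputable def State.output (σ : State) (n : ℕ) : PauliString n → ℝ :=
  (List.range (σ.nat 6 0)).foldl
    (fun lam r => Function.update lam (fun i => Fin.ofNat 4 (σ.nat 7 (r * n + i))) (σ.real 1 r)) 0

/-- An algorithm with non-adaptive experiments consists of a program that designs all experiments
and a program that processes the outcomes (and still has access to the whole memory). The two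
programs are fixed; they do not depend on any parameter. -/
structure Algorithm where
  design : Prog
  process : Prog

/-- The law of an infinite sequence of independent uniformly random coins. -/
noncomputable def coinMeasure : Measure (ℕ → Fin 6) :=
  Measure.infinitePi fun _ => (PMF.uniformOfFintype (Fin 6)).toMeasure

open Classical in
/-- The probability, over the coins and the measurement outcomes, that the algorithm, applied to
the unknown unitary `Z`, halts after a total classical running time `t` with an output `lam` such
that `good lam t`. (For every `ω`, at most one pair `(t₁, σ₁)` contributes to the supremum; if the
design program does not halt then there is none, and the value is `0`.) -/
noncomputable def Algorithm.prob (alg : Algorithm) {n : ℕ} (Z : Op n) (k : ℕ) (ε δ : ℝ)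
    (good : (PauliString n → ℝ) → ℕ → Prop) : ℝ≥0∞ :=
  ∫⁻ ω, (⨆ (t₁ : ℕ) (σ₁ : State) (_ : Exec ω alg.design (initState n k ε δ) t₁ σ₁),
    ∑ w : Fin σ₁.numExperiments → Fin n → Bool,
      if ∃ (t₂ : ℕ) (σ₂ : State),
          Exec ω alg.process (σ₁.record w) t₂ σ₂ ∧ good (σ₂.output n) (t₁ + t₂)
      then ∏ j : Fin σ₁.numExperiments, ENNReal.ofReal ((σ₁.circuit n j).outcomeProb Z (w j))
      else 0) ∂coinMeasure

end HamLearn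

open HamLearn

/-!
The coefficients of the Hamiltonian are Pauli coefficients of evolved observables. If `(c, P, R)`
are Pauli matrices in cyclic order, then `[i c, P] = -2 R`; so the coefficient in `Z† P Z`, for the
observable `P` at the qubit `i`, of a string with label `R` at `i` is, up to the error, `-2` times
the coefficient in the Hamiltonian of the string in which `R` is replaced by `c`
(`exists_error`). By Bessel's inequality the errors have a small sum of squares.

Prepare every qubit in a uniformly random eigenstate of a random Pauli matrix, and measure the qubit
`i` along a random axis. A product over the support of a string `R` of signs and factors `3`
(`trialStat`) then has the coefficient of `R` in the evolved observable as its mean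
(`trialMean_eq`), and its second moment is at most `3 ^ (k + 1)` (`sum_trialWeight_mul_sq`). This
yields estimates for any single coefficient, but there are too many strings to try all of them.

The relevant strings are therefore built up qubit by qubit, from the first qubit of their support
(`Record.tree`). Whether a partial string `α` is worth extending is decided by groups of experiments
in which every qubit is, once for the whole group, either left random or fixed to a random
eigenstate. For such a pattern the mean of the statistic of `α` is a random multilinear form in the
coefficients of the extensions of `α`. Its second moment is at most the sum of the squares of these
coefficients, and so a string whose extensions are light altogether rarely gets the vote of a group
(`voteProb_le`). Conversely, if `α` is part of a large term, then the form is large with probability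
`41 ^ (-k)` at least, up to a constant: this follows from the Paley–Zygmund inequality, since the
degree of the form is bounded by `k`, so that its fourth moment is controlled by its second moment
(`sum_prod_mul_pow_four_le`, `le_voteProb`). Votes of many independent groups separate the two cases
for all strings of weight at most `k` at once (`iidProb_not_typical_le`).

Since every term has at most `2 ^ k` substrings, the number of partial strings that survive is
bounded by the effective sparsity (`card_heavy_le`); clipping is harmless because a single
coefficient of size `ε` makes a string heavy. The size of the search trees bounds the running time
(`wp_processProg`, `time_le`) and the number of non-zero entries of the output. The programs are
verified in a weakest-precondition calculus that counts time; `le_prob` identifies the law of the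
coins and outcomes with that of independent groups of experiments.
-/

namespace HamLearn

/-! ### A weakest-precondition calculus with time -/

/-- The program `p`, started in `σ` with the coins `ω`, halts, and its running time and final state
satisfy `Φ`. -/
def WP (ω : ℕ → Fin 6) (p : Prog) (σ : State) (Φ : ℕ → State → Prop) : Prop :=
  ∃ t σ', Exec ω p σ t σ' ∧ Φ t σ'

/-- Whether the array `b` of natural numbers occurs on the left of an assignment. -/
def Prog.writesNat (b : ℕ) : Prog → Bool
  | .skip => false
  | .setNat a _ _ => Nat.beq a b
  | .setReal _ _ _ => false
  | .toss a _ => Nat.beq a b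
  | .seq p q => p.writesNat b || q.writesNat b
  | .ite _ p q => p.writesNat b || q.writesNat b
  | .while _ p => p.writesNat b

/-- Whether the array `b` of real numbers occurs on the left of an assignment. -/
def Prog.writesReal (b : ℕ) : Prog → Bool
  | .skip => false
  | .setNat _ _ _ => false
  | .setReal a _ _ => Nat.beq a b
  | .toss _ _ => false
  | .seq p q => p.writesReal b || q.writesReal b
  | .ite _ p q => p.writesReal b || q.writesReal b
  | .while _ p => p.writesReal b

/-- Whether a coin toss occurs in the program. -/
def Prog.tosses : Prog → Bool
  | .skip => false
  | .setNat _ _ _ => false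
  | .setReal _ _ _ => false
  | .toss _ _ => true
  | .seq p q => p.tosses || q.tosses
  | .ite _ p q => p.tosses || q.tosses
  | .while _ p => p.tosses

/-- The states `σ` and `σ'` agree on everything that `p` does not write to. -/
structure Frame (p : Prog) (σ σ' : State) : Prop where
  nat : ∀ a, p.writesNat a = false → σ'.nat a = σ.nat a
  real : ∀ a, p.writesReal a = false → σ'.real a = σ.real a
  coins : p.tosses = false → σ'.coins = σ.coins

theorem Frame.refl (p : Prog) (σ : State) : Frame p σ σ :=
  ⟨fun _ _ => rfl, fun _ _ => rfl, fun _ => rfl⟩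

theorem Frame.trans {p : Prog} {σ σ' σ'' : State} (h : Frame p σ σ') (h' : Frame p σ' σ'') :
    Frame p σ σ'' :=
  ⟨fun a ha => (h'.nat a ha).trans (h.nat a ha), fun a ha => (h'.real a ha).trans (h.real a ha),
    fun ht => (h'.coins ht).trans (h.coins ht)⟩

theorem Frame.mono {p q : Prog} {σ σ' : State} (h : Frame p σ σ')
    (hn : ∀ a, q.writesNat a = false → p.writesNat a = false)
    (hr : ∀ a, q.writesReal a = false → p.writesReal a = false)
    (ht : q.tosses = false → p.tosses = false) : Frame q σ σ' :=
  ⟨fun a ha => h.nat a (hn a ha), fun a ha => h.real a (hr a ha), fun h' => h.coins (ht h')⟩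

theorem natBeq_eq_false_iff {a b : ℕ} : Nat.beq a b = false ↔ a ≠ b := by
  rw [← Bool.not_eq_true, Nat.beq_eq]

@[simp] theorem State.setNat_nat_ne (σ : State) {a b : ℕ} (i v : ℕ) (h : b ≠ a) :
    (σ.setNat a i v).nat b = σ.nat b := by
  simp [State.setNat, Function.update_of_ne h]

@[simp] theorem State.setNat_nat_self (σ : State) (a i v : ℕ) :
    (σ.setNat a i v).nat a = Function.update (σ.nat a) i v := by
  simp [State.setNat]

@[simp] theorem State.setNat_real (σ : State) (a i v : ℕ) : (σ.setNat a i v).real = σ.real := rfl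

@[simp] theorem State.setNat_coins (σ : State) (a i v : ℕ) :
    (σ.setNat a i v).coins = σ.coins := rfl

@[simp] theorem State.setReal_real_ne (σ : State) {a b : ℕ} (i : ℕ) (v : ℝ) (h : b ≠ a) :
    (σ.setReal a i v).real b = σ.real b := by
  simp [State.setReal, Function.update_of_ne h]

@[simp] theorem State.setReal_real_self (σ : State) (a i : ℕ) (v : ℝ) :
    (σ.setReal a i v).real a = Function.update (σ.real a) i v := by
  simp [State.setReal]

@[simp] theorem State.setReal_nat (σ : State) (a i : ℕ) (v : ℝ) :
    (σ.setReal a i v).nat = σ.nat := rfl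

/-- An execution changes only those arrays that occur on the left of an assignment. -/
theorem Exec.frame {ω : ℕ → Fin 6} {p : Prog} {σ σ' : State} {t : ℕ} (h : Exec ω p σ t σ') :
    Frame p σ σ' := by
  induction h with
  | skip σ => exact Frame.refl _ _
  | setNat a i e σ =>
    exact ⟨fun b hb => State.setNat_nat_ne _ _ _ (natBeq_eq_false_iff.mp hb).symm,
      fun _ _ => rfl, fun _ => rfl⟩
  | setReal a i e σ =>
    exact ⟨fun _ _ => rfl,
      fun b hb => State.setReal_real_ne _ _ _ (natBeq_eq_false_iff.mp hb).symm, fun _ => rfl⟩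
  | toss a i σ =>
    exact ⟨fun b hb => State.setNat_nat_ne _ _ _ (natBeq_eq_false_iff.mp hb).symm,
      fun _ _ => rfl, fun h => by simp [Prog.tosses] at h⟩
  | seq _ _ ih₁ ih₂ =>
    exact (ih₁.mono (by simp +contextual [Prog.writesNat]) (by simp +contextual [Prog.writesReal])
      (by simp +contextual [Prog.tosses])).trans (ih₂.mono (by simp +contextual [Prog.writesNat])
      (by simp +contextual [Prog.writesReal]) (by simp +contextual [Prog.tosses]))
  | iteTrue _ _ ih =>
    exact ih.mono (by simp +contextual [Prog.writesNat]) (by simp +contextual [Prog.writesReal])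
      (by simp +contextual [Prog.tosses])
  | iteFalse _ _ ih =>
    exact ih.mono (by simp +contextual [Prog.writesNat]) (by simp +contextual [Prog.writesReal])
      (by simp +contextual [Prog.tosses])
  | whileFalse _ => exact Frame.refl _ _
  | whileTrue _ _ _ ih₁ ih₂ =>
    exact (ih₁.mono (by simp [Prog.writesNat]) (by simp [Prog.writesReal])
      (by simp [Prog.tosses])).trans ih₂

variable {ω : ℕ → Fin 6}

theorem WP.mono {p : Prog} {σ : State} {Φ Ψ : ℕ → State → Prop} (h : WP ω p σ Φ)
    (h' : ∀ t τ, Frame p σ τ → Φ t τ → Ψ t τ) : WP ω p σ Ψ := by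
  obtain ⟨t, τ, he, hΦ⟩ := h
  exact ⟨t, τ, he, h' t τ he.frame hΦ⟩

theorem wp_skip {σ : State} {Φ : ℕ → State → Prop} : WP ω .skip σ Φ ↔ Φ 1 σ :=
  ⟨fun ⟨_, _, h, hΦ⟩ => by cases h; exact hΦ, fun h => ⟨_, _, .skip σ, h⟩⟩

theorem wp_setNat {a : ℕ} {i e : NExp} {σ : State} {Φ : ℕ → State → Prop} :
    WP ω (.setNat a i e) σ Φ ↔ Φ (i.cost + e.cost + 1) (σ.setNat a (i.eval σ) (e.eval σ)) :=
  ⟨fun ⟨_, _, h, hΦ⟩ => by cases h; exact hΦ, fun h => ⟨_, _, .setNat a i e σ, h⟩⟩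

theorem wp_setReal {a : ℕ} {i : NExp} {e : RExp} {σ : State} {Φ : ℕ → State → Prop} :
    WP ω (.setReal a i e) σ Φ ↔ Φ (i.cost + e.cost + 1) (σ.setReal a (i.eval σ) (e.eval σ)) :=
  ⟨fun ⟨_, _, h, hΦ⟩ => by cases h; exact hΦ, fun h => ⟨_, _, .setReal a i e σ, h⟩⟩

theorem wp_toss {a : ℕ} {i : NExp} {σ : State} {Φ : ℕ → State → Prop} :
    WP ω (.toss a i) σ Φ ↔
      Φ (i.cost + 1) { σ.setNat a (i.eval σ) (ω σ.coins) with coins := σ.coins + 1 } :=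
  ⟨fun ⟨_, _, h, hΦ⟩ => by cases h; exact hΦ, fun h => ⟨_, _, .toss a i σ, h⟩⟩

theorem wp_seq {p q : Prog} {σ : State} {Φ : ℕ → State → Prop} :
    WP ω (.seq p q) σ Φ ↔ WP ω p σ fun s τ => WP ω q τ fun t τ' => Φ (s + t) τ' := by
  constructor
  · rintro ⟨_, _, h, hΦ⟩
    cases h with
    | seq h₁ h₂ => exact ⟨_, _, h₁, _, _, h₂, hΦ⟩
  · rintro ⟨_, _, h₁, _, _, h₂, hΦ⟩
    exact ⟨_, _, .seq h₁ h₂, hΦ⟩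

theorem wp_ite {b : BExp} {p q : Prog} {σ : State} {Φ : ℕ → State → Prop} :
    WP ω (.ite b p q) σ Φ ↔
      (b.eval σ → WP ω p σ fun t τ => Φ (b.cost + 1 + t) τ) ∧
        (¬ b.eval σ → WP ω q σ fun t τ => Φ (b.cost + 1 + t) τ) := by
  constructor
  · rintro ⟨_, _, h, hΦ⟩
    cases h with
    | iteTrue hb h => exact ⟨fun _ => ⟨_, _, h, hΦ⟩, fun hb' => absurd hb hb'⟩
    | iteFalse hb h => exact ⟨fun hb' => absurd hb' hb, fun _ => ⟨_, _, h, hΦ⟩⟩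
  · rintro ⟨h₁, h₂⟩
    by_cases hb : b.eval σ
    · obtain ⟨t, τ, he, hΦ⟩ := h₁ hb
      exact ⟨_, _, .iteTrue hb he, hΦ⟩
    · obtain ⟨t, τ, he, hΦ⟩ := h₂ hb
      exact ⟨_, _, .iteFalse hb he, hΦ⟩

/-- A loop that makes exactly `hi - lo` rounds. -/
theorem WP.while_count {b : BExp} {p : Prog} {σ : State} {Φ : ℕ → State → Prop}
    (I : ℕ → State → Prop) (lo hi tb : ℕ) (hle : lo ≤ hi) (hinit : I lo σ)
    (hstep : ∀ j τ, lo ≤ j → j < hi → Frame p σ τ → I j τ →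
      b.eval τ ∧ WP ω p τ fun t τ' => t ≤ tb ∧ I (j + 1) τ')
    (hend : ∀ τ, Frame p σ τ → I hi τ → ¬ b.eval τ)
    (hpost : ∀ t τ, Frame p σ τ → I hi τ →
      t ≤ (hi - lo) * (tb + b.cost + 1) + b.cost + 1 → Φ t τ) :
    WP ω (.while b p) σ Φ := by
  have key : ∀ m j τ, lo ≤ j → j + m = hi → Frame p σ τ → I j τ →
      WP ω (.while b p) τ fun t τ' => Frame p σ τ' ∧ I hi τ' ∧
        t ≤ m * (tb + b.cost + 1) + b.cost + 1 := by
    intro m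
    induction m with
    | zero =>
      intro j τ _ hj hf hI
      obtain rfl : j = hi := by omega
      exact ⟨_, _, .whileFalse (hend τ hf hI), hf, hI, by omega⟩
    | succ m ih =>
      intro j τ hlo hj hf hI
      obtain ⟨hb, s, τ', he, hs, hI'⟩ := hstep j τ hlo (by omega) hf hI
      obtain ⟨t, τ'', he', hf', hI'', ht⟩ := ih (j + 1) τ' (by omega) (by omega)
        (hf.trans he.frame) hI'
      refine ⟨_, _, .whileTrue hb he he', hf', hI'', ?_⟩
      rw [Nat.succ_mul]
      omega
  refine (key (hi - lo) lo σ le_rfl (by omega) (Frame.refl _ _) hinit).mono ?_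
  rintro t τ - ⟨hf, hI, ht⟩
  exact hpost t τ hf hI ht

/-- The loop in which the entry `0` of array `i` runs from `e` to `b - 1`. -/
def forLoop (i : ℕ) (e b : NExp) (p : Prog) : Prog :=
  .seq (.setNat i (.const 0) e) (.while (.natLt (.get i (.const 0)) b)
    (.seq p (.setNat i (.const 0) (.add (.get i (.const 0)) (.const 1)))))

/-- The rule for `forLoop`: `I` is the invariant, which must not depend on the loop counter, and
`tb` bounds the time of one round. -/
theorem WP.forLoop {i : ℕ} {e b : NExp} {p : Prog} {σ : State} {Φ : ℕ → State → Prop}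
    (I : ℕ → State → Prop) (lo hi tb : ℕ) (hle : lo ≤ hi) (hi_p : p.writesNat i = false)
    (he : e.eval σ = lo)
    (hI : ∀ j τ v, I j τ → I j (τ.setNat i 0 v))
    (hinit : I lo σ)
    (hb : ∀ τ, Frame (forLoop i e b p) σ τ → b.eval τ = hi)
    (hstep : ∀ j τ, lo ≤ j → j < hi → Frame (HamLearn.forLoop i e b p) σ τ → τ.nat i 0 = j →
      I j τ → WP ω p τ fun t τ' => t ≤ tb ∧ I (j + 1) τ')
    (hpost : ∀ t τ, Frame (HamLearn.forLoop i e b p) σ τ → I hi τ →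
      t ≤ (hi - lo + 1) * (tb + b.cost + 10) + e.cost → Φ t τ) :
    WP ω (HamLearn.forLoop i e b p) σ Φ := by
  set B : Prog := .seq p (.setNat i (.const 0) (.add (.get i (.const 0)) (.const 1))) with hB
  have hfr : ∀ τ, Frame B (σ.setNat i 0 lo) τ → Frame (HamLearn.forLoop i e b p) σ τ := by
    intro τ h
    refine ⟨fun a ha => ?_, fun a ha => h.real a ?_, fun h' => h.coins ?_⟩
    · simp only [HamLearn.forLoop, Prog.writesNat, ← hB, Bool.or_eq_false_iff] at ha
      rw [h.nat a (by simpa [hB, Prog.writesNat] using ha.2), State.setNat_nat_ne]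
      exact (natBeq_eq_false_iff.mp ha.1).symm
    · simpa [HamLearn.forLoop, hB, Prog.writesReal] using ha
    · simpa [HamLearn.forLoop, hB, Prog.tosses] using h'
  unfold HamLearn.forLoop at hfr hb hstep hpost ⊢
  rw [wp_seq, wp_setNat]
  simp only [NExp.eval, he, NExp.cost]
  refine WP.while_count (fun j τ => I j τ ∧ τ.nat i 0 = j) lo hi (tb + 6) hle ?_ ?_ ?_ ?_
  · exact ⟨hI _ _ _ hinit, by simp⟩
  · rintro j τ hlo hhi hf ⟨hIj, hij⟩
    have hF := hfr τ hf
    refine ⟨by simp only [BExp.eval, NExp.eval, hb τ hF, hij]; exact hhi, ?_⟩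
    rw [wp_seq]
    refine (hstep j τ hlo hhi hF hij hIj).mono ?_
    rintro t τ' hf' ⟨ht, hI'⟩
    rw [wp_setNat]
    have hij' : τ'.nat i 0 = j := by rw [hf'.nat i hi_p, hij]
    simp only [NExp.eval, NExp.cost, hij']
    exact ⟨by omega, hI _ _ _ hI', by simp⟩
  · rintro τ hf ⟨-, hij⟩
    simp only [BExp.eval, NExp.eval, hb τ (hfr τ hf), hij, lt_irrefl, not_false_eq_true]
  · rintro t τ hf ⟨hIj, -⟩ ht
    refine hpost _ τ (hfr τ hf) hIj ?_
    simp only [BExp.cost, NExp.cost] at ht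
    rw [Nat.add_mul]
    have : (hi - lo) * (tb + 6 + (1 + 1 + b.cost + 1) + 1) = (hi - lo) * (tb + b.cost + 10) := by
      ring
    omega

end HamLearn

namespace HamLearn

/-! ### The statistic of a partial Pauli string -/

/-! The memory layout. The names of the arrays that hold a single variable, in their entry `0`,
are also used as the names of these variables. Cell `j * n + i` of `aOut`, `aMeas` and `aSeen`
belongs to the qubit `i` in the experiment `j`. The strings in the search tree are the nodes of
linked lists: node `q` adds the label `aVal q` at the qubit `aPos q` to the string of node
`aParent q`, and `aDepth q` is the length of its string. -/

notation "aSize" => (0 : ℕ)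
notation "aOut" => (5 : ℕ)
notation "aMeas" => (4 : ℕ)
notation "aSeen" => (8 : ℕ)
notation "aCell" => (11 : ℕ)
notation "aQubit" => (12 : ℕ)
notation "aTrials" => (13 : ℕ)
notation "aGroups" => (14 : ℕ)
notation "aStride" => (15 : ℕ)
notation "aWalk" => (16 : ℕ)
notation "aDepthIdx" => (17 : ℕ)
notation "aPos" => (18 : ℕ)
notation "aVal" => (19 : ℕ)
notation "aParent" => (20 : ℕ)
notation "aDepth" => (21 : ℕ)
notation "aTail" => (22 : ℕ)
notation "aNode" => (23 : ℕ)
notation "aGroupIdx" => (24 : ℕ)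
notation "aTrialIdx" => (25 : ℕ)
notation "aVotes" => (26 : ℕ)
notation "rStat" => (2 : ℕ)
notation "rSum" => (3 : ℕ)
notation "rScale" => (4 : ℕ)

/-- The entry `0` of an array of natural numbers, used as a variable. -/
def NExp.var (a : ℕ) : NExp := .get a (.const 0)

/-- The entry `0` of an array of real numbers, used as a variable. -/
def RExp.var (a : ℕ) : RExp := .get a (.const 0)

@[simp] theorem NExp.eval_var (σ : State) (a : ℕ) : (NExp.var a).eval σ = σ.nat a 0 := rfl

@[simp] theorem NExp.cost_var (a : ℕ) : (NExp.var a).cost = 2 := rfl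

@[simp] theorem RExp.eval_var (σ : State) (a : ℕ) : (RExp.var a).eval σ = σ.real a 0 := rfl

@[simp] theorem RExp.cost_var (a : ℕ) : (RExp.var a).cost = 2 := rfl

/-- The contribution of one prepared qubit to the statistic: `y` is the code of the prepared
eigenstate (its axis for the eigenvalue `+1`, and its axis plus `3` for the eigenvalue `-1`), and
`v` is the label of a Pauli matrix. The factor `3` compensates for the probability that the random
axis is that of `v`. The code `6` stands for a qubit that must not be used. -/
noncomputable def chi (y v : ℕ) : ℝ := if y + 1 = v then 3 else if y = v + 2 then -3 else 0

/-- The contribution of the measured qubit to the statistic: `u` is the code of the measured axis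
(modulo `3`), `o` the recorded outcome, `P` the label of a Pauli matrix. Again `3` is the inverse
of the probability that the axis is that of `P`. -/
noncomputable def psi (u o P : ℕ) : ℝ :=
  if u + 1 = P then (if o = 0 then 3 else -3)
  else if u = P + 2 then (if o = 0 then 3 else -3) else 0

/-- The statistic, for the experiment whose data start at cell `c`, of the partial Pauli string that
is given by a list of pairs of a qubit and a label. -/
noncomputable def statF (y u o : ℕ → ℕ) (i P c : ℕ) (l : List (ℕ × ℕ)) : ℝ :=
  psi (u (c + i)) (o (c + i)) P * (l.map fun a => chi (y (c + a.1)) a.2).prod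

/-- The linked list that starts at the node `q` begins with the entries of `l`, in nodes below
`B`. The length of the linked list is stored elsewhere. -/
def Walk (pos val par : ℕ → ℕ) (B : ℕ) : ℕ → List (ℕ × ℕ) → Prop
  | _, [] => True
  | q, a :: l => q < B ∧ pos q = a.1 ∧ val q = a.2 ∧ Walk pos val par B (par q) l

theorem Walk.congr {pos val par pos' val' par' : ℕ → ℕ} {B B' : ℕ} (hB : B ≤ B')
    (hp : ∀ q < B, pos' q = pos q) (hv : ∀ q < B, val' q = val q)
    (hr : ∀ q < B, par' q = par q) {q : ℕ} {l : List (ℕ × ℕ)} (h : Walk pos val par B q l) :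
    Walk pos' val' par' B' q l := by
  induction l generalizing q with
  | nil => trivial
  | cons a l ih =>
    obtain ⟨h1, h2, h3, h4⟩ := h
    exact ⟨by omega, by rw [hp q h1, h2], by rw [hv q h1, h3], by rw [hr q h1]; exact ih h4⟩

/-- Initialization of the statistic with the contribution of the measured qubit. -/
def measProg (P : ℕ) : Prog :=
  let u : NExp := .get aMeas (.add (.var aCell) (.var aQubit))
  let o : NExp := .get aOut (.add (.var aCell) (.var aQubit))
  let signed : Prog := .ite (.natEq o (.const 0)) (.setReal rStat (.const 0) (.const 3))
    (.setReal rStat (.const 0) (.const (-3)))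
  .ite (.natEq (.add u (.const 1)) (.const P)) signed
    (.ite (.natEq u (.const (P + 2))) signed (.setReal rStat (.const 0) (.const 0)))

/-- Multiplication of the statistic by the contribution of the node `aWalk`. -/
def factorProg : Prog :=
  let y : NExp := .get aSeen (.add (.var aCell) (.get aPos (.var aWalk)))
  let v : NExp := .get aVal (.var aWalk)
  .seq (.ite (.natEq (.add y (.const 1)) v)
    (.setReal rStat (.const 0) (.mul (.var rStat) (.const 3)))
    (.ite (.natEq y (.add v (.const 2)))
      (.setReal rStat (.const 0) (.mul (.var rStat) (.const (-3))))
      (.setReal rStat (.const 0) (.const 0))))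
    (.setNat aWalk (.const 0) (.get aParent (.var aWalk)))

/-- The statistic of the string with node `aNode` for the experiment at `aCell`. -/
def statProg (P : ℕ) : Prog :=
  .seq (measProg P) (.seq (.setNat aWalk (.const 0) (.var aNode))
    (forLoop aDepthIdx (.const 0) (.get aDepth (.var aNode)) factorProg))

variable {ω : ℕ → Fin 6}

theorem wp_measProg (P : ℕ) (σ : State) :
    WP ω (measProg P) σ fun t τ => t ≤ 60 ∧ τ.real rStat 0 =
      psi (σ.nat aMeas (σ.nat aCell 0 + σ.nat aQubit 0))
        (σ.nat aOut (σ.nat aCell 0 + σ.nat aQubit 0)) P := by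
  simp only [measProg, wp_ite, wp_setReal, BExp.eval, NExp.eval, NExp.eval_var, RExp.eval,
    BExp.cost, NExp.cost, NExp.cost_var, RExp.cost, State.setReal_real_self, Function.update_self,
    psi]
  refine ⟨fun h => ⟨fun h' => ?_, fun h' => ?_⟩, fun h => ⟨fun h' => ⟨fun h'' => ?_, fun h'' => ?_⟩,
    fun h' => ?_⟩⟩ <;> simp [*]

theorem wp_factorProg {σ : State} {a : ℕ × ℕ} (hp : σ.nat aPos (σ.nat aWalk 0) = a.1)
    (hv : σ.nat aVal (σ.nat aWalk 0) = a.2) :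
    WP ω factorProg σ fun t τ => t ≤ 60 ∧
      τ.real rStat 0 = σ.real rStat 0 * chi (σ.nat aSeen (σ.nat aCell 0 + a.1)) a.2 ∧
      τ.nat aWalk 0 = σ.nat aParent (σ.nat aWalk 0) := by
  simp only [factorProg, wp_seq, wp_ite, wp_setReal, wp_setNat, BExp.eval, NExp.eval,
    NExp.eval_var, RExp.eval, RExp.eval_var, RExp.cost_var,
    BExp.cost, NExp.cost, NExp.cost_var, RExp.cost, State.setReal_real_self, Function.update_self,
    State.setReal_nat, State.setNat_nat_self, State.setNat_real, chi, hp, hv]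
  refine ⟨fun h => ?_, fun h => ⟨fun h' => ?_, fun h' => ?_⟩⟩
  · simp [*]
  · have : ¬ a.2 + 2 + 1 = a.2 := by omega
    simp [*]
  · simp [*]

theorem wp_statProg (P : ℕ) {σ : State} {l : List (ℕ × ℕ)} {B : ℕ}
    (hw : Walk (σ.nat aPos) (σ.nat aVal) (σ.nat aParent) B (σ.nat aNode 0) l)
    (hd : σ.nat aDepth (σ.nat aNode 0) = l.length) :
    WP ω (statProg P) σ fun t τ => t ≤ 160 * (l.length + 1) ∧
      τ.real rStat 0 =
        statF (σ.nat aSeen) (σ.nat aMeas) (σ.nat aOut) (σ.nat aQubit 0) P (σ.nat aCell 0) l := by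
  rw [statProg, wp_seq]
  refine (wp_measProg P σ).mono ?_
  rintro t₁ τ₁ hf₁ ⟨ht₁, hx₁⟩
  have hn : τ₁.nat = σ.nat := funext fun a => hf₁.nat a rfl
  rw [wp_seq, wp_setNat]
  refine WP.forLoop (fun j τ => Walk (σ.nat aPos) (σ.nat aVal) (σ.nat aParent) B (τ.nat aWalk 0)
    (l.drop j) ∧ τ.real rStat 0 = psi (σ.nat aMeas (σ.nat aCell 0 + σ.nat aQubit 0))
        (σ.nat aOut (σ.nat aCell 0 + σ.nat aQubit 0)) P *
      ((l.take j).map fun a => chi (σ.nat aSeen (σ.nat aCell 0 + a.1)) a.2).prod)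
    0 l.length 60 (Nat.zero_le _) rfl rfl ?_ ?_ ?_ ?_ ?_
  · intro j τ v h
    simpa using h
  · simpa [NExp.eval, hn, hx₁] using hw
  · intro τ hf
    have h1 := hf.nat aNode rfl
    have h2 := hf.nat aDepth rfl
    simp [NExp.eval, h1, h2, hn, hd]
  · rintro j τ - hj hf - ⟨hwj, hxj⟩
    have e1 := hf.nat aPos rfl
    have e2 := hf.nat aVal rfl
    have e3 := hf.nat aParent rfl
    have e4 := hf.nat aSeen rfl
    have e5 := hf.nat aCell rfl
    simp only [State.setNat_nat_ne _ _ _ (show aPos ≠ aWalk by decide),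
      State.setNat_nat_ne _ _ _ (show aVal ≠ aWalk by decide),
      State.setNat_nat_ne _ _ _ (show aParent ≠ aWalk by decide),
      State.setNat_nat_ne _ _ _ (show aSeen ≠ aWalk by decide),
      State.setNat_nat_ne _ _ _ (show aCell ≠ aWalk by decide), NExp.eval, hn] at e1 e2 e3 e4 e5
    rw [List.drop_eq_getElem_cons hj] at hwj
    obtain ⟨-, hp, hv, hwj⟩ := hwj
    refine (wp_factorProg (a := l[j]) (by rw [e1, hp]) (by rw [e2, hv])).mono ?_
    rintro t τ' - ⟨ht, hx, hq⟩
    refine ⟨ht, by rw [hq, e3]; exact hwj, ?_⟩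
    rw [hx, hxj, e4, e5, List.take_add_one, List.getElem?_eq_getElem hj, Option.toList_some,
      List.map_append, List.prod_append, List.map_singleton, List.prod_singleton, mul_assoc]
  · rintro t τ - ⟨-, hx⟩ ht
    refine ⟨?_, by rw [hx, List.take_length, statF]⟩
    simp only [NExp.cost, NExp.cost_var] at ht ⊢
    omega

end HamLearn

namespace HamLearn

/-! ### Votes and estimates -/

/-- What the processing program reads: the parameters, and the codes of the prepared states, the
codes of the measured axes and the outcomes, cell by cell. There are `M` groups of `2 * T`
experiments; `D` is the scale of the threshold for the votes. -/
structure Record where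
  n : ℕ
  k : ℕ
  T : ℕ
  M : ℕ
  ε : ℝ
  D : ℝ
  y : ℕ → ℕ
  u : ℕ → ℕ
  o : ℕ → ℕ

/-- The memory `σ` contains the record `e`. -/
structure Env (σ : State) (e : Record) : Prop where
  size : σ.nat aSize 0 = e.n
  locality : σ.nat aSize 1 = e.k
  trials : σ.nat aTrials 0 = e.T
  groups : σ.nat aGroups 0 = e.M
  stride : σ.nat aStride 0 = e.T * e.n
  accuracy : σ.real 0 0 = e.ε
  scale : σ.real rScale 0 = e.D
  seen : σ.nat aSeen = e.y
  meas : σ.nat aMeas = e.u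
  out : σ.nat aOut = e.o

/-- The program writes to none of the arrays that `Env` is about. -/
def Prog.keepsRecord (p : Prog) : Bool :=
  [aSize, aTrials, aGroups, aStride, aSeen, aMeas, aOut].all (fun a => !p.writesNat a) &&
    [0, rScale].all (fun a => !p.writesReal a)

theorem Env.frame {p : Prog} {σ τ : State} {e : Record} (h : Env σ e)
    (hf : Frame p σ τ) (hp : p.keepsRecord = true) : Env τ e := by
  simp only [Prog.keepsRecord, List.all_cons, List.all_nil, Bool.and_true, Bool.and_eq_true,
    Bool.not_eq_true'] at hp
  obtain ⟨⟨h0, h1, h2, h3, h4, h5, h6⟩, h7, h8⟩ := hp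
  constructor
  · rw [hf.nat _ h0, h.size]
  · rw [hf.nat _ h0, h.locality]
  · rw [hf.nat _ h1, h.trials]
  · rw [hf.nat _ h2, h.groups]
  · rw [hf.nat _ h3, h.stride]
  · rw [hf.real _ h7, h.accuracy]
  · rw [hf.real _ h8, h.scale]
  · rw [hf.nat _ h4, h.seen]
  · rw [hf.nat _ h5, h.meas]
  · rw [hf.nat _ h6, h.out]

theorem Env.setNat {σ : State} {e : Record} (h : Env σ e) (a i v : ℕ)
    (ha : [aSize, aTrials, aGroups, aStride, aSeen, aMeas, aOut].contains a = false) :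
    Env (σ.setNat a i v) e := by
  refine h.frame (p := .setNat a (.const i) (.const v)) (Exec.frame (ω := 0)
    (Exec.setNat a (.const i) (.const v) σ)) ?_
  simp only [List.contains_eq_mem, decide_eq_false_iff_not, List.mem_cons, not_or] at ha
  simp [Prog.keepsRecord, Prog.writesNat, Prog.writesReal, natBeq_eq_false_iff]
  tauto

theorem Env.setReal {σ : State} {e : Record} (h : Env σ e) (a i : ℕ) (v : ℝ)
    (h0 : a ≠ 0) (h4 : a ≠ rScale) : Env (σ.setReal a i v) e where
  size := h.size
  locality := h.locality
  trials := h.trials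
  groups := h.groups
  stride := h.stride
  accuracy := by rw [State.setReal_real_ne _ _ _ h0.symm]; exact h.accuracy
  scale := by rw [State.setReal_real_ne _ _ _ h4.symm]; exact h.scale
  seen := h.seen
  meas := h.meas
  out := h.out

/-- The sum of the statistic over `T` consecutive experiments, beginning with number `j`. -/
noncomputable def Record.trialSum (e : Record) (i P j : ℕ) (l : List (ℕ × ℕ)) : ℝ :=
  ∑ t ∈ Finset.range e.T, statF e.y e.u e.o i P ((j + t) * e.n) l

/-- Addition of the statistics of `T` consecutive experiments to `rSum`. -/
def sumProg (P : ℕ) : Prog :=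
  forLoop aTrialIdx (.const 0) (.var aTrials)
    (.seq (statProg P) (.seq (.setReal rSum (.const 0) (.add (.var rSum) (.var rStat)))
      (.setNat aCell (.const 0) (.add (.var aCell) (.get aSize (.const 0))))))

/-- The node `q` in the memory carries the string `l`. -/
def IsNode (σ : State) (q : ℕ) (l : List (ℕ × ℕ)) : Prop :=
  σ.nat aDepth q = l.length ∧ Walk (σ.nat aPos) (σ.nat aVal) (σ.nat aParent) (q + 1) q l

theorem IsNode.frame {p : Prog} {σ τ : State} {q : ℕ} {l : List (ℕ × ℕ)} (h : IsNode σ q l)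
    (hf : Frame p σ τ)
    (hp : [aDepth, aPos, aVal, aParent].all (fun a => !p.writesNat a) = true) :
    IsNode τ q l := by
  simp only [List.all_cons, List.all_nil, Bool.and_true, Bool.and_eq_true,
    Bool.not_eq_true'] at hp
  rw [IsNode, hf.nat _ hp.1, hf.nat _ hp.2.1, hf.nat _ hp.2.2.1, hf.nat _ hp.2.2.2]
  exact h

variable {ω : ℕ → Fin 6}

theorem wp_sumProg (P : ℕ) {σ : State} {e : Record} {l : List (ℕ × ℕ)} {q j : ℕ} (he : Env σ e)
    (hq : σ.nat aNode 0 = q) (hl : IsNode σ q l) (hc : σ.nat aCell 0 = j * e.n) :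
    WP ω (sumProg P) σ fun t τ => t ≤ (e.T + 1) * (160 * (l.length + 1) + 40) ∧
      τ.real rSum 0 = σ.real rSum 0 + e.trialSum (σ.nat aQubit 0) P j l ∧
      τ.nat aCell 0 = (j + e.T) * e.n := by
  refine WP.forLoop (fun s τ => τ.nat aCell 0 = (j + s) * e.n ∧ τ.real rSum 0 = σ.real rSum 0 +
    ∑ t ∈ Finset.range s, statF e.y e.u e.o (σ.nat aQubit 0) P ((j + t) * e.n) l)
    0 e.T (160 * (l.length + 1) + 25) (Nat.zero_le _) ?_ rfl ?_ ?_ ?_ ?_ ?_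
  · rfl
  · intro j τ v h
    simpa using h
  · simpa using hc
  · intro τ hf
    simp [(he.frame hf rfl).trials]
  · rintro s τ - hs hf - ⟨hcs, hss⟩
    have he' := he.frame hf rfl
    have hl' := hl.frame hf rfl
    have hq' : τ.nat aNode 0 = q := by rw [hf.nat _ rfl, hq]
    rw [wp_seq]
    refine (wp_statProg P (σ := τ) (by rw [hq']; exact hl'.2) (by rw [hq']; exact hl'.1)).mono ?_
    rintro t τ' hf' ⟨ht, hx⟩
    have he'' := he'.frame hf' rfl
    rw [wp_seq, wp_setReal, wp_setNat]
    simp only [NExp.eval, NExp.eval_var, RExp.eval, RExp.eval_var, NExp.cost, NExp.cost_var,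
      RExp.cost, RExp.cost_var, State.setNat_nat_self, Function.update_self, State.setReal_nat,
      State.setNat_real, State.setReal_real_self, he''.size]
    refine ⟨by omega, ?_, ?_⟩
    · rw [hf'.nat _ rfl, hcs]
      ring
    · rw [hf'.real _ rfl, hss, hx, Finset.sum_range_succ, he'.seen, he'.meas, he'.out, hcs,
        hf.nat aQubit rfl, add_assoc]
  · rintro t τ - ⟨h1, h2⟩ ht
    refine ⟨ht.trans ?_, h2, h1⟩
    simp only [NExp.cost, NExp.cost_var, Nat.sub_zero]
    ring_nf
    omega

/-- The number of groups of experiments in which the statistic of `l` is large on average. Only the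
second half of a group is used. -/
noncomputable def Record.votes (e : Record) (i P : ℕ) (l : List (ℕ × ℕ)) : ℕ :=
  ((Finset.range e.M).filter fun m =>
    ¬ e.trialSum i P (m * (2 * e.T) + e.T) l * e.trialSum i P (m * (2 * e.T) + e.T) l <
      (e.ε * e.T) * (e.ε * e.T)).card

/-- Counting of the votes for the node `aNode`. -/
def voteProg (P : ℕ) : Prog :=
  .seq (.setNat aVotes (.const 0) (.const 0)) (.seq (.setNat aCell (.const 0) (.const 0))
    (forLoop aGroupIdx (.const 0) (.var aGroups)
      (.seq (.setNat aCell (.const 0) (.add (.var aCell) (.var aStride)))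
      (.seq (.setReal rSum (.const 0) (.const 0))
      (.seq (sumProg P)
        (.ite (.realLt (.mul (.var rSum) (.var rSum))
            (.mul (.mul (.get 0 (.const 0)) (.ofNat (.var aTrials)))
              (.mul (.get 0 (.const 0)) (.ofNat (.var aTrials))))) .skip
          (.setNat aVotes (.const 0) (.add (.var aVotes) (.const 1)))))))))

/-- A bound for the time of one pass over all experiments, for strings of weight at most `d`. -/
def Record.passTime (e : Record) (d : ℕ) : ℕ := 500 * ((e.M + 1) * ((e.T + 1) * (d + 1)))

theorem passTime_bound (M T d : ℕ) :
    (M + 1) * ((T + 1) * (160 * (d + 1) + 40) + 100) + 40 ≤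
      500 * ((M + 1) * ((T + 1) * (d + 1))) := by
  have h1 : 1 ≤ (T + 1) * (d + 1) := Nat.mul_pos (by omega) (by omega)
  have h2 : (T + 1) * (160 * (d + 1) + 40) ≤ 200 * ((T + 1) * (d + 1)) := by
    calc _ ≤ (T + 1) * (200 * (d + 1)) := Nat.mul_le_mul_left _ (by omega)
      _ = _ := by ring
  have h3 : (M + 1) * ((T + 1) * (160 * (d + 1) + 40) + 100) ≤
      (M + 1) * (300 * ((T + 1) * (d + 1))) := Nat.mul_le_mul_left _ (by omega)
  have h4 : 1 ≤ (M + 1) * ((T + 1) * (d + 1)) := Nat.mul_pos (by omega) h1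
  have h5 : (M + 1) * (300 * ((T + 1) * (d + 1))) = 300 * ((M + 1) * ((T + 1) * (d + 1))) := by
    ring
  linarith

theorem wp_voteProg (P : ℕ) {σ : State} {e : Record} {l : List (ℕ × ℕ)} {q : ℕ} (he : Env σ e)
    (hq : σ.nat aNode 0 = q) (hl : IsNode σ q l) :
    WP ω (voteProg P) σ fun t τ => t ≤ e.passTime l.length ∧
      τ.nat aVotes 0 = e.votes (σ.nat aQubit 0) P l := by
  rw [voteProg, wp_seq, wp_setNat, wp_seq, wp_setNat]
  simp only [NExp.eval, NExp.cost]
  set σ' := (σ.setNat aVotes 0 0).setNat aCell 0 0 with hσ'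
  have he' : Env σ' e := (he.setNat _ _ _ rfl).setNat _ _ _ rfl
  have hq' : σ'.nat aNode 0 = q := by simpa [hσ'] using hq
  have hl' : IsNode σ' q l := by simpa [hσ', IsNode] using hl
  have hi' : σ'.nat aQubit 0 = σ.nat aQubit 0 := by simp [hσ']
  rw [← hi']
  have hv' : σ'.nat aVotes 0 = 0 := by simp [hσ']
  have hc' : σ'.nat aCell 0 = 0 := by simp [hσ']
  clear_value σ'
  refine WP.forLoop (fun m τ => τ.nat aCell 0 = (m * (2 * e.T)) * e.n ∧ τ.nat aVotes 0 =
    ((Finset.range m).filter fun m =>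
    ¬ e.trialSum (σ'.nat aQubit 0) P (m * (2 * e.T) + e.T) l *
      e.trialSum (σ'.nat aQubit 0) P (m * (2 * e.T) + e.T) l <
      (e.ε * e.T) * (e.ε * e.T)).card)
    0 e.M ((e.T + 1) * (160 * (l.length + 1) + 40) + 60) (Nat.zero_le _) ?_ rfl ?_ ?_ ?_ ?_ ?_
  · rfl
  · intro j τ v h
    simpa using h
  · simpa [hv'] using hc'
  · intro τ hf
    simp [(he'.frame hf rfl).groups]
  · rintro m τ - hm hf - ⟨hcm, hvm⟩
    have he₁ := he'.frame hf rfl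
    have hl₁ := hl'.frame hf rfl
    have hq₁ : τ.nat aNode 0 = q := by rw [hf.nat _ rfl, hq']
    have hi₁ : τ.nat aQubit 0 = σ'.nat aQubit 0 := by rw [hf.nat _ rfl]
    rw [wp_seq, wp_setNat, wp_seq, wp_setReal, wp_seq]
    simp only [NExp.eval, NExp.cost, NExp.eval_var, NExp.cost_var, RExp.eval, RExp.cost]
    refine (wp_sumProg P (e := e) (l := l) (q := q) (j := m * (2 * e.T) + e.T)
      ((he₁.setNat _ _ _ rfl).setReal _ _ _ (by decide) (by decide))
      (by simpa using hq₁) (by simpa [IsNode] using hl₁) ?_).mono ?_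
    · simp only [State.setReal_nat, State.setNat_nat_self, Function.update_self, hcm, he₁.stride]
      ring
    · rintro t τ₂ hf₂ ⟨ht, hs, hc⟩
      have he₂ : Env τ₂ e :=
        ((he₁.setNat _ _ _ rfl).setReal _ _ _ (by decide) (by decide)).frame hf₂ rfl
      have hv₂ : τ₂.nat aVotes 0 = τ.nat aVotes 0 := by
        rw [hf₂.nat _ rfl]
        simp
      simp only [State.setReal_nat, State.setNat_real, State.setReal_real_self,
        Function.update_self, Rat.cast_zero, zero_add,
        State.setNat_nat_ne _ _ _ (show aQubit ≠ aCell by decide), hi₁] at hs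
      have hc₂ : τ₂.nat aCell 0 = (m + 1) * (2 * e.T) * e.n := by
        rw [hc]
        ring
      rw [wp_ite, wp_skip, wp_setNat]
      simp only [BExp.eval, BExp.cost, NExp.eval, NExp.cost, NExp.eval_var, NExp.cost_var,
        RExp.eval, RExp.cost, RExp.eval_var, RExp.cost_var, he₂.accuracy, he₂.trials, hs]
      refine ⟨fun h => ⟨by omega, hc₂, ?_⟩, fun h => ⟨by omega, by simpa using hc₂, ?_⟩⟩
      · rw [Finset.range_add_one, Finset.filter_insert, if_neg (not_not.mpr h), hv₂, hvm]
      · rw [Finset.range_add_one, Finset.filter_insert, if_pos h,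
          Finset.card_insert_of_notMem (by simp), hv₂, hvm]
        simp
  · rintro t τ - ⟨-, h2⟩ ht
    refine ⟨?_, h2⟩
    have := passTime_bound e.M e.T l.length
    simp only [NExp.cost, NExp.cost_var, Nat.sub_zero] at ht
    rw [Record.passTime]
    have h3 : (e.M + 1) * ((e.T + 1) * (160 * (l.length + 1) + 40) + 60 + 2 + 10) ≤
      (e.M + 1) * ((e.T + 1) * (160 * (l.length + 1) + 40) + 100) :=
      Nat.mul_le_mul_left _ (by omega)
    omega

/-- The sum of the statistic over all experiments of the first kind, which are the first halves of
the groups. -/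
noncomputable def Record.totalSum (e : Record) (i P : ℕ) (l : List (ℕ × ℕ)) : ℝ :=
  ∑ m ∈ Finset.range e.M, e.trialSum i P (m * (2 * e.T)) l

/-- Summation of the statistic of the node `aNode` over all experiments of the first kind. -/
def totalProg (P : ℕ) : Prog :=
  .seq (.setReal rSum (.const 0) (.const 0)) (.seq (.setNat aCell (.const 0) (.const 0))
    (forLoop aGroupIdx (.const 0) (.var aGroups)
      (.seq (sumProg P) (.setNat aCell (.const 0) (.add (.var aCell) (.var aStride))))))

theorem wp_totalProg (P : ℕ) {σ : State} {e : Record} {l : List (ℕ × ℕ)} {q : ℕ} (he : Env σ e)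
    (hq : σ.nat aNode 0 = q) (hl : IsNode σ q l) :
    WP ω (totalProg P) σ fun t τ => t ≤ e.passTime l.length ∧
      τ.real rSum 0 = e.totalSum (σ.nat aQubit 0) P l := by
  rw [totalProg, wp_seq, wp_setReal, wp_seq, wp_setNat]
  simp only [NExp.eval, NExp.cost, RExp.eval, RExp.cost]
  set σ' := (σ.setReal rSum 0 (0 : ℚ)).setNat aCell 0 0 with hσ'
  have he' : Env σ' e := (he.setReal _ _ _ (by decide) (by decide)).setNat _ _ _ rfl
  have hq' : σ'.nat aNode 0 = q := by simpa [hσ'] using hq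
  have hl' : IsNode σ' q l := by simpa [hσ', IsNode] using hl
  have hi' : σ'.nat aQubit 0 = σ.nat aQubit 0 := by simp [hσ']
  rw [← hi']
  have hv' : σ'.real rSum 0 = 0 := by simp [hσ']
  have hc' : σ'.nat aCell 0 = 0 := by simp [hσ']
  clear_value σ'
  refine WP.forLoop (fun m τ => τ.nat aCell 0 = (m * (2 * e.T)) * e.n ∧ τ.real rSum 0 =
    ∑ m ∈ Finset.range m, e.trialSum (σ'.nat aQubit 0) P (m * (2 * e.T)) l)
    0 e.M ((e.T + 1) * (160 * (l.length + 1) + 40) + 60) (Nat.zero_le _) ?_ rfl ?_ ?_ ?_ ?_ ?_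
  · rfl
  · intro j τ v h
    simpa using h
  · simpa [hv'] using hc'
  · intro τ hf
    simp [(he'.frame hf rfl).groups]
  · rintro m τ - hm hf - ⟨hcm, hvm⟩
    have he₁ := he'.frame hf rfl
    have hl₁ := hl'.frame hf rfl
    have hq₁ : τ.nat aNode 0 = q := by rw [hf.nat _ rfl, hq']
    have hi₁ : τ.nat aQubit 0 = σ'.nat aQubit 0 := by rw [hf.nat _ rfl]
    rw [wp_seq]
    refine (wp_sumProg P (e := e) (l := l) (q := q) he₁ hq₁ hl₁ hcm).mono ?_
    rintro t τ₂ hf₂ ⟨ht, hs, hc⟩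
    have he₂ : Env τ₂ e := he₁.frame hf₂ rfl
    rw [wp_setNat]
    simp only [NExp.eval, NExp.cost, NExp.eval_var, NExp.cost_var, hc, he₂.stride,
      State.setNat_real, State.setNat_nat_self, Function.update_self]
    refine ⟨by omega, by ring, ?_⟩
    rw [hs, hvm, Finset.sum_range_succ, hi₁]
  · rintro t τ - ⟨-, h2⟩ ht
    refine ⟨?_, h2⟩
    have := passTime_bound e.M e.T l.length
    simp only [NExp.cost, NExp.cost_var, Nat.sub_zero] at ht
    rw [Record.passTime]
    have h3 : (e.M + 1) * ((e.T + 1) * (160 * (l.length + 1) + 40) + 60 + 2 + 10) ≤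
      (e.M + 1) * ((e.T + 1) * (160 * (l.length + 1) + 40) + 100) :=
      Nat.mul_le_mul_left _ (by omega)
    omega

end HamLearn

namespace HamLearn

/-! ### The search tree -/

notation "aNext" => (27 : ℕ)
notation "aHead" => (28 : ℕ)
notation "aOldTail" => (29 : ℕ)

/-- The memory holds the list `LL` of strings, in the nodes `0, 1, …`. -/
def Nodes (σ : State) (LL : List (List (ℕ × ℕ))) : Prop :=
  σ.nat aTail 0 = LL.length ∧ ∀ h (hh : h < LL.length), IsNode σ h LL[h]

theorem Nodes.setNat {σ : State} {LL : List (List (ℕ × ℕ))} (h : Nodes σ LL) (a i v : ℕ)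
    (ha : [aDepth, aPos, aVal, aParent, aTail].contains a = false) : Nodes (σ.setNat a i v) LL := by
  simp only [List.contains_eq_mem, decide_eq_false_iff_not, List.mem_cons, not_or] at ha
  obtain ⟨h1, h2, h3, h4, h5, -⟩ := ha
  refine ⟨?_, fun q hq => ?_⟩
  · rw [State.setNat_nat_ne _ _ _ (Ne.symm h5)]
    exact h.1
  · rw [IsNode, State.setNat_nat_ne _ _ _ (Ne.symm h1), State.setNat_nat_ne _ _ _ (Ne.symm h2),
      State.setNat_nat_ne _ _ _ (Ne.symm h3), State.setNat_nat_ne _ _ _ (Ne.symm h4)]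
    exact h.2 q hq

/-- The string `l` gets many votes. This is the negation of the test that the program makes. -/
def Record.live (e : Record) (i P : ℕ) (l : List (ℕ × ℕ)) : Prop :=
  ¬ ((e.votes i P l : ℝ) * 16 * e.D < e.M)

open Classical in
/-- The string `l` itself if it gets many votes. -/
noncomputable def Record.ifLive (e : Record) (i P : ℕ) (l : List (ℕ × ℕ)) : List (List (ℕ × ℕ)) :=
  if e.live i P l then [l] else []

/-- The extensions of `l` to the qubit `p` that get many votes. -/
noncomputable def Record.children (e : Record) (i P p : ℕ) (l : List (ℕ × ℕ)) :
    List (List (ℕ × ℕ)) :=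
  if l.length < e.k then
    e.ifLive i P ((p, 1) :: l) ++ e.ifLive i P ((p, 2) :: l) ++ e.ifLive i P ((p, 3) :: l)
  else []

/-- One stage of the search: all strings in the list are extended to the qubit `p`. -/
noncomputable def Record.stage (e : Record) (i P : ℕ) (LL : List (List (ℕ × ℕ))) (p : ℕ) :
    List (List (ℕ × ℕ)) :=
  LL ++ LL.flatMap (e.children i P p)

/-- The list of strings found when all qubits between `i` and `j` have been treated. The search
starts with the label `R` at the qubit `i`. -/
noncomputable def Record.tree (e : Record) (i P R j : ℕ) : List (List (ℕ × ℕ)) :=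
  (List.range' (i + 1) (j - (i + 1))).foldl (e.stage i P) [[(i, R)]]

theorem Record.tree_start (e : Record) (i P R : ℕ) : e.tree i P R (i + 1) = [[(i, R)]] := by
  simp [Record.tree]

theorem Record.tree_succ (e : Record) (i P R : ℕ) {j : ℕ} (hj : i + 1 ≤ j) :
    e.tree i P R (j + 1) = e.stage i P (e.tree i P R j) j := by
  rw [Record.tree, Record.tree, Nat.sub_add_comm hj, List.range'_1_concat, List.foldl_append,
    Nat.add_sub_cancel' hj]
  rfl

theorem Record.tree_length_mono (e : Record) (i P R : ℕ) {j j' : ℕ} (hj : i + 1 ≤ j)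
    (h : j ≤ j') : (e.tree i P R j).length ≤ (e.tree i P R j').length := by
  induction j', h using Nat.le_induction with
  | base => rfl
  | succ m hm ih =>
    rw [e.tree_succ i P R (hj.trans hm), Record.stage, List.length_append]
    omega

theorem Record.passTime_mono (e : Record) {d d' : ℕ} (h : d ≤ d') : e.passTime d ≤ e.passTime d' :=
  Nat.mul_le_mul_left _ (Nat.mul_le_mul_left _ (Nat.mul_le_mul_left _ (by omega)))

/-- Extension of the node `aHead` to the qubit `aNext` with the label `v`. The new node is written
behind the last one, and it is kept if it gets many votes. -/
def tryProg (P v : ℕ) : Prog :=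
  .seq (.setNat aPos (.var aTail) (.var aNext))
  (.seq (.setNat aVal (.var aTail) (.const v))
  (.seq (.setNat aParent (.var aTail) (.var aHead))
  (.seq (.setNat aDepth (.var aTail) (.add (.get aDepth (.var aHead)) (.const 1)))
  (.seq (.setNat aNode (.const 0) (.var aTail))
  (.seq (voteProg P)
  (.ite (.realLt (.mul (.mul (.ofNat (.var aVotes)) (.const 16)) (.var rScale))
      (.ofNat (.var aGroups))) .skip
    (.setNat aTail (.const 0) (.add (.var aTail) (.const 1)))))))))

variable {ω : ℕ → Fin 6}

theorem wp_tryProg (P v : ℕ) {σ : State} {e : Record} {LL : List (List (ℕ × ℕ))} {h : ℕ}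
    (he : Env σ e) (hL : Nodes σ LL) (hh : h < LL.length) (hσ : σ.nat aHead 0 = h) :
    WP ω (tryProg P v) σ fun t τ => t ≤ e.passTime (LL[h].length + 1) + 100 ∧
      Nodes τ (LL ++ e.ifLive (σ.nat aQubit 0) P ((σ.nat aNext 0, v) :: LL[h])) := by
  obtain ⟨hT, hN⟩ := hL
  rw [tryProg]
  simp only [wp_seq, wp_setNat, NExp.eval, NExp.eval_var, NExp.cost, NExp.cost_var, ne_eq,
    Nat.reduceEqDiff, not_false_eq_true, State.setNat_nat_ne, hT, hσ]
  set l := LL[h] with hl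
  set B := LL.length with hB
  set σ₁ := ((((σ.setNat aPos B (σ.nat aNext 0)).setNat aVal B v).setNat aParent B h).setNat
    aDepth B (σ.nat aDepth h + 1)).setNat aNode 0 B with hσ₁
  have he₁ : Env σ₁ e := ((((he.setNat _ _ _ rfl).setNat _ _ _ rfl).setNat _ _ _ rfl).setNat
    _ _ _ rfl).setNat _ _ _ rfl
  have hwalk : ∀ q (hq : q < B),
      Walk (σ₁.nat aPos) (σ₁.nat aVal) (σ₁.nat aParent) (q + 1) q LL[q] := by
    intro q hq
    refine Walk.congr le_rfl ?_ ?_ ?_ (hN q hq).2 <;> intro r hr <;>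
      simp [hσ₁, Function.update_of_ne (show r ≠ B by omega)]
  have hold : ∀ q (hq : q < B), IsNode σ₁ q LL[q] := by
    intro q hq
    refine ⟨?_, hwalk q hq⟩
    simp [hσ₁, Function.update_of_ne (show q ≠ B by omega), (hN q hq).1]
  have hnew : IsNode σ₁ B ((σ.nat aNext 0, v) :: l) := by
    refine ⟨by simp [hσ₁, (hN h hh).1, hl], by omega, by simp [hσ₁], by simp [hσ₁], ?_⟩
    have : σ₁.nat aParent B = h := by simp [hσ₁]
    rw [this]
    exact Walk.congr (by omega) (fun _ _ => rfl) (fun _ _ => rfl) (fun _ _ => rfl) (hwalk h hh)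
  have hi₁ : σ₁.nat aQubit 0 = σ.nat aQubit 0 := by simp [hσ₁]
  have hT₁ : σ₁.nat aTail 0 = B := by simpa [hσ₁] using hT
  have hn₁ : σ₁.nat aNode 0 = B := by simp [hσ₁]
  clear_value σ₁
  refine (wp_voteProg P he₁ hn₁ hnew).mono ?_
  rintro t τ hf ⟨ht, hv⟩
  have he₂ := he₁.frame hf rfl
  have hT₂ : τ.nat aTail 0 = B := by rw [hf.nat _ rfl, hT₁]
  have hlive : ((τ.nat aVotes 0 : ℝ) * 16 * e.D < e.M) ↔
      ¬ e.live (σ.nat aQubit 0) P ((σ.nat aNext 0, v) :: l) := by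
    rw [Record.live, not_not, hv, hi₁]
  rw [wp_ite, wp_skip, wp_setNat]
  simp only [BExp.eval, BExp.cost, NExp.eval, NExp.cost, NExp.eval_var, NExp.cost_var,
    RExp.eval, RExp.cost, RExp.eval_var, RExp.cost_var, he₂.scale, he₂.groups, Rat.cast_ofNat,
    hlive, not_not, hT₂, List.length_cons] at ht ⊢
  have hold₂ : ∀ q (hq : q < B), IsNode τ q LL[q] := fun q hq => (hold q hq).frame hf rfl
  refine ⟨fun hc => ⟨by omega, ?_⟩, fun hc => ⟨by omega, ?_⟩⟩
  · rw [Record.ifLive, if_neg hc, List.append_nil]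
    exact ⟨hT₂, hold₂⟩
  · rw [Record.ifLive, if_pos hc]
    refine ⟨by simp [hB], fun q hq => ?_⟩
    have : ∀ l', IsNode τ q l' → IsNode (τ.setNat aTail 0 (B + 1)) q l' := by
      intro l' h'
      simpa [IsNode] using h'
    apply this
    rw [List.length_append, List.length_singleton] at hq
    rcases Nat.lt_succ_iff_lt_or_eq.mp hq with hq' | rfl
    · rw [List.getElem_append_left hq']
      exact hold₂ q hq'
    · rw [List.getElem_append_right le_rfl]
      simpa using hnew.frame hf rfl

/-- Extension of the node `aHead` to the qubit `aNext`. -/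
def childProg (P : ℕ) : Prog :=
  .ite (.natLt (.get aDepth (.var aHead)) (.get aSize (.const 1)))
    (.seq (tryProg P 1) (.seq (tryProg P 2) (tryProg P 3))) .skip

theorem wp_childProg (P : ℕ) {σ : State} {e : Record} {LL : List (List (ℕ × ℕ))} {h : ℕ}
    (he : Env σ e) (hL : Nodes σ LL) (hh : h < LL.length) (hσ : σ.nat aHead 0 = h) :
    WP ω (childProg P) σ fun t τ => t ≤ 3 * e.passTime e.k + 320 ∧
      Nodes τ (LL ++ e.children (σ.nat aQubit 0) P (σ.nat aNext 0) LL[h]) := by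
  rw [childProg, wp_ite]
  simp only [BExp.eval, BExp.cost, NExp.eval, NExp.cost, NExp.eval_var, NExp.cost_var, hσ,
    he.locality, (hL.2 h hh).1]
  refine ⟨fun hk => ?_, fun hk => ?_⟩
  · have hpt : e.passTime (LL[h].length + 1) ≤ e.passTime e.k := e.passTime_mono hk
    rw [wp_seq]
    refine (wp_tryProg P 1 he hL hh hσ).mono ?_
    rintro t₁ τ₁ hf₁ ⟨ht₁, hL₁⟩
    rw [wp_seq]
    have hh₁ := Nat.lt_of_lt_of_le hh (List.length_append ▸ Nat.le_add_right _ _ :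
      LL.length ≤ (LL ++ e.ifLive (σ.nat aQubit 0) P ((σ.nat aNext 0, 1) :: LL[h])).length)
    refine (wp_tryProg P 2 (he.frame hf₁ rfl) hL₁ hh₁ (by rw [hf₁.nat _ rfl, hσ])).mono ?_
    rintro t₂ τ₂ hf₂ ⟨ht₂, hL₂⟩
    rw [List.getElem_append_left hh, hf₁.nat aQubit rfl, hf₁.nat aNext rfl] at hL₂
    rw [List.getElem_append_left hh] at ht₂
    have hh₂ := Nat.lt_of_lt_of_le hh₁ (List.length_append ▸ Nat.le_add_right _ _ :
      _ ≤ (LL ++ e.ifLive (σ.nat aQubit 0) P ((σ.nat aNext 0, 1) :: LL[h]) ++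
        e.ifLive (σ.nat aQubit 0) P ((σ.nat aNext 0, 2) :: LL[h])).length)
    refine (wp_tryProg P 3 ((he.frame hf₁ rfl).frame hf₂ rfl) hL₂ hh₂
      (by rw [hf₂.nat _ rfl, hf₁.nat _ rfl, hσ])).mono ?_
    rintro t₃ τ₃ hf₃ ⟨ht₃, hL₃⟩
    rw [List.getElem_append_left hh₁, List.getElem_append_left hh, hf₂.nat aQubit rfl,
      hf₂.nat aNext rfl, hf₁.nat aQubit rfl, hf₁.nat aNext rfl] at hL₃
    rw [List.getElem_append_left hh₁, List.getElem_append_left hh] at ht₃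
    refine ⟨by omega, ?_⟩
    rw [Record.children, if_pos hk]
    simpa only [List.append_assoc] using hL₃
  · rw [wp_skip, Record.children, if_neg hk, List.append_nil]
    exact ⟨by omega, hL⟩

/-- One stage of the search. -/
def stageProg (P : ℕ) : Prog :=
  .seq (.setNat aOldTail (.const 0) (.var aTail))
    (forLoop aHead (.const 0) (.var aOldTail) (childProg P))

theorem wp_stageProg (P : ℕ) {σ : State} {e : Record} {LL : List (List (ℕ × ℕ))}
    (he : Env σ e) (hL : Nodes σ LL) :
    WP ω (stageProg P) σ fun t τ => t ≤ (LL.length + 1) * (3 * e.passTime e.k + 350) ∧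
      Nodes τ (e.stage (σ.nat aQubit 0) P LL (σ.nat aNext 0)) := by
  rw [stageProg, wp_seq, wp_setNat]
  simp only [NExp.eval, NExp.eval_var, NExp.cost, NExp.cost_var, hL.1]
  refine WP.forLoop (fun h τ => Nodes τ (LL ++ (LL.take h).flatMap
    (e.children (σ.nat aQubit 0) P (σ.nat aNext 0)))) 0 LL.length (3 * e.passTime e.k + 320)
    (Nat.zero_le _) rfl rfl ?_ ?_ ?_ ?_ ?_
  · intro j τ v h
    exact h.setNat _ _ _ rfl
  · simpa using hL.setNat _ _ _ rfl
  · intro τ hf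
    have := hf.nat aOldTail rfl
    simp [this]
  · rintro h τ - hh hf hσ hLτ
    have he' := (he.setNat aOldTail 0 LL.length rfl).frame hf rfl
    have hlen := Nat.lt_of_lt_of_le hh (List.length_append ▸ Nat.le_add_right _ _ :
      LL.length ≤ (LL ++ (LL.take h).flatMap
        (e.children (σ.nat aQubit 0) P (σ.nat aNext 0))).length)
    refine (wp_childProg P he' hLτ hlen hσ).mono ?_
    rintro t τ' - ⟨ht, hL'⟩
    refine ⟨ht, ?_⟩
    have h1 := hf.nat aQubit rfl
    have h2 := hf.nat aNext rfl
    rw [State.setNat_nat_ne _ _ _ (by decide)] at h1 h2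
    rw [h1, h2, List.getElem_append_left hh] at hL'
    rw [List.take_add_one, List.getElem?_eq_getElem hh, Option.toList_some, List.flatMap_append,
      List.flatMap_singleton, ← List.append_assoc]
    exact hL'
  · rintro t τ - h ht
    rw [List.take_length] at h
    refine ⟨?_, h⟩
    simp only [NExp.cost, NExp.cost_var, Nat.sub_zero] at ht
    have : (LL.length + 1) * (3 * e.passTime e.k + 320 + 2 + 10) + 18 ≤
      (LL.length + 1) * (3 * e.passTime e.k + 350) := by
      have : 3 * e.passTime e.k + 350 = (3 * e.passTime e.k + 320 + 2 + 10) + 18 := by ring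
      rw [this, Nat.mul_add _ (3 * e.passTime e.k + 320 + 2 + 10) 18]
      linarith [Nat.zero_le LL.length]
    omega

/-- The search for the strings with first qubit `aQubit` and first label `R`. -/
def treeProg (P R : ℕ) : Prog :=
  .seq (.setNat aPos (.const 0) (.var aQubit))
  (.seq (.setNat aVal (.const 0) (.const R))
  (.seq (.setNat aDepth (.const 0) (.const 1))
  (.seq (.setNat aTail (.const 0) (.const 1))
    (forLoop aNext (.add (.var aQubit) (.const 1)) (.get aSize (.const 0)) (stageProg P)))))

theorem wp_treeProg (P R : ℕ) {σ : State} {e : Record} (he : Env σ e) (hi : σ.nat aQubit 0 < e.n) :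
    WP ω (treeProg P R) σ fun t τ =>
      t ≤ (e.n + 1) * (((e.tree (σ.nat aQubit 0) P R e.n).length + 1) *
        (3 * e.passTime e.k + 350) + 50) ∧
      Nodes τ (e.tree (σ.nat aQubit 0) P R e.n) := by
  rw [treeProg]
  simp only [wp_seq, wp_setNat, NExp.eval, NExp.eval_var, NExp.cost, NExp.cost_var]
  set i := σ.nat aQubit 0 with hi'
  set σ₁ := (((σ.setNat aPos 0 i).setNat aVal 0 R).setNat aDepth 0 1).setNat aTail 0 1 with hσ₁
  have he₁ : Env σ₁ e := (((he.setNat _ _ _ rfl).setNat _ _ _ rfl).setNat _ _ _ rfl).setNat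
    _ _ _ rfl
  have hi₁ : σ₁.nat aQubit 0 = i := by simp [hσ₁, hi']
  have hL₁ : Nodes σ₁ [[(i, R)]] := by
    refine ⟨by simp [hσ₁], fun q hq => ?_⟩
    obtain rfl : q = 0 := by simpa using hq
    exact ⟨by simp [hσ₁], by omega, by simp [hσ₁], by simp [hσ₁], trivial⟩
  clear_value σ₁
  set len := (e.tree i P R e.n).length with hlen
  refine WP.forLoop (fun j τ => Nodes τ (e.tree i P R j)) (i + 1) e.n
    ((len + 1) * (3 * e.passTime e.k + 350)) hi rfl (by simp [NExp.eval, hi₁]) ?_ ?_ ?_ ?_ ?_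
  · intro j τ v h
    exact h.setNat _ _ _ rfl
  · rw [e.tree_start]
    exact hL₁
  · intro τ hf
    exact (he₁.frame hf rfl).size
  · rintro j τ hj hjn hf hτ hL
    refine (wp_stageProg P (he₁.frame hf rfl) hL).mono ?_
    rintro t τ' - ⟨ht, hL'⟩
    rw [hf.nat aQubit rfl, hi₁, hτ] at hL'
    refine ⟨ht.trans (Nat.mul_le_mul_right _ ?_), ?_⟩
    · have := e.tree_length_mono i P R hj hjn.le
      omega
    · rw [e.tree_succ i P R hj]
      exact hL'
  · rintro t τ - h ht
    refine ⟨?_, h⟩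
    simp only [NExp.cost, NExp.cost_var] at ht
    generalize (len + 1) * (3 * e.passTime e.k + 350) = A at ht ⊢
    have h1 : (e.n - (i + 1) + 1) * (A + (1 + 1) + 10) ≤ (e.n + 1) * (A + (1 + 1) + 10) :=
      Nat.mul_le_mul_right _ (by omega)
    have h2 : (e.n + 1) * (A + 50) = (e.n + 1) * (A + (1 + 1) + 10) + 38 * (e.n + 1) := by ring
    omega

end HamLearn

namespace HamLearn

/-- `l` could be found by the search that starts with the label `R` at the qubit `i` and has treated
the qubits below `j`. -/
structure IsTreeString (k i R j : ℕ) (l : List (ℕ × ℕ)) : Prop where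
  sorted : l.Pairwise fun a b => b.1 < a.1
  lower : ∀ a ∈ l, i ≤ a.1
  upper : ∀ a ∈ l, a.1 < j
  label : ∀ a ∈ l, 1 ≤ a.2 ∧ a.2 ≤ 3
  length_le : l.length ≤ k
  root_mem : (i, R) ∈ l

theorem Record.mem_ifLive {e : Record} {i P : ℕ} {l l' : List (ℕ × ℕ)} :
    l' ∈ e.ifLive i P l ↔ l' = l ∧ e.live i P l := by
  rw [Record.ifLive]
  split_ifs with h <;> simp [h]

theorem Record.mem_children {e : Record} {i P p : ℕ} {l l' : List (ℕ × ℕ)} :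
    l' ∈ e.children i P p l ↔
      l.length < e.k ∧ ∃ v, (1 ≤ v ∧ v ≤ 3) ∧ l' = (p, v) :: l ∧ e.live i P l' := by
  rw [Record.children]
  split_ifs with h
  · simp only [List.mem_append, Record.mem_ifLive, h, true_and]
    constructor
    · rintro ((⟨rfl, h'⟩ | ⟨rfl, h'⟩) | ⟨rfl, h'⟩)
      exacts [⟨1, by omega, rfl, h'⟩, ⟨2, by omega, rfl, h'⟩, ⟨3, by omega, rfl, h'⟩]
    · rintro ⟨v, ⟨hv, hv'⟩, rfl, h'⟩
      interval_cases v <;> simp [h']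
  · simp [h]

/-- The strings in the search tree, apart from the root, get many votes. -/
theorem Record.mem_tree {e : Record} {i P R j : ℕ} (hk : 0 < e.k) (hR : 1 ≤ R ∧ R ≤ 3)
    (hj : i + 1 ≤ j) {l : List (ℕ × ℕ)} (hl : l ∈ e.tree i P R j) :
    IsTreeString e.k i R j l ∧ (l = [(i, R)] ∨ e.live i P l) := by
  induction j, hj using Nat.le_induction generalizing l with
  | base =>
    rw [e.tree_start, List.mem_singleton] at hl
    subst hl
    exact ⟨⟨by simp, by simp, by simp, by simpa using hR, by simpa using Nat.succ_le_of_lt hk,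
      by simp⟩, Or.inl rfl⟩
  | succ j hj ih =>
    rw [e.tree_succ i P R hj, Record.stage, List.mem_append, List.mem_flatMap] at hl
    rcases hl with hl | ⟨l', hl', hl⟩
    · obtain ⟨h, h'⟩ := ih hl
      exact ⟨⟨h.sorted, h.lower, fun a ha => (h.upper a ha).trans (Nat.lt_succ_self _), h.label,
        h.length_le, h.root_mem⟩, h'⟩
    · obtain ⟨hlen, v, hv, rfl, hlive⟩ := Record.mem_children.mp hl
      obtain ⟨h, -⟩ := ih hl'
      refine ⟨⟨?_, ?_, ?_, ?_, hlen, List.mem_cons_of_mem _ h.root_mem⟩, Or.inr hlive⟩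
      · exact List.pairwise_cons.mpr ⟨fun a ha => h.upper a ha, h.sorted⟩
      · rintro a (_ | ⟨_, ha⟩)
        exacts [by dsimp only; omega, h.lower a ha]
      · rintro a (_ | ⟨_, ha⟩)
        exacts [by dsimp only; omega, (h.upper a ha).trans (Nat.lt_succ_self _)]
      · rintro a (_ | ⟨_, ha⟩)
        exacts [hv, h.label a ha]

theorem Record.nodup_tree {e : Record} {i P R j : ℕ} (hk : 0 < e.k) (hR : 1 ≤ R ∧ R ≤ 3)
    (hj : i + 1 ≤ j) : (e.tree i P R j).Nodup := by
  induction j, hj using Nat.le_induction with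
  | base =>
    rw [e.tree_start]
    exact List.nodup_singleton _
  | succ j hj ih =>
    rw [e.tree_succ i P R hj, Record.stage, List.nodup_append]
    refine ⟨ih, ?_, ?_⟩
    · rw [List.nodup_flatMap]
      refine ⟨fun l _ => ?_, ?_⟩
      · rw [Record.children]
        split_ifs
        · rw [Record.ifLive, Record.ifLive, Record.ifLive]
          split_ifs <;> simp
        · exact List.nodup_nil
      · refine ih.imp fun {l l'} hne => ?_
        intro x hx hx'
        obtain ⟨-, v, -, rfl, -⟩ := Record.mem_children.mp hx
        obtain ⟨-, v', -, h, -⟩ := Record.mem_children.mp hx'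
        exact hne (List.cons.inj h).2
    · rintro l hl l' hl' rfl
      obtain ⟨l'', -, h⟩ := List.mem_flatMap.mp hl'
      obtain ⟨-, v, -, rfl, -⟩ := Record.mem_children.mp h
      have := (Record.mem_tree hk hR hj hl).1.upper _ (List.mem_cons_self ..)
      exact lt_irrefl _ this

/-! ### The output -/

notation "aCount" => (6 : ℕ)
notation "aString" => (7 : ℕ)
notation "aRow" => (30 : ℕ)
notation "rValue" => (1 : ℕ)

/-- The string that is written into a row of zeros by successive assignments. -/
def strF (l : List (ℕ × ℕ)) : ℕ → ℕ := l.foldl (fun f a => Function.update f a.1 a.2) 0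

theorem strF_concat (l : List (ℕ × ℕ)) (a : ℕ × ℕ) :
    strF (l ++ [a]) = Function.update (strF l) a.1 a.2 := by
  simp [strF]

theorem strF_of_notMem {l : List (ℕ × ℕ)} {x : ℕ} (h : ∀ a ∈ l, a.1 ≠ x) : strF l x = 0 := by
  induction l using List.reverseRecOn with
  | nil => rfl
  | append_singleton l a ih =>
    rw [strF_concat, Function.update_of_ne (h a (by simp)).symm]
    exact ih fun b hb => h b (by simp [hb])

/-- The memory holds the list `LO` of assignments, and the array `aString` is still zero behind
them. -/
structure Outputs (σ : State) (n : ℕ) (LO : List ((ℕ → ℕ) × ℝ)) : Prop where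
  count : σ.nat aCount 0 = LO.length
  row : σ.nat aRow 0 = LO.length * n
  value : ∀ r (hr : r < LO.length), σ.real rValue r = LO[r].2
  string : ∀ r (hr : r < LO.length), ∀ x < n, σ.nat aString (r * n + x) = LO[r].1 x
  free : ∀ x, LO.length * n ≤ x → σ.nat aString x = 0

theorem Outputs.frame {p : Prog} {σ τ : State} {n : ℕ} {LO : List ((ℕ → ℕ) × ℝ)}
    (h : Outputs σ n LO) (hf : Frame p σ τ)
    (hp : ([aCount, aString, aRow].all (fun a => !p.writesNat a) && !p.writesReal rValue) = true) :
    Outputs τ n LO := by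
  simp only [List.all_cons, List.all_nil, Bool.and_true, Bool.and_eq_true,
    Bool.not_eq_true'] at hp
  obtain ⟨⟨h1, h2, h3⟩, h4⟩ := hp
  exact ⟨by rw [hf.nat _ h1, h.count], by rw [hf.nat _ h3, h.row],
    by rw [hf.real _ h4]; exact h.value, by rw [hf.nat _ h2]; exact h.string,
    by rw [hf.nat _ h2]; exact h.free⟩

theorem Outputs.setNat {σ : State} {n : ℕ} {LO : List ((ℕ → ℕ) × ℝ)}
    (h : Outputs σ n LO) (a i v : ℕ) (ha : [aCount, aString, aRow].contains a = false) :
    Outputs (σ.setNat a i v) n LO := by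
  refine h.frame (p := .setNat a (.const i) (.const v)) (Exec.frame (ω := 0)
    (Exec.setNat a (.const i) (.const v) σ)) ?_
  simp only [List.contains_eq_mem, decide_eq_false_iff_not, List.mem_cons, not_or] at ha
  simp [Prog.writesNat, Prog.writesReal, natBeq_eq_false_iff]
  tauto

/-- The estimate for the coefficient that belongs to the string `l`. The sign and the
factor `2` come from `[iσ, τ] = -2 ρ` for Pauli matrices `σ`, `τ`, `ρ` in cyclic order. -/
noncomputable def Record.estimate (e : Record) (i P : ℕ) (l : List (ℕ × ℕ)) : ℝ :=
  (0 - e.totalSum i P l) / (2 * (e.M * e.T))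

/-- Writing the string of the node `aNode` to the current row of the output. -/
def rowProg : Prog :=
  .seq (.setNat aWalk (.const 0) (.var aNode))
    (forLoop aDepthIdx (.const 0) (.get aDepth (.var aNode))
      (.seq (.setNat aString (.add (.var aRow) (.get aPos (.var aWalk))) (.get aVal (.var aWalk)))
        (.setNat aWalk (.const 0) (.get aParent (.var aWalk)))))

variable {ω : ℕ → Fin 6}

theorem wp_rowProg {σ : State} {l : List (ℕ × ℕ)} {q b : ℕ}
    (hq : σ.nat aNode 0 = q) (hl : IsNode σ q l) (hb : σ.nat aRow 0 = b)
    (hfree : ∀ x, b ≤ x → σ.nat aString x = 0) :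
    WP ω rowProg σ fun t τ => t ≤ 40 * (l.length + 2) ∧
      τ.nat aString = fun x => if x < b then σ.nat aString x else strF l (x - b) := by
  rw [rowProg, wp_seq, wp_setNat]
  simp only [NExp.eval, NExp.eval_var, NExp.cost, NExp.cost_var, hq]
  obtain ⟨hd, hw⟩ := hl
  refine WP.forLoop (fun j τ => Walk (σ.nat aPos) (σ.nat aVal) (σ.nat aParent) (q + 1)
    (τ.nat aWalk 0) (l.drop j) ∧ τ.nat aString =
      fun x => if x < b then σ.nat aString x else strF (l.take j) (x - b))
    0 l.length 20 (Nat.zero_le _) rfl rfl ?_ ?_ ?_ ?_ ?_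
  · intro j τ v h
    simpa using h
  · refine ⟨by simpa using hw, funext fun x => ?_⟩
    by_cases hx : x < b
    · simp [hx]
    · simp [hx, strF, hfree x (not_lt.mp hx)]
  · intro τ hf
    have h1 := hf.nat aNode rfl
    have h2 := hf.nat aDepth rfl
    simp [NExp.eval, h1, h2, hq, hd]
  · rintro j τ - hj hf - ⟨hwj, hsj⟩
    have e1 := hf.nat aPos rfl
    have e2 := hf.nat aVal rfl
    have e3 := hf.nat aParent rfl
    have e4 := hf.nat aRow rfl
    rw [State.setNat_nat_ne _ _ _ (by decide)] at e1 e2 e3 e4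
    rw [List.drop_eq_getElem_cons hj] at hwj
    obtain ⟨-, hp, hv, hwj⟩ := hwj
    rw [wp_seq, wp_setNat, wp_setNat]
    simp only [NExp.eval, NExp.eval_var, NExp.cost, NExp.cost_var, e1, e2, e3, e4, hb, hp, hv,
      State.setNat_nat_self, State.setNat_nat_ne, ne_eq, Nat.reduceEqDiff, not_false_eq_true,
      Function.update_self, hwj, true_and]
    refine ⟨by omega, ?_⟩
    rw [hsj, List.take_add_one, List.getElem?_eq_getElem hj, Option.toList_some, strF_concat]
    funext x
    by_cases hx : x = b + l[j].1
    · subst hx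
      simp
    · rw [Function.update_of_ne hx]
      by_cases hxb : x < b
      · simp [hxb]
      · rw [if_neg hxb, if_neg hxb, Function.update_of_ne (by omega)]
  · rintro t τ - ⟨-, h⟩ ht
    rw [List.take_length] at h
    refine ⟨?_, h⟩
    simp only [NExp.cost, NExp.cost_var] at ht
    omega

/-- Output of the estimate for the node `aNode`. -/
def emitProg (c P : ℕ) : Prog :=
  .seq (totalProg P)
  (.seq (.setReal rValue (.var aCount) (.div (.sub (.const 0) (.var rSum))
    (.mul (.const 2) (.mul (.ofNat (.var aGroups)) (.ofNat (.var aTrials))))))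
  (.seq rowProg
  (.seq (.setNat aString (.add (.var aRow) (.var aQubit)) (.const c))
  (.seq (.setNat aCount (.const 0) (.add (.var aCount) (.const 1)))
    (.setNat aRow (.const 0) (.add (.var aRow) (.get aSize (.const 0))))))))

theorem wp_emitProg (c P : ℕ) {σ : State} {e : Record} {l : List (ℕ × ℕ)} {q : ℕ}
    {LO : List ((ℕ → ℕ) × ℝ)} (he : Env σ e) (hq : σ.nat aNode 0 = q) (hl : IsNode σ q l)
    (hi : σ.nat aQubit 0 < e.n) (hln : ∀ a ∈ l, a.1 < e.n) (hO : Outputs σ e.n LO) :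
    WP ω (emitProg c P) σ fun t τ => t ≤ 2 * e.passTime l.length + 200 ∧
      Outputs τ e.n (LO ++ [(Function.update (strF l) (σ.nat aQubit 0) c,
        e.estimate (σ.nat aQubit 0) P l)]) := by
  rw [emitProg, wp_seq]
  refine (wp_totalProg P he hq hl).mono ?_
  rintro t₁ τ₁ hf₁ ⟨ht₁, hs₁⟩
  have he₁ := he.frame hf₁ rfl
  have hl₁ := hl.frame hf₁ rfl
  have hO₁ := hO.frame hf₁ rfl
  rw [wp_seq, wp_setReal, wp_seq]
  simp only [NExp.eval_var, RExp.eval, RExp.eval_var, hs₁, he₁.groups, he₁.trials, hO₁.count]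
  set τ₂ := τ₁.setReal rValue LO.length _ with hτ₂
  have he₂ : Env τ₂ e := he₁.setReal _ _ _ (by decide) (by decide)
  refine (wp_rowProg (σ := τ₂) (l := l) (q := q) (b := LO.length * e.n) ?_ hl₁ hO₁.row
    hO₁.free).mono ?_
  · rw [hτ₂, State.setReal_nat, hf₁.nat _ rfl, hq]
  rintro t₃ τ₃ hf₃ ⟨ht₃, hs₃⟩
  have he₃ := he₂.frame hf₃ rfl
  have hi₃ : τ₃.nat aQubit 0 = σ.nat aQubit 0 := by
    rw [hf₃.nat _ rfl, hτ₂, State.setReal_nat, hf₁.nat _ rfl]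
  have hr₃ : τ₃.nat aRow 0 = LO.length * e.n := by
    rw [hf₃.nat _ rfl, hτ₂, State.setReal_nat, hO₁.row]
  have hc₃ : τ₃.nat aCount 0 = LO.length := by
    rw [hf₃.nat _ rfl, hτ₂, State.setReal_nat, hO₁.count]
  have hv₃ : τ₃.real rValue = Function.update (τ₁.real rValue) LO.length
      (e.estimate (σ.nat aQubit 0) P l) := by
    rw [hf₃.real _ rfl, hτ₂, State.setReal_real_self, Record.estimate]
    norm_num
  simp only [wp_seq, wp_setNat, NExp.eval, NExp.eval_var, NExp.cost, NExp.cost_var, RExp.cost,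
    RExp.cost_var, State.setNat_nat_ne, ne_eq, Nat.reduceEqDiff, not_false_eq_true, hi₃, hr₃, hc₃,
    OfNat.zero_ne_ofNat, he₃.size]
  have hpt : 500 * (l.length + 1) ≤ e.passTime l.length := by
    rw [Record.passTime]
    refine Nat.mul_le_mul_left _ ?_
    rw [← mul_assoc]
    exact Nat.le_mul_of_pos_left _ (Nat.mul_pos (Nat.succ_pos _) (Nat.succ_pos _))
  refine ⟨by omega, ?_⟩
  set i := σ.nat aQubit 0
  have hstr : (((τ₃.setNat aString (LO.length * e.n + i) c).setNat aCount 0 (LO.length + 1)).setNat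
      aRow 0 (LO.length * e.n + e.n)).nat aString = fun x => if x < LO.length * e.n then
        τ₁.nat aString x else Function.update (strF l) i c (x - LO.length * e.n) := by
    rw [State.setNat_nat_ne _ _ _ (by decide), State.setNat_nat_ne _ _ _ (by decide),
      State.setNat_nat_self, hs₃]
    funext x
    by_cases hx : x = LO.length * e.n + i
    · subst hx
      simp
    · rw [Function.update_of_ne hx]
      by_cases hxb : x < LO.length * e.n
      · simp [hxb, hτ₂]
      · rw [if_neg hxb, if_neg hxb, Function.update_of_ne (by omega)]
  have hlen : (LO ++ [(Function.update (strF l) i c, e.estimate i P l)]).length =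
      LO.length + 1 := by
    simp
  constructor
  · simp
  · simp [Nat.succ_mul]
  · intro r hr
    rw [hlen] at hr
    simp only [State.setNat_real, hv₃]
    rcases Nat.lt_succ_iff_lt_or_eq.mp hr with hr' | rfl
    · rw [List.getElem_append_left hr', Function.update_of_ne hr'.ne, hO₁.value r hr']
    · simp
  · intro r hr x hx
    rw [hlen] at hr
    rw [hstr]
    rcases Nat.lt_succ_iff_lt_or_eq.mp hr with hr' | rfl
    · have : r * e.n + x < LO.length * e.n :=
        calc _ < (r + 1) * e.n := by rw [Nat.succ_mul]; omega
          _ ≤ _ := Nat.mul_le_mul_right _ hr'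
      simp only [this, if_true]
      rw [List.getElem_append_left hr', hO₁.string r hr' x hx]
    · simp
  · intro x hx
    rw [hlen, Nat.succ_mul] at hx
    rw [hstr]
    simp only [show ¬ x < LO.length * e.n by omega, if_false]
    rw [Function.update_of_ne (by omega)]
    exact strF_of_notMem fun a ha => by have := hln a ha; omega

/-- Output of the estimates for all nodes. -/
def emitAllProg (c P : ℕ) : Prog :=
  forLoop aNode (.const 0) (.var aTail) (emitProg c P)

theorem wp_emitAllProg (c P : ℕ) {σ : State} {e : Record} {LL : List (List (ℕ × ℕ))}
    {LO : List ((ℕ → ℕ) × ℝ)} (he : Env σ e) (hN : Nodes σ LL)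
    (hi : σ.nat aQubit 0 < e.n) (hln : ∀ l ∈ LL, ∀ a ∈ l, a.1 < e.n)
    (hk : ∀ l ∈ LL, l.length ≤ e.k) (hO : Outputs σ e.n LO) :
    WP ω (emitAllProg c P) σ fun t τ => t ≤ (LL.length + 1) * (2 * e.passTime e.k + 230) ∧
      Outputs τ e.n (LO ++ LL.map fun l => (Function.update (strF l) (σ.nat aQubit 0) c,
        e.estimate (σ.nat aQubit 0) P l)) := by
  refine WP.forLoop (fun h τ => Outputs τ e.n (LO ++ (LL.take h).map fun l =>
    (Function.update (strF l) (σ.nat aQubit 0) c, e.estimate (σ.nat aQubit 0) P l)))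
    0 LL.length (2 * e.passTime e.k + 200) (Nat.zero_le _) rfl rfl ?_ ?_ ?_ ?_ ?_
  · intro j τ v h
    exact h.setNat _ _ _ rfl
  · simpa using hO
  · intro τ hf
    rw [NExp.eval_var, hf.nat aTail rfl, hN.1]
  · rintro h τ - hh hf hτ hO'
    have hmem := List.getElem_mem hh
    have hi' : τ.nat aQubit 0 = σ.nat aQubit 0 := by rw [hf.nat aQubit rfl]
    refine (wp_emitProg c P (he.frame hf rfl) hτ ((hN.2 h hh).frame hf rfl) (by rw [hi']; exact hi)
      (hln _ hmem) hO').mono ?_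
    rintro t τ' - ⟨ht, hO''⟩
    refine ⟨ht.trans (by have := e.passTime_mono (hk _ hmem); omega), ?_⟩
    rw [hi'] at hO''
    rw [List.take_add_one, List.getElem?_eq_getElem hh, Option.toList_some, List.map_append,
      ← List.append_assoc]
    exact hO''
  · rintro t τ - h ht
    rw [List.take_length] at h
    refine ⟨?_, h⟩
    simp only [NExp.cost, NExp.cost_var, Nat.sub_zero] at ht
    have : (LL.length + 1) * (2 * e.passTime e.k + 230) =
      (LL.length + 1) * (2 * e.passTime e.k + 200 + 2 + 10) + 18 * (LL.length + 1) := by ring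
    omega

/-- Search and output for the strings with label `c` at the first qubit `aQubit`. The observable is
the Pauli matrix `P` at this qubit, and `R` is the label into which `c` is turned by the commutator
with `P`. -/
def branchProg (c P R : ℕ) : Prog := .seq (treeProg P R) (emitAllProg c P)

/-- The assignments that result from one branch. -/
noncomputable def Record.branch (e : Record) (i c P R : ℕ) : List ((ℕ → ℕ) × ℝ) :=
  (e.tree i P R e.n).map fun l => (Function.update (strF l) i c, e.estimate i P l)

theorem wp_branchProg (c P R : ℕ) {σ : State} {e : Record} {len : ℕ} (hR : 1 ≤ R ∧ R ≤ 3)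
    {LO : List ((ℕ → ℕ) × ℝ)} (he : Env σ e) (hk : 0 < e.k) (hi : σ.nat aQubit 0 < e.n)
    (hlen : (e.tree (σ.nat aQubit 0) P R e.n).length ≤ len) (hO : Outputs σ e.n LO) :
    WP ω (branchProg c P R) σ fun t τ => t ≤ (e.n + 1) * ((len + 1) * (7 * e.passTime e.k)) ∧
      Outputs τ e.n (LO ++ e.branch (σ.nat aQubit 0) c P R) := by
  rw [branchProg, wp_seq]
  refine (wp_treeProg P R he hi).mono ?_
  rintro t₁ τ₁ hf₁ ⟨ht₁, hN⟩
  have hi₁ : τ₁.nat aQubit 0 = σ.nat aQubit 0 := by rw [hf₁.nat aQubit rfl]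
  have hmem := fun l (hl : l ∈ e.tree (σ.nat aQubit 0) P R e.n) => (e.mem_tree hk hR hi hl).1
  refine (wp_emitAllProg c P (he.frame hf₁ rfl) hN (by rw [hi₁]; exact hi)
    (fun l hl => (hmem l hl).upper) (fun l hl => (hmem l hl).length_le) (hO.frame hf₁ rfl)).mono ?_
  rintro t₂ τ₂ - ⟨ht₂, hO₂⟩
  rw [hi₁] at hO₂
  refine ⟨?_, hO₂⟩
  have hpt : 500 ≤ e.passTime e.k := by
    rw [Record.passTime]
    have : 1 ≤ (e.M + 1) * ((e.T + 1) * (e.k + 1)) :=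
      Nat.mul_pos (Nat.succ_pos _) (Nat.mul_pos (Nat.succ_pos _) (Nat.succ_pos _))
    omega
  set A := e.passTime e.k
  have h1 : ((e.tree (σ.nat aQubit 0) P R e.n).length + 1) * (3 * A + 350) + 50 ≤
      (len + 1) * (4 * A) := by
    have h2 : ((e.tree (σ.nat aQubit 0) P R e.n).length + 1) * (3 * A + 350) ≤
        (len + 1) * (3 * A + 350) := Nat.mul_le_mul_right _ (by omega)
    have h3 : (len + 1) * (4 * A) ≥ (len + 1) * (3 * A + 350) + (len + 1) * 50 := by
      rw [← Nat.mul_add]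
      exact Nat.mul_le_mul_left _ (by omega)
    linarith
  have h2 : ((e.tree (σ.nat aQubit 0) P R e.n).length + 1) * (2 * A + 230) ≤ (len + 1) * (3 * A) :=
    Nat.mul_le_mul (by omega) (by omega)
  have h3 := Nat.mul_le_mul_left (e.n + 1) h1
  have h4 : (len + 1) * (3 * A) ≤ (e.n + 1) * ((len + 1) * (3 * A)) :=
    Nat.le_mul_of_pos_left _ (Nat.succ_pos _)
  have h5 : (e.n + 1) * ((len + 1) * (7 * A)) =
      (e.n + 1) * ((len + 1) * (4 * A)) + (e.n + 1) * ((len + 1) * (3 * A)) := by ring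
  omega

/-- The processing program. A term of the Hamiltonian is found from its first qubit, via the
observable that turns its label there into the next but one in cyclic order. -/
def processProg : Prog :=
  forLoop aQubit (.const 0) (.get aSize (.const 0))
    (.ite (.natLt (.const 0) (.get aSize (.const 1)))
      (.seq (branchProg 1 2 3) (.seq (branchProg 2 3 1) (branchProg 3 1 2))) .skip)

/-- The assignments with first qubit `i`. -/
noncomputable def Record.branches (e : Record) (i : ℕ) : List ((ℕ → ℕ) × ℝ) :=
  if 0 < e.k then e.branch i 1 2 3 ++ (e.branch i 2 3 1 ++ e.branch i 3 1 2) else []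

/-- The processing program writes the estimates for all strings in the search trees, in a time
that is bounded in terms of the size of these trees. -/
theorem wp_processProg {σ : State} {e : Record} {len : ℕ} (he : Env σ e)
    (hlen : 0 < e.k → ∀ i < e.n, (e.tree i 2 3 e.n).length ≤ len ∧
      (e.tree i 3 1 e.n).length ≤ len ∧ (e.tree i 1 2 e.n).length ≤ len)
    (hO : Outputs σ e.n []) :
    WP ω processProg σ fun t τ =>
      t ≤ 30 * ((e.n + 1) * ((e.n + 1) * ((len + 1) * e.passTime e.k))) ∧
      Outputs τ e.n ((List.range e.n).flatMap e.branches) := by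
  refine WP.forLoop (fun i τ => Outputs τ e.n ((List.range i).flatMap e.branches))
    0 e.n (21 * ((e.n + 1) * ((len + 1) * e.passTime e.k)) + 20) (Nat.zero_le _) rfl rfl
    ?_ ?_ ?_ ?_ ?_
  · intro j τ v h
    exact h.setNat _ _ _ rfl
  · simpa using hO
  · intro τ hf
    exact (he.frame hf rfl).size
  · rintro i τ - hi hf hτ hO'
    have he₀ := he.frame hf rfl
    rw [List.range_succ, List.flatMap_append, List.flatMap_singleton, wp_ite, Record.branches]
    simp only [BExp.eval, BExp.cost, NExp.eval, NExp.cost, he₀.locality]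
    refine ⟨fun hk => ?_, fun hk => ?_⟩
    · obtain ⟨hl1, hl2, hl3⟩ := hlen hk i hi
      rw [wp_seq, if_pos hk]
      refine (wp_branchProg 1 2 3 (len := len) (by decide) he₀ hk (by rw [hτ]; exact hi)
        (by rw [hτ]; exact hl1) hO').mono ?_
      rintro t₁ τ₁ hf₁ ⟨ht₁, hO₁⟩
      have hi₁ : τ₁.nat aQubit 0 = i := by rw [hf₁.nat aQubit rfl, hτ]
      have he₁ := he₀.frame hf₁ rfl
      rw [wp_seq]
      refine (wp_branchProg 2 3 1 (len := len) (by decide) he₁ hk (by rw [hi₁]; exact hi)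
        (by rw [hi₁]; exact hl2) hO₁).mono ?_
      rintro t₂ τ₂ hf₂ ⟨ht₂, hO₂⟩
      have hi₂ : τ₂.nat aQubit 0 = i := by rw [hf₂.nat aQubit rfl, hi₁]
      refine (wp_branchProg 3 1 2 (len := len) (by decide) (he₁.frame hf₂ rfl) hk
        (by rw [hi₂]; exact hi)
        (by rw [hi₂]; exact hl3) hO₂).mono ?_
      rintro t₃ τ₃ - ⟨ht₃, hO₃⟩
      rw [hτ, hi₁, hi₂, List.append_assoc, List.append_assoc] at hO₃
      refine ⟨?_, hO₃⟩
      have : (e.n + 1) * ((len + 1) * (7 * e.passTime e.k)) =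
        7 * ((e.n + 1) * ((len + 1) * e.passTime e.k)) := by ring
      omega
    · rw [wp_skip, if_neg hk, List.append_nil]
      exact ⟨by omega, hO'⟩
  · rintro t τ - h ht
    refine ⟨?_, h⟩
    simp only [NExp.cost, Nat.sub_zero] at ht
    have hA : 500 ≤ (e.n + 1) * ((len + 1) * e.passTime e.k) := by
      have hpt : 500 ≤ e.passTime e.k := by
        rw [Record.passTime]
        have : 1 ≤ (e.M + 1) * ((e.T + 1) * (e.k + 1)) :=
          Nat.mul_pos (Nat.succ_pos _) (Nat.mul_pos (Nat.succ_pos _) (Nat.succ_pos _))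
        omega
      exact hpt.trans ((Nat.le_mul_of_pos_left _ (Nat.succ_pos _)).trans
        (Nat.le_mul_of_pos_left _ (Nat.succ_pos _)))
    set A := (e.n + 1) * ((len + 1) * e.passTime e.k)
    have h1 : (e.n + 1) * (21 * A + 20 + (1 + 1) + 10) + 1 ≤ (e.n + 1) * (30 * A) := by
      calc _ ≤ (e.n + 1) * (21 * A + 20 + (1 + 1) + 10) + (e.n + 1) * 1 := by omega
        _ = (e.n + 1) * (21 * A + 20 + (1 + 1) + 10 + 1) := by ring
        _ ≤ _ := Nat.mul_le_mul_left _ (by omega)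
    calc t ≤ _ := ht
      _ ≤ _ := h1
      _ = _ := by ring

end HamLearn

namespace HamLearn

/-! ### The design of the experiments -/

notation "aAsked" => (1 : ℕ)
notation "aPrep" => (2 : ℕ)
notation "aSign" => (3 : ℕ)
notation "aBase" => (9 : ℕ)
notation "aMask" => (10 : ℕ)
notation "aLog" => (31 : ℕ)
notation "aLoop" => (32 : ℕ)
notation "rPower" => (5 : ℕ)

/-- The number of doublings that lead from `1` to `n / δ`. -/
noncomputable def logCount (n : ℕ) (δ : ℝ) : ℕ := ⌈Real.logb 2 (n / δ)⌉₊

/-- The number of experiments of each kind in a group. The variance of an average over so many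
experiments is far below `ε ^ 2`, since the statistic has second moment at most `3 ^ (k + 1)`. -/
noncomputable def trialCount (k : ℕ) (ε : ℝ) : ℕ := ⌈2000 * 41 ^ k / (ε * ε)⌉₊

/-- The number of groups. The factor `k + 1` makes up for the number of strings in the union bound,
and `41 ^ k` for the small probability of a vote for a term that is present. -/
noncomputable def groupCount (n k : ℕ) (δ : ℝ) : ℕ :=
  ⌈384 * ((k : ℝ) + 1) * logCount n δ * 41 ^ k⌉₊

/-- Computation of `logCount`. -/
def logProg : Prog :=
  .seq (.setReal rPower (.const 0) (.const 1))
    (.while (.realLt (.var rPower) (.div (.ofNat (.get aSize (.const 0))) (.get 0 (.const 1))))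
      (.seq (.setReal rPower (.const 0) (.mul (.var rPower) (.const 2)))
        (.setNat aLog (.const 0) (.add (.var aLog) (.const 1)))))

/-- Computation of `41 ^ k`. -/
def scaleProg : Prog :=
  .seq (.setReal rScale (.const 0) (.const 1))
    (forLoop aLoop (.const 0) (.get aSize (.const 1))
      (.setReal rScale (.const 0) (.mul (.var rScale) (.const 41))))

/-- Computation of `⌈x⌉₊` into the entry `0` of the array `a`. -/
def ceilProg (a : ℕ) (x : RExp) : Prog :=
  .seq (.setNat a (.const 0) (.const 0))
    (.while (.realLt (.ofNat (.var a)) x) (.setNat a (.const 0) (.add (.var a) (.const 1))))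

/-- Computation of `T * n`. -/
def strideProg : Prog :=
  .seq (.setNat aStride (.const 0) (.const 0))
    (forLoop aLoop (.const 0) (.var aTrials)
      (.setNat aStride (.const 0) (.add (.var aStride) (.get aSize (.const 0)))))

variable {ω : ℕ → Fin 6}

theorem wp_logProg {σ : State} {n : ℕ} {δ : ℝ} (hn : σ.nat aSize 0 = n) (hδ : σ.real 0 1 = δ)
    (hpos : 0 < n / δ) (hL : σ.nat aLog 0 = 0) :
    WP ω logProg σ fun t τ => t ≤ 40 * (logCount n δ + 1) ∧ τ.nat aLog 0 = logCount n δ := by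
  have hiff : ∀ j : ℕ, (2 : ℝ) ^ j < n / δ ↔ j < logCount n δ := by
    intro j
    rw [logCount, Nat.lt_ceil, Real.lt_logb_iff_rpow_lt (by norm_num) hpos, Real.rpow_natCast]
  rw [logProg, wp_seq, wp_setReal]
  refine WP.while_count (fun j τ => τ.nat aLog 0 = j ∧ τ.real rPower 0 = 2 ^ j) 0 (logCount n δ) 15
    (Nat.zero_le _) ?_ ?_ ?_ ?_
  · simp [hL, RExp.eval, NExp.eval]
  · rintro j τ - hj hf ⟨hLj, hpj⟩
    have h0 := hf.nat aSize rfl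
    have h1 := hf.real 0 rfl
    rw [State.setReal_nat] at h0
    rw [State.setReal_real_ne _ _ _ (by decide)] at h1
    constructor
    · simp only [BExp.eval, RExp.eval, RExp.eval_var, NExp.eval, h0, h1, hn, hδ, hpj]
      exact (hiff j).mpr hj
    · simp only [wp_seq, wp_setReal, wp_setNat, NExp.cost, NExp.cost_var, RExp.cost, RExp.cost_var,
        NExp.eval, NExp.eval_var, RExp.eval, RExp.eval_var, hpj, hLj, State.setReal_nat]
      exact ⟨by omega, by simp, by simp [pow_succ]⟩
  · rintro τ hf ⟨-, hpj⟩
    have h0 := hf.nat aSize rfl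
    have h1 := hf.real 0 rfl
    rw [State.setReal_nat] at h0
    rw [State.setReal_real_ne _ _ _ (by decide)] at h1
    simp only [BExp.eval, RExp.eval, RExp.eval_var, NExp.eval, h0, h1, hn, hδ, hpj]
    exact fun h => lt_irrefl _ ((hiff _).mp h)
  · rintro t τ - ⟨h, -⟩ ht
    refine ⟨?_, h⟩
    simp only [NExp.cost, RExp.cost, RExp.cost_var, BExp.cost] at ht ⊢
    omega

theorem wp_scaleProg {σ : State} {k : ℕ} (hk : σ.nat aSize 1 = k) :
    WP ω scaleProg σ fun t τ => t ≤ 40 * (k + 1) ∧ τ.real rScale 0 = 41 ^ k := by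
  rw [scaleProg, wp_seq, wp_setReal]
  refine WP.forLoop (fun j τ => τ.real rScale 0 = 41 ^ j) 0 k 10 (Nat.zero_le _) rfl rfl
    (fun _ _ _ h => h) ?_ ?_ ?_ ?_
  · simp [RExp.eval, NExp.eval]
  · intro τ hf
    simp [NExp.eval, hf.nat aSize rfl, hk]
  · rintro j τ - - - - hj
    rw [wp_setReal]
    simp only [RExp.cost, RExp.cost_var, NExp.cost, RExp.eval, RExp.eval_var, hj, NExp.eval]
    exact ⟨by omega, by simp [pow_succ]⟩
  · rintro t τ - h ht
    refine ⟨?_, h⟩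
    simp only [NExp.cost, RExp.cost] at ht ⊢
    omega

theorem wp_ceilProg {a : ℕ} {x : RExp} {σ : State} {r : ℝ}
    (hx : ∀ τ, Frame (ceilProg a x) σ τ → x.eval τ = r) :
    WP ω (ceilProg a x) σ fun t τ => t ≤ (x.cost + 20) * (⌈r⌉₊ + 1) ∧ τ.nat a 0 = ⌈r⌉₊ := by
  have hfr : ∀ τ, Frame (.setNat a (.const 0) (.add (.var a) (.const 1))) (σ.setNat a 0 0) τ →
      x.eval τ = r := by
    intro τ hf
    refine hx τ ⟨fun b hb => ?_, hf.real, hf.coins⟩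
    simp only [ceilProg, Prog.writesNat, Bool.or_self] at hb
    rw [hf.nat b hb, State.setNat_nat_ne _ _ _ (natBeq_eq_false_iff.mp hb).symm]
  rw [ceilProg, wp_seq, wp_setNat]
  refine WP.while_count (fun j τ => τ.nat a 0 = j) 0 ⌈r⌉₊ 6 (Nat.zero_le _) ?_ ?_ ?_ ?_
  · simp [NExp.eval]
  · rintro j τ - hj hf haj
    constructor
    · simp only [BExp.eval, RExp.eval, NExp.eval_var, hfr τ hf, haj]
      exact Nat.lt_ceil.mp hj
    · rw [wp_setNat]
      simp [NExp.cost, NExp.eval, haj]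
  · rintro τ hf haj
    simp only [BExp.eval, RExp.eval, NExp.eval_var, hfr τ hf, haj, not_lt]
    exact Nat.le_ceil r
  · rintro t τ - h ht
    refine ⟨?_, h⟩
    simp only [NExp.cost, RExp.cost, NExp.cost_var, BExp.cost, Nat.sub_zero] at ht ⊢
    have : (x.cost + 20) * (⌈r⌉₊ + 1) =
        ⌈r⌉₊ * (6 + (2 + 1 + x.cost + 1) + 1) + 9 * ⌈r⌉₊ + x.cost + 20 := by
      ring
    omega

theorem wp_strideProg {σ : State} {n T : ℕ} (hn : σ.nat aSize 0 = n) (hT : σ.nat aTrials 0 = T) :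
    WP ω strideProg σ fun t τ => t ≤ 40 * (T + 1) ∧ τ.nat aStride 0 = T * n := by
  rw [strideProg, wp_seq, wp_setNat]
  refine WP.forLoop (fun j τ => τ.nat aStride 0 = j * n) 0 T 10 (Nat.zero_le _) rfl rfl
    ?_ ?_ ?_ ?_ ?_
  · intro j τ v h
    simpa using h
  · simp [NExp.eval]
  · intro τ hf
    simp [hf.nat aTrials rfl, hT]
  · rintro j τ - - hf - hj
    have h0 := hf.nat aSize rfl
    rw [State.setNat_nat_ne _ _ _ (by decide)] at h0
    rw [wp_setNat]
    simp only [NExp.cost, NExp.cost_var, NExp.eval, NExp.eval_var, hj, h0, hn]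
    exact ⟨by omega, by simp [Nat.succ_mul]⟩
  · rintro t τ - h ht
    refine ⟨?_, h⟩
    simp only [NExp.cost, NExp.cost_var] at ht ⊢
    omega

/-- The numbers of coins that are tossed for a group. -/
def coinsPerGroup (n T : ℕ) : ℕ := 2 * n + 2 * T * (2 * n)

/-- The position in the coin sequence of the code of the base state of qubit `i` in group `m`; it
is followed by the coin that decides whether the qubit is fixed. -/
def baseCoin (n T m i : ℕ) : ℕ := m * coinsPerGroup n T + 2 * i

/-- The position in the coin sequence of the code of the fresh state of qubit `i` in the experiment
`t` of group `m`; it is followed by the coin for the measured axis. -/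
def trialCoin (n T m t i : ℕ) : ℕ := m * coinsPerGroup n T + 2 * n + t * (2 * n) + 2 * i

/-- In the experiments of the second kind, about two thirds of the qubits are prepared in a base
state that is the same for the whole group. -/
def IsFixed (ω : ℕ → Fin 6) (n T m t i : ℕ) : Prop := T ≤ t ∧ 2 ≤ (ω (baseCoin n T m i + 1) : ℕ)

instance (ω : ℕ → Fin 6) (n T m t i : ℕ) : Decidable (IsFixed ω n T m t i) :=
  inferInstanceAs (Decidable (_ ∧ _))

/-- The cell `c` contains the data of qubit `i` in experiment `t` of group `m`. -/
structure CellOK (ω : ℕ → Fin 6) (n T : ℕ) (σ : State) (c m t i : ℕ) : Prop where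
  prep : σ.nat aPrep c =
    if IsFixed ω n T m t i then (ω (baseCoin n T m i) : ℕ) else ω (trialCoin n T m t i)
  sign : σ.nat aSign c = σ.nat aPrep c - 2
  meas : σ.nat aMeas c = ω (trialCoin n T m t i + 1)
  seen : σ.nat aSeen c = if IsFixed ω n T m t i then 6 else (ω (trialCoin n T m t i) : ℕ)

/-- The cells before `C` contain their data. -/
def CellsOK (ω : ℕ → Fin 6) (n T : ℕ) (σ : State) (C : ℕ) : Prop :=
  ∀ m t i, t < 2 * T → i < n → (m * (2 * T) + t) * n + i < C →
    CellOK ω n T σ ((m * (2 * T) + t) * n + i) m t i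

/-- The base states of group `m` are in the memory. -/
def BaseOK (ω : ℕ → Fin 6) (n T : ℕ) (σ : State) (m I : ℕ) : Prop :=
  ∀ i < I, σ.nat aBase i = ω (baseCoin n T m i) ∧ σ.nat aMask i = ω (baseCoin n T m i + 1)

theorem CellsOK.congr {n T C : ℕ} {σ τ : State} (h : CellsOK ω n T σ C)
    (h2 : τ.nat aPrep = σ.nat aPrep) (h3 : τ.nat aSign = σ.nat aSign)
    (h4 : τ.nat aMeas = σ.nat aMeas) (h8 : τ.nat aSeen = σ.nat aSeen) : CellsOK ω n T τ C := by
  intro m t i ht hi hc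
  obtain ⟨a, b, c, d⟩ := h m t i ht hi hc
  exact ⟨by rw [h2, a], by rw [h2, h3, b], by rw [h4, c], by rw [h8, d]⟩

/-- Tossing of the data of one qubit in one experiment. The sign is `code - 2`, truncated, since
any non-zero number stands for the eigenvalue `-1`; the axes are read modulo `3`. -/
def cellProg : Prog :=
  .seq (.toss aSeen (.var aCell))
  (.seq (.toss aMeas (.var aCell))
  (.seq (.ite (.and (.not (.natLt (.var aTrialIdx) (.var aTrials)))
      (.not (.natLt (.get aMask (.var aQubit)) (.const 2))))
    (.seq (.setNat aPrep (.var aCell) (.get aBase (.var aQubit)))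
      (.setNat aSeen (.var aCell) (.const 6)))
    (.setNat aPrep (.var aCell) (.get aSeen (.var aCell))))
  (.seq (.setNat aSign (.var aCell) (.sub (.get aPrep (.var aCell)) (.const 2)))
    (.setNat aCell (.const 0) (.add (.var aCell) (.const 1))))))

theorem wp_cellProg {σ : State} {n T m t i : ℕ} (hT : σ.nat aTrials 0 = T)
    (ht : σ.nat aTrialIdx 0 = t) (hi : σ.nat aQubit 0 = i) (hin : i < n) (htT : t < 2 * T)
    (hb : BaseOK ω n T σ m n) (hcoin : σ.coins = trialCoin n T m t i)
    (hc : σ.nat aCell 0 = (m * (2 * T) + t) * n + i)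
    (hcells : CellsOK ω n T σ ((m * (2 * T) + t) * n + i)) :
    WP ω cellProg σ fun s τ => s ≤ 80 ∧ τ.coins = trialCoin n T m t i + 2 ∧
      τ.nat aCell 0 = (m * (2 * T) + t) * n + i + 1 ∧
      CellsOK ω n T τ ((m * (2 * T) + t) * n + i + 1) := by
  obtain ⟨hb1, hb2⟩ := hb i hin
  set c := (m * (2 * T) + t) * n + i with hcdef
  have main : ∀ τ : State, (∀ x, x ≠ c → τ.nat aPrep x = σ.nat aPrep x ∧
      τ.nat aSign x = σ.nat aSign x ∧ τ.nat aMeas x = σ.nat aMeas x ∧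
      τ.nat aSeen x = σ.nat aSeen x) → CellOK ω n T τ c m t i → CellsOK ω n T τ (c + 1) := by
    intro τ hτ hcell m' t' i' ht' hi' hlt
    rcases Nat.lt_succ_iff_lt_or_eq.mp hlt with hlt | heq
    · obtain ⟨a, b, c, d⟩ := hcells m' t' i' ht' hi' hlt
      obtain ⟨h1, h2, h3, h4⟩ := hτ _ hlt.ne
      exact ⟨by rw [h1, a], by rw [h1, h2, b], by rw [h3, c], by rw [h4, d]⟩
    · have hn : 0 < n := by omega
      have h1 : i' = i := by
        have := congrArg (· % n) heq
        simpa [hcdef, Nat.add_mod, Nat.mod_eq_of_lt hi',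
          Nat.mod_eq_of_lt hin] using this
      subst h1
      have h2 : m' * (2 * T) + t' = m * (2 * T) + t :=
        Nat.eq_of_mul_eq_mul_right hn (by omega)
      have h3 : t' = t := by
        have := congrArg (· % (2 * T)) h2
        simpa [Nat.add_mod, Nat.mod_eq_of_lt ht', Nat.mod_eq_of_lt htT] using this
      subst h3
      have h4 : m' = m := Nat.eq_of_mul_eq_mul_right (show 0 < 2 * T by omega) (by omega)
      subst h4
      exact hcell
  rw [cellProg]
  simp only [wp_seq, wp_toss, wp_ite, wp_setNat, NExp.eval, NExp.eval_var, NExp.cost, NExp.cost_var,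
    BExp.eval, BExp.cost, State.setNat_nat_self, State.setNat_nat_ne, State.setNat_coins, ne_eq,
    Nat.reduceEqDiff, not_false_eq_true, Function.update_self, hc, ht, hi, hT, hcoin, hb2, hb1,
    not_lt, not_and, not_le]
  constructor
  · intro hfix
    have hfix' : IsFixed ω n T m t i := hfix
    refine ⟨by omega, trivial, trivial, main _ (fun x hx => ?_) ?_⟩
    · simp [Function.update_of_ne hx]
    · constructor <;> simp [hfix']
  · intro hfix
    have hfix' : ¬ IsFixed ω n T m t i := fun h => by have := hfix h.1; have := h.2; omega
    refine ⟨by omega, trivial, trivial, main _ (fun x hx => ?_) ?_⟩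
    · simp [Function.update_of_ne hx]
    · constructor <;> simp [hfix']

/-- The design of one experiment. -/
def trialProg : Prog :=
  .seq (forLoop aQubit (.const 0) (.get aSize (.const 0)) cellProg)
    (.setNat aAsked (.const 0) (.add (.var aAsked) (.const 1)))

theorem wp_trialProg {σ : State} {n T m t : ℕ} (hn : σ.nat aSize 0 = n) (hT : σ.nat aTrials 0 = T)
    (ht : σ.nat aTrialIdx 0 = t) (htT : t < 2 * T)
    (hb : BaseOK ω n T σ m n) (hcoin : σ.coins = trialCoin n T m t 0)
    (hc : σ.nat aCell 0 = (m * (2 * T) + t) * n)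
    (hcells : CellsOK ω n T σ ((m * (2 * T) + t) * n)) :
    WP ω trialProg σ fun s τ => s ≤ 110 * (n + 1) ∧ τ.coins = trialCoin n T m (t + 1) 0 ∧
      τ.nat aCell 0 = (m * (2 * T) + (t + 1)) * n ∧
      CellsOK ω n T τ ((m * (2 * T) + (t + 1)) * n) ∧
      τ.nat aAsked 0 = σ.nat aAsked 0 + 1 := by
  rw [trialProg, wp_seq]
  refine WP.forLoop (fun i τ => τ.coins = trialCoin n T m t i ∧
    τ.nat aCell 0 = (m * (2 * T) + t) * n + i ∧ CellsOK ω n T τ ((m * (2 * T) + t) * n + i))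
    0 n 80 (Nat.zero_le _) rfl rfl ?_ ?_ ?_ ?_ ?_
  · rintro j τ v ⟨h1, h2, h3⟩
    exact ⟨h1, by simpa using h2, h3.congr (by simp) (by simp) (by simp) (by simp)⟩
  · exact ⟨hcoin, hc, hcells⟩
  · intro τ hf
    rw [NExp.eval, NExp.eval, hf.nat _ rfl, hn]
  · rintro i τ - hin hf hτ ⟨h1, h2, h3⟩
    have hb' : BaseOK ω n T τ m n := fun j hj => by
      rw [hf.nat aBase rfl, hf.nat aMask rfl]
      exact hb j hj
    refine (wp_cellProg (by rw [hf.nat _ rfl, hT]) (by rw [hf.nat _ rfl, ht]) hτ hin htT hb' h1 h2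
      h3).mono ?_
    rintro s τ' - ⟨hs, hc', hcell, hok⟩
    exact ⟨hs, by rw [hc', trialCoin, trialCoin]; ring, hcell, hok⟩
  · rintro s τ hf ⟨h1, h2, h3⟩ hs
    rw [wp_setNat]
    simp only [NExp.cost, NExp.cost_var, NExp.eval, NExp.eval_var, State.setNat_coins] at hs ⊢
    refine ⟨by omega, by rw [h1, trialCoin, trialCoin]; ring, ?_, ?_, ?_⟩
    · rw [State.setNat_nat_ne _ _ _ (by decide), h2]
      ring
    · rw [show (m * (2 * T) + (t + 1)) * n = (m * (2 * T) + t) * n + n by ring]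
      exact h3.congr (by simp) (by simp) (by simp) (by simp)
    · simp [hf.nat aAsked rfl]

/-- The design of one group of experiments. -/
def groupProg : Prog :=
  .seq (forLoop aQubit (.const 0) (.get aSize (.const 0))
    (.seq (.toss aBase (.var aQubit)) (.toss aMask (.var aQubit))))
    (forLoop aTrialIdx (.const 0) (.add (.var aTrials) (.var aTrials)) trialProg)

theorem wp_groupProg {σ : State} {n T m : ℕ} (hn : σ.nat aSize 0 = n) (hT : σ.nat aTrials 0 = T)
    (hcoin : σ.coins = m * coinsPerGroup n T)
    (hc : σ.nat aCell 0 = m * (2 * T) * n) (hcells : CellsOK ω n T σ (m * (2 * T) * n)) :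
    WP ω groupProg σ fun s τ => s ≤ 400 * ((n + 1) * (T + 1)) ∧
      τ.coins = (m + 1) * coinsPerGroup n T ∧
      τ.nat aCell 0 = (m + 1) * (2 * T) * n ∧
      CellsOK ω n T τ ((m + 1) * (2 * T) * n) ∧
      τ.nat aAsked 0 = σ.nat aAsked 0 + 2 * T := by
  rw [groupProg, wp_seq]
  refine WP.forLoop (fun i τ => τ.coins = baseCoin n T m i ∧ BaseOK ω n T τ m i)
    0 n 10 (Nat.zero_le _) rfl rfl ?_ ?_ ?_ ?_ ?_
  · rintro j τ v ⟨h1, h2⟩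
    exact ⟨h1, fun i hi => by simpa using h2 i hi⟩
  · exact ⟨hcoin, fun i hi => absurd hi (Nat.not_lt_zero _)⟩
  · intro τ hf
    rw [NExp.eval, NExp.eval, hf.nat _ rfl, hn]
  · rintro i τ - hin hf hτ ⟨h1, h2⟩
    simp only [wp_seq, wp_toss, NExp.cost_var, NExp.eval_var, hτ, h1, State.setNat_nat_ne, ne_eq,
      Nat.reduceEqDiff, not_false_eq_true]
    refine ⟨by omega, by rw [baseCoin, baseCoin]; ring, fun j hj => ?_⟩
    simp only [State.setNat_nat_ne, ne_eq, Nat.reduceEqDiff, not_false_eq_true,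
      State.setNat_nat_self]
    rcases Nat.lt_succ_iff_lt_or_eq.mp hj with hj | rfl
    · rw [Function.update_of_ne hj.ne, Function.update_of_ne hj.ne]
      exact h2 j hj
    · simp
  · rintro s τ hf ⟨h1, h2⟩ hs
    have hcell : τ.nat aCell 0 = m * (2 * T) * n := by rw [hf.nat _ rfl, hc]
    have hcells' : CellsOK ω n T τ (m * (2 * T) * n) :=
      hcells.congr (hf.nat _ rfl) (hf.nat _ rfl) (hf.nat _ rfl) (hf.nat _ rfl)
    have hTτ : τ.nat aTrials 0 = T := by rw [hf.nat _ rfl, hT]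
    have hnτ : τ.nat aSize 0 = n := by rw [hf.nat _ rfl, hn]
    have haτ : τ.nat aAsked 0 = σ.nat aAsked 0 := by rw [hf.nat _ rfl]
    refine WP.forLoop (fun t τ' => τ'.coins = trialCoin n T m t 0 ∧
      τ'.nat aCell 0 = (m * (2 * T) + t) * n ∧ CellsOK ω n T τ' ((m * (2 * T) + t) * n) ∧
      τ'.nat aAsked 0 = σ.nat aAsked 0 + t)
      0 (2 * T) (110 * (n + 1)) (Nat.zero_le _) rfl rfl ?_ ?_ ?_ ?_ ?_
    · rintro j τ v ⟨h1, h2, h3, h4⟩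
      exact ⟨h1, by simpa using h2, h3.congr (by simp) (by simp) (by simp) (by simp),
        by simpa using h4⟩
    · exact ⟨by rw [h1, baseCoin, trialCoin]; ring, hcell, hcells', haτ⟩
    · intro τ' hf'
      simp only [NExp.eval, NExp.eval_var]
      rw [hf'.nat _ rfl, hTτ, two_mul]
    · rintro t τ' - htT hf' hτ' ⟨g1, g2, g3, g4⟩
      have hb' : BaseOK ω n T τ' m n := fun j hj => by
        rw [hf'.nat aBase rfl, hf'.nat aMask rfl]
        exact h2 j hj
      refine (wp_trialProg (by rw [hf'.nat _ rfl, hnτ]) (by rw [hf'.nat _ rfl, hTτ]) hτ' htT hb' g1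
        g2 g3).mono ?_
      rintro s' τ'' - ⟨k1, k2, k3, k4, k5⟩
      exact ⟨k1, k2, k3, k4, by rw [k5, g4, add_assoc]⟩
    · rintro s' τ' - ⟨g1, g2, g3, g4⟩ hs'
      refine ⟨?_, ?_, ?_, ?_, g4⟩
      · simp only [NExp.cost, NExp.cost_var, Nat.sub_zero] at hs hs'
        have e1 : 400 * ((n + 1) * (T + 1)) = (2 * T + 1) * (110 * (n + 1)) +
          ((n + 1) * T * 180 + (n + 1) * 290) := by ring
        have e2 : (2 * T + 1) * (110 * (n + 1) + (2 + 2 + 1) + 10) =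
          (2 * T + 1) * (110 * (n + 1)) + 15 * (2 * T + 1) := by ring
        have e3 : T ≤ (n + 1) * T := Nat.le_mul_of_pos_left _ (Nat.succ_pos _)
        have e4 : (n + 1) * T * 180 = 180 * ((n + 1) * T) := by ring
        rw [e1, e4]
        rw [e2] at hs'
        omega
      · rw [g1, trialCoin, coinsPerGroup]
        ring
      · rw [g2]
        ring
      · rw [show (m + 1) * (2 * T) * n = (m * (2 * T) + 2 * T) * n by ring]
        exact g3

/-- The design program. -/
def designProg : Prog :=
  .seq logProg
  (.seq scaleProg
  (.seq (ceilProg aTrials (.div (.mul (.const 2000) (.var rScale))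
    (.mul (.get 0 (.const 0)) (.get 0 (.const 0)))))
  (.seq (ceilProg aGroups (.mul (.mul (.mul (.const 384) (.add (.ofNat (.get aSize (.const 1)))
    (.const 1))) (.ofNat (.var aLog))) (.var rScale)))
  (.seq strideProg
  (.seq (.setNat aCell (.const 0) (.const 0))
    (forLoop aGroupIdx (.const 0) (.var aGroups) groupProg))))))

/-- The state in which the design program halts. -/
structure Designed (ω : ℕ → Fin 6) (n k : ℕ) (ε : ℝ) (T M : ℕ) (σ : State) : Prop where
  asked : σ.nat aAsked 0 = M * (2 * T)
  cells : CellsOK ω n T σ (M * (2 * T) * n)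
  size : σ.nat aSize 0 = n
  locality : σ.nat aSize 1 = k
  trials : σ.nat aTrials 0 = T
  groups : σ.nat aGroups 0 = M
  stride : σ.nat aStride 0 = T * n
  accuracy : σ.real 0 0 = ε
  scale : σ.real rScale 0 = 41 ^ k
  count : σ.nat aCount 0 = 0
  row : σ.nat aRow 0 = 0
  string : ∀ x, σ.nat aString x = 0

theorem wp_designProg {n k : ℕ} {ε δ : ℝ} (hpos : 0 < n / δ) :
    WP ω designProg (initState n k ε δ) fun s τ =>
      s ≤ 1000 * ((groupCount n k δ + logCount n δ + k + 1) * ((n + 1) * (trialCount k ε + 1))) ∧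
      Designed ω n k ε (trialCount k ε) (groupCount n k δ) τ := by
  have hfinal : ∀ τ, Frame designProg (initState n k ε δ) τ → τ.nat aSize 0 = n ∧
      τ.nat aSize 1 = k ∧ τ.real 0 0 = ε ∧ τ.nat aCount 0 = 0 ∧ τ.nat aRow 0 = 0 ∧
      ∀ x, τ.nat aString x = 0 := by
    intro τ hf
    rw [hf.nat aSize rfl, hf.real 0 rfl, hf.nat aCount rfl, hf.nat aRow rfl, hf.nat aString rfl]
    simp [initState]
  suffices h : WP ω designProg (initState n k ε δ) fun s τ =>
      s ≤ 1000 * ((groupCount n k δ + logCount n δ + k + 1) * ((n + 1) * (trialCount k ε + 1))) ∧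
      τ.nat aAsked 0 = groupCount n k δ * (2 * trialCount k ε) ∧
      CellsOK ω n (trialCount k ε) τ (groupCount n k δ * (2 * trialCount k ε) * n) ∧
      τ.nat aTrials 0 = trialCount k ε ∧ τ.nat aGroups 0 = groupCount n k δ ∧
      τ.nat aStride 0 = trialCount k ε * n ∧ τ.real rScale 0 = 41 ^ k by
    refine h.mono ?_
    rintro s τ hf ⟨h1, h2, h3, h4, h5, h6, h7⟩
    obtain ⟨g1, g2, g3, g4, g5, g6⟩ := hfinal τ hf
    exact ⟨h1, h2, h3, g1, g2, h4, h5, h6, g3, h7, g4, g5, g6⟩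
  rw [designProg, wp_seq]
  refine (wp_logProg (n := n) (δ := δ) (by simp [initState]) (by simp [initState]) hpos
    (by simp [initState])).mono ?_
  rintro t₁ τ₁ hf₁ ⟨ht₁, hL₁⟩
  have hn₁ : τ₁.nat aSize = (initState n k ε δ).nat aSize := hf₁.nat _ rfl
  have hr₁ : τ₁.real 0 = (initState n k ε δ).real 0 := hf₁.real _ rfl
  have hcoin₁ : τ₁.coins = 0 := hf₁.coins rfl
  have hN₁ : τ₁.nat aAsked 0 = 0 := by rw [hf₁.nat _ rfl]; simp [initState]
  rw [wp_seq]
  refine (wp_scaleProg (k := k) (by rw [hn₁]; simp [initState])).mono ?_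
  rintro t₂ τ₂ hf₂ ⟨ht₂, hD₂⟩
  have hn₂ : τ₂.nat aSize = (initState n k ε δ).nat aSize := by rw [hf₂.nat _ rfl, hn₁]
  have hr₂ : τ₂.real 0 = (initState n k ε δ).real 0 := by rw [hf₂.real _ rfl, hr₁]
  have hcoin₂ : τ₂.coins = 0 := by rw [hf₂.coins rfl, hcoin₁]
  have hN₂ : τ₂.nat aAsked 0 = 0 := by rw [hf₂.nat _ rfl, hN₁]
  have hL₂ : τ₂.nat aLog 0 = logCount n δ := by rw [hf₂.nat _ rfl, hL₁]
  rw [wp_seq]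
  refine (wp_ceilProg (r := 2000 * 41 ^ k / (ε * ε)) ?_).mono ?_
  · intro τ hf
    simp [RExp.eval, NExp.eval, hf.real 0 rfl, hf.real rScale rfl, hr₂, hD₂, initState]
  rintro t₃ τ₃ hf₃ ⟨ht₃, hT₃⟩
  have hn₃ : τ₃.nat aSize = (initState n k ε δ).nat aSize := by rw [hf₃.nat _ rfl, hn₂]
  have hcoin₃ : τ₃.coins = 0 := by rw [hf₃.coins rfl, hcoin₂]
  have hN₃ : τ₃.nat aAsked 0 = 0 := by rw [hf₃.nat _ rfl, hN₂]
  have hL₃ : τ₃.nat aLog 0 = logCount n δ := by rw [hf₃.nat _ rfl, hL₂]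
  have hD₃ : τ₃.real rScale 0 = 41 ^ k := by rw [hf₃.real _ rfl, hD₂]
  rw [wp_seq]
  refine (wp_ceilProg (r := 384 * ((k : ℝ) + 1) * logCount n δ * 41 ^ k) ?_).mono ?_
  · intro τ hf
    simp [RExp.eval, NExp.eval, hf.nat aSize rfl, hf.real rScale rfl, hf.nat aLog rfl, hn₃, hD₃,
      hL₃, initState]
  rintro t₄ τ₄ hf₄ ⟨ht₄, hM₄⟩
  have hn₄ : τ₄.nat aSize = (initState n k ε δ).nat aSize := by rw [hf₄.nat _ rfl, hn₃]
  have hcoin₄ : τ₄.coins = 0 := by rw [hf₄.coins rfl, hcoin₃]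
  have hN₄ : τ₄.nat aAsked 0 = 0 := by rw [hf₄.nat _ rfl, hN₃]
  have hT₄ : τ₄.nat aTrials 0 = trialCount k ε := by rw [hf₄.nat _ rfl, hT₃, trialCount]
  have hD₄ : τ₄.real rScale 0 = 41 ^ k := by rw [hf₄.real _ rfl, hD₃]
  replace hM₄ : τ₄.nat aGroups 0 = groupCount n k δ := hM₄
  change t₃ ≤ _ * (trialCount k ε + 1) at ht₃
  change t₄ ≤ _ * (groupCount n k δ + 1) at ht₄
  set T := trialCount k ε
  set M := groupCount n k δ
  rw [wp_seq]
  refine (wp_strideProg (n := n) (T := T) (by rw [hn₄]; simp [initState]) hT₄).mono ?_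
  rintro t₅ τ₅ hf₅ ⟨ht₅, hS₅⟩
  have hn₅ : τ₅.nat aSize 0 = n := by rw [hf₅.nat _ rfl, hn₄]; simp [initState]
  have hcoin₅ : τ₅.coins = 0 := by rw [hf₅.coins rfl, hcoin₄]
  have hN₅ : τ₅.nat aAsked 0 = 0 := by rw [hf₅.nat _ rfl, hN₄]
  have hT₅ : τ₅.nat aTrials 0 = T := by rw [hf₅.nat _ rfl, hT₄]
  have hD₅ : τ₅.real rScale 0 = 41 ^ k := by rw [hf₅.real _ rfl, hD₄]
  have hM₅ : τ₅.nat aGroups 0 = M := by rw [hf₅.nat _ rfl, hM₄]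
  rw [wp_seq, wp_setNat]
  refine WP.forLoop (fun m τ => τ.coins = m * coinsPerGroup n T ∧
    τ.nat aCell 0 = m * (2 * T) * n ∧ CellsOK ω n T τ (m * (2 * T) * n) ∧
    τ.nat aAsked 0 = m * (2 * T)) 0 M (400 * ((n + 1) * (T + 1))) (Nat.zero_le _) rfl rfl ?_ ?_ ?_
    ?_ ?_
  · rintro j τ v ⟨h1, h2, h3, h4⟩
    exact ⟨h1, by simpa using h2, h3.congr (by simp) (by simp) (by simp) (by simp),
      by simpa using h4⟩
  · refine ⟨by simpa using hcoin₅, by simp [NExp.eval], ?_, by simpa using hN₅⟩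
    intro m t i _ _ h
    simp at h
  · intro τ hf
    rw [NExp.eval_var, hf.nat _ rfl, State.setNat_nat_ne _ _ _ (by decide), hM₅]
  · rintro m τ - hm hf - ⟨h1, h2, h3, h4⟩
    refine (wp_groupProg (by rw [hf.nat _ rfl, State.setNat_nat_ne _ _ _ (by decide), hn₅])
      (by rw [hf.nat _ rfl, State.setNat_nat_ne _ _ _ (by decide), hT₅]) h1 h2 h3).mono ?_
    rintro s τ' - ⟨k1, k2, k3, k4, k5⟩
    exact ⟨k1, k2, k3, k4, by rw [k5, h4]; ring⟩
  · rintro s τ hf ⟨-, -, h3, h4⟩ hs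
    refine ⟨?_, h4, h3, ?_, ?_, ?_, ?_⟩
    · simp only [NExp.cost, NExp.cost_var, RExp.cost, RExp.cost_var, Nat.sub_zero] at hs ht₃ ht₄ ⊢
      set L := logCount n δ
      have e1 : M + L + k + 1 ≤ (M + L + k + 1) * ((n + 1) * (T + 1)) :=
        Nat.le_mul_of_pos_right _ (Nat.mul_pos (Nat.succ_pos _) (Nat.succ_pos _))
      have e2 : T + 1 ≤ (M + L + k + 1) * ((n + 1) * (T + 1)) :=
        (Nat.le_mul_of_pos_left _ (Nat.succ_pos n)).trans
          (Nat.le_mul_of_pos_left _ (Nat.succ_pos _))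
      have e3 : (M + 1) * (400 * ((n + 1) * (T + 1)) + 2 + 10) ≤
          420 * ((M + L + k + 1) * ((n + 1) * (T + 1))) := by
        have : 1 ≤ (n + 1) * (T + 1) := Nat.mul_pos (Nat.succ_pos _) (Nat.succ_pos _)
        calc _ ≤ (M + L + k + 1) * (420 * ((n + 1) * (T + 1))) :=
              Nat.mul_le_mul (by omega) (by omega)
          _ = _ := by ring
      generalize (M + L + k + 1) * ((n + 1) * (T + 1)) = X at e1 e2 e3 ⊢
      generalize (M + 1) * (400 * ((n + 1) * (T + 1)) + 2 + 10) = Y at hs e3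
      omega
    all_goals
      first
      | rw [hf.nat _ rfl, State.setNat_nat_ne _ _ _ (by decide)]; assumption
      | rw [hf.real _ rfl, State.setNat_real]; assumption

end HamLearn

namespace HamLearn

/-! ### Tensor products and Pauli coefficients -/

section Tensor

variable {n : ℕ}

theorem tensor_mul (M N : Fin n → Matrix (Fin 2) (Fin 2) ℂ) :
    tensor M * tensor N = tensor fun i => M i * N i := by
  ext x y
  simp only [tensor, Matrix.mul_apply, ← Finset.prod_mul_distrib]
  rw [Finset.prod_univ_sum, Fintype.piFinset_univ]

theorem trace_tensor (M : Fin n → Matrix (Fin 2) (Fin 2) ℂ) :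
    (tensor M).trace = ∏ i, (M i).trace := by
  simp only [tensor, Matrix.trace, Matrix.diag]
  rw [Finset.prod_univ_sum, Fintype.piFinset_univ]

theorem tensor_conjTranspose (M : Fin n → Matrix (Fin 2) (Fin 2) ℂ) :
    (tensor M)ᴴ = tensor fun i => (M i)ᴴ := by
  ext x y
  simp [tensor, Matrix.conjTranspose_apply]

theorem tensor_one : tensor (fun _ : Fin n => (1 : Matrix (Fin 2) (Fin 2) ℂ)) = 1 := by
  ext x y
  simp only [tensor, Matrix.one_apply, Finset.prod_ite_zero, Finset.mem_univ, true_imp_iff,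
    Finset.prod_const_one, funext_iff]

theorem tensor_sum {ι : Type*} [Fintype ι] (c : Fin n → ι → ℂ)
    (M : Fin n → ι → Matrix (Fin 2) (Fin 2) ℂ) :
    tensor (fun l => ∑ a, c l a • M l a) =
      ∑ r : Fin n → ι, (∏ l, c l (r l)) • tensor fun l => M l (r l) := by
  classical
  ext x y
  simp only [tensor, Matrix.sum_apply, Matrix.smul_apply, smul_eq_mul, ← Finset.prod_mul_distrib]
  rw [Finset.prod_univ_sum, Fintype.piFinset_univ]

theorem trace_pauli_mul_pauli (a b : Fin 4) :
    (pauli a * pauli b).trace = if a = b then 2 else 0 := by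
  fin_cases a <;> fin_cases b <;>
    simp [pauli, Matrix.trace, Fin.sum_univ_two] <;> norm_num

theorem sum_pauli_mul_star (x y x' y' : Fin 2) :
    ∑ a : Fin 4, pauli a x y * star (pauli a x' y') = if x = x' ∧ y = y' then 2 else 0 := by
  fin_cases x <;> fin_cases y <;> fin_cases x' <;> fin_cases y' <;>
    simp [pauli, Fin.sum_univ_four] <;> norm_num

/-- The real part of the coefficient of the Pauli string `R` in the expansion of `A`. -/
noncomputable def coeff (A : Op n) (R : PauliString n) : ℝ := (R.op * A).trace.re / 2 ^ n

theorem sum_op_mul_star (x y x' y' : Fin n → Fin 2) :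
    ∑ R : PauliString n, R.op x y * star (R.op x' y') =
      if x = x' ∧ y = y' then (2 : ℂ) ^ n else 0 := by
  simp only [PauliString.op, tensor, star_prod, ← Finset.prod_mul_distrib]
  rw [← Fintype.piFinset_univ, ← Finset.prod_univ_sum (fun _ => Finset.univ)
    (fun i a => pauli a (x i) (y i) * star (pauli a (x' i) (y' i)))]
  simp only [sum_pauli_mul_star, Finset.prod_ite_zero, Finset.mem_univ, true_imp_iff,
    Finset.prod_const, Finset.card_univ, Fintype.card_fin, funext_iff, ← forall_and]

/-- Bessel's inequality for the Pauli strings. -/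
theorem sum_coeff_sq_le (E : Op n) : ∑ R, coeff E R ^ 2 ≤ normalizedFrobenius E ^ 2 := by
  have htr : ∀ R : PauliString n, (R.op * E).trace =
      ∑ p : (Fin n → Fin 2) × (Fin n → Fin 2), R.op p.1 p.2 * E p.2 p.1 := by
    intro R
    rw [Fintype.sum_prod_type]
    rfl
  have hsum : ∑ R : PauliString n, (R.op * E).trace * star (R.op * E).trace =
      (2 : ℂ) ^ n * ∑ p : (Fin n → Fin 2) × (Fin n → Fin 2), E p.2 p.1 * star (E p.2 p.1) := by
    calc _ = ∑ R : PauliString n, ∑ p : (Fin n → Fin 2) × (Fin n → Fin 2),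
          ∑ q : (Fin n → Fin 2) × (Fin n → Fin 2),
          (R.op p.1 p.2 * star (R.op q.1 q.2)) * (E p.2 p.1 * star (E q.2 q.1)) := by
          refine Finset.sum_congr rfl fun R _ => ?_
          rw [htr, star_sum, Finset.sum_mul_sum]
          refine Finset.sum_congr rfl fun p _ => Finset.sum_congr rfl fun q _ => ?_
          rw [star_mul']
          ring
      _ = ∑ p : (Fin n → Fin 2) × (Fin n → Fin 2), ∑ q : (Fin n → Fin 2) × (Fin n → Fin 2),
          (∑ R : PauliString n, R.op p.1 p.2 * star (R.op q.1 q.2)) *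
            (E p.2 p.1 * star (E q.2 q.1)) := by
          rw [Finset.sum_comm]
          refine Finset.sum_congr rfl fun p _ => ?_
          rw [Finset.sum_comm]
          refine Finset.sum_congr rfl fun q _ => ?_
          rw [Finset.sum_mul]
      _ = _ := by
          rw [Finset.mul_sum]
          refine Finset.sum_congr rfl fun p _ => ?_
          simp only [sum_op_mul_star, ← Prod.ext_iff]
          simp
  have hreal : ∑ R : PauliString n, Complex.normSq (R.op * E).trace =
      2 ^ n * ∑ x, ∑ y, ‖E x y‖ ^ 2 := by
    have : ∀ z : ℂ, z * star z = ((Complex.normSq z : ℝ) : ℂ) := fun z => Complex.mul_conj z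
    simp only [this] at hsum
    rw [Fintype.sum_prod_type, Finset.sum_comm] at hsum
    simp only [← Complex.normSq_eq_norm_sq]
    exact_mod_cast hsum
  have hnF : normalizedFrobenius E ^ 2 = (∑ x, ∑ y, ‖E x y‖ ^ 2) / 2 ^ n := by
    rw [normalizedFrobenius, div_pow, Real.sq_sqrt, Real.sq_sqrt (by positivity)]
    exact Finset.sum_nonneg fun x _ => Finset.sum_nonneg fun y _ => sq_nonneg _
  rw [hnF]
  calc ∑ R, coeff E R ^ 2 ≤ ∑ R : PauliString n, Complex.normSq (R.op * E).trace / (2 ^ n) ^ 2 := by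
        refine Finset.sum_le_sum fun R _ => ?_
        rw [coeff, div_pow, Complex.normSq_apply]
        gcongr
        nlinarith [mul_self_nonneg (R.op * E).trace.im]
    _ = _ := by
        rw [← Finset.sum_div, hreal]
        field_simp

end Tensor

/-! ### Random experiments -/

section Trial

variable {n : ℕ}

/-- The Bloch sign of the eigenstate with code `e`. -/
def codeSign (e : Fin 6) : Bool := decide (3 ≤ (e : ℕ))

/-- The axis of the eigenstate with code `e`. -/
def codeAxis (e : Fin 6) : Fin 3 := Fin.ofNat 3 e

/-- The circuit that prepares the states with codes `e` and measures along the axes with codes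
`u`. -/
def codeCircuit (e u : Fin n → Fin 6) : Circuit n where
  prepAxis i := codeAxis (e i)
  prepSign i := codeSign (e i)
  measAxis i := codeAxis (u i)

/-- The eigenprojector of the Pauli matrix with axis `a` for the eigenvalue with sign bit `b`. -/
noncomputable def proj (a : Fin 3) (b : Bool) : Matrix (Fin 2) (Fin 2) ℂ :=
  (1 / 2 : ℂ) • (1 + bitSign b • pauli a.succ)

theorem eigenProjector_eq (A : Fin n → Fin 3) (v : Fin n → Bool) :
    eigenProjector A v = tensor fun i => proj (A i) (v i) := rfl

theorem proj_mul_self (a : Fin 3) (b : Bool) : proj a b * proj a b = proj a b := by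
  have hσ : pauli a.succ * pauli a.succ = 1 := by
    fin_cases a <;> ext i j <;> fin_cases i <;> fin_cases j <;>
      simp [pauli]
  have hs : bitSign b * bitSign b = 1 := by cases b <;> simp [bitSign]
  rw [proj, smul_mul_smul_comm, add_mul, mul_add, mul_add, smul_mul_smul_comm, hσ, hs, one_smul,
    mul_one, one_mul, mul_one]
  module

theorem proj_conjTranspose (a : Fin 3) (b : Bool) : (proj a b)ᴴ = proj a b := by
  fin_cases a <;> cases b <;> ext i j <;> fin_cases i <;> fin_cases j <;>
    simp [proj, pauli, bitSign, Matrix.conjTranspose_apply] <;> norm_num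

theorem trace_proj (a : Fin 3) (b : Bool) : (proj a b).trace = 1 := by
  fin_cases a <;> cases b <;> simp [proj, pauli, bitSign, Matrix.trace, Fin.sum_univ_two] <;>
    norm_num

theorem sum_proj (a : Fin 3) : ∑ b, proj a b = 1 := by
  fin_cases a <;> ext i j <;> fin_cases i <;> fin_cases j <;>
    simp [proj, pauli, bitSign] <;> norm_num

theorem outcomeProb_nonneg (c : Circuit n) (Z : Op n) (w : Fin n → Bool) :
    0 ≤ c.outcomeProb Z w := by
  have hE : ∀ (A : Fin n → Fin 3) v,
      eigenProjector A v * eigenProjector A v = eigenProjector A v := by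
    intro A v
    simp [eigenProjector_eq, tensor_mul, proj_mul_self]
  have hH : ∀ (A : Fin n → Fin 3) v, (eigenProjector A v)ᴴ = eigenProjector A v := by
    intro A v
    simp [eigenProjector_eq, tensor_conjTranspose, proj_conjTranspose]
  set E := eigenProjector c.measAxis w with hEdef
  set ρ := eigenProjector c.prepAxis c.prepSign with hρ
  have key : (E * (Z * ρ * Zᴴ)).trace = ((ρ * Zᴴ * E)ᴴ * (ρ * Zᴴ * E)).trace := by
    simp only [Matrix.conjTranspose_mul, Matrix.conjTranspose_conjTranspose]
    rw [hEdef, hρ, hH, hH, ← hEdef, ← hρ]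
    have : E * (Z * ρ) * (ρ * Zᴴ * E) = E * (Z * (ρ * ρ) * Zᴴ) * E := by
      simp only [Matrix.mul_assoc]
    have hEE : E * E = E := hE _ _
    rw [this, hρ, hE, ← hρ, Matrix.trace_mul_comm _ E]
    simp only [← Matrix.mul_assoc, hEE]
  rw [Circuit.outcomeProb, ← hEdef, ← hρ, key]
  simp only [Matrix.trace, Matrix.diag, Matrix.mul_apply, Matrix.conjTranspose_apply,
    Complex.re_sum]
  refine Finset.sum_nonneg fun x _ => Finset.sum_nonneg fun y _ => ?_
  simp only [Complex.star_def, ← Complex.normSq_eq_conj_mul_self, Complex.ofReal_re]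
  exact Complex.normSq_nonneg _

theorem sum_outcomeProb (c : Circuit n) {Z : Op n}
    (hZ : Z ∈ Matrix.unitaryGroup (Fin n → Fin 2) ℂ) :
    ∑ w, c.outcomeProb Z w = 1 := by
  have h1 : ∑ w, eigenProjector c.measAxis w = 1 := by
    have := tensor_sum (fun _ _ => 1) (fun l b => proj (c.measAxis l) b)
    simp only [one_smul, sum_proj, tensor_one, Finset.prod_const_one] at this
    rw [this]
    rfl
  simp only [Circuit.outcomeProb]
  rw [← Complex.re_sum, ← Matrix.trace_sum, ← Finset.sum_mul, h1, one_mul, Matrix.trace_mul_comm,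
    ← Matrix.mul_assoc, ← Matrix.star_eq_conjTranspose, Matrix.mem_unitaryGroup_iff'.mp hZ, one_mul,
    eigenProjector_eq, trace_tensor]
  simp [trace_proj]

/-- The preparation of a qubit: `none` if the state is chosen afresh for every experiment, and
`some b` if the qubit is always in the state with code `b`. -/
abbrev Pattern (n : ℕ) := Fin n → Option (Fin 6)

/-- The data of an experiment: the codes of the fresh states, and the codes of the measured axes
together with the outcomes. -/
abbrev Trial (n : ℕ) := (Fin n → Fin 6) × (Fin n → Fin 6 × Bool)

/-- The circuit of an experiment. -/
def trialCircuit (φ : Pattern n) (d : Trial n) : Circuit n :=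
  codeCircuit (fun l => (φ l).getD (d.1 l)) fun l => (d.2 l).1

/-- The probability of an experiment. -/
noncomputable def trialWeight (Z : Op n) (φ : Pattern n) (d : Trial n) : ℝ :=
  (1 / 6) ^ n * (1 / 6) ^ n * (trialCircuit φ d).outcomeProb Z fun l => (d.2 l).2

/-- The code of the prepared state as it is seen by the processing program. -/
def seenCode (φ : Option (Fin 6)) (x : Fin 6) : ℕ := φ.elim (x : ℕ) fun _ => 6

/-- The factor that a qubit with label `a` in the string contributes to the statistic. -/
noncomputable def prepFactor (φ : Option (Fin 6)) (a : Fin 4) (x : Fin 6) : ℝ :=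
  if a = 0 then 1 else chi (seenCode φ x) a

/-- The factor that the measured qubit contributes to the statistic. -/
noncomputable def measFactor (P : Fin 4) (u : Fin 6 × Bool) : ℝ := psi u.1 (if u.2 then 1 else 0) P

/-- The statistic of the string `R` in an experiment. -/
noncomputable def trialStat (φ : Pattern n) (i : Fin n) (P : Fin 4) (R : PauliString n)
    (d : Trial n) : ℝ :=
  measFactor P (d.2 i) * ∏ l, prepFactor (φ l) (R l) (d.1 l)

/-- The contribution of a qubit to the coefficients of the conditional mean of the statistic: `v` is
the label in the string whose statistic is considered, and `a` runs over the four labels. -/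
noncomputable def kernel (φ : Option (Fin 6)) (v a : Fin 4) : ℝ :=
  φ.elim (if a = v then 1 else 0) fun b =>
    if v = 0 then
      (if a = 0 then 1 else if a = (codeAxis b).succ then (if codeSign b then -1 else 1) else 0)
    else 0

/-- The label `P` at the qubit `i` and `0` elsewhere. -/
def single (i : Fin n) (P : Fin 4) : PauliString n := Function.update 0 i P

/-- The observable that is measured, in the Heisenberg picture. -/
noncomputable def evolved (Z : Op n) (i : Fin n) (P : Fin 4) : Op n := Zᴴ * (single i P).op * Z

/-- The mean of the statistic for a fixed preparation pattern. -/
noncomputable def trialMean (Z : Op n) (φ : Pattern n) (i : Fin n) (P : Fin 4)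
    (R : PauliString n) : ℝ :=
  ∑ R' : PauliString n, coeff (evolved Z i P) R' * ∏ l, kernel (φ l) (R l) (R' l)

theorem pauli_zero : pauli 0 = 1 := rfl

theorem sum_const_sixth (A : Matrix (Fin 2) (Fin 2) ℂ) : ∑ _x : Fin 6, (1 / 6 : ℂ) • A = A := by
  rw [Finset.sum_const, Finset.card_univ, Fintype.card_fin, ← Nat.cast_smul_eq_nsmul ℂ, smul_smul]
  norm_num

/-- The prepared state, weighted with the statistic and averaged over the coins: the Pauli matrix
with label `v` if the state is chosen afresh. -/
theorem sum_prepFactor_proj (φ : Option (Fin 6)) (v : Fin 4) :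
    ∑ x : Fin 6, ((1 / 6 : ℂ) * prepFactor φ v x) •
        proj (codeAxis (φ.getD x)) (codeSign (φ.getD x)) =
      ∑ a, ((1 / 2 : ℂ) * kernel φ v a) • pauli a := by
  cases φ with
  | none =>
    fin_cases v <;>
    · simp [Fin.sum_univ_six, Fin.sum_univ_four, prepFactor, seenCode, chi, kernel, codeAxis,
        codeSign, proj, bitSign, Fin.ofNat, pauli_zero]
      module
  | some b =>
    fin_cases v
    · have h : ∀ x : Fin 6, (1 / 6 : ℂ) * prepFactor (some b) 0 x = 1 / 6 := by
        simp [prepFactor]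
      simp only [Fin.zero_eta, h, Option.getD_some, sum_const_sixth]
      fin_cases b <;>
      · simp [Fin.sum_univ_four, kernel, codeAxis, codeSign, proj, bitSign, Fin.ofNat, pauli_zero]
        try module
    all_goals simp [prepFactor, seenCode, chi, kernel]

/-- The effect of the outcome, weighted with the statistic and averaged over the axes, is the
observable `P`. -/
theorem sum_measFactor_proj {P : Fin 4} (hP : P ≠ 0) :
    ∑ u : Fin 6 × Bool, ((1 / 6 : ℂ) * measFactor P u) • proj (codeAxis u.1) u.2 = pauli P := by
  rw [Fintype.sum_prod_type]
  fin_cases P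
  · exact absurd rfl hP
  all_goals
    simp [Fin.sum_univ_six, measFactor, psi, codeAxis, proj, bitSign, Fin.ofNat]
    module

theorem sum_unit_proj : ∑ u : Fin 6 × Bool, (1 / 6 : ℂ) • proj (codeAxis u.1) u.2 = 1 := by
  rw [Fintype.sum_prod_type]
  simp only [← Finset.smul_sum, sum_proj]
  simp only [Finset.smul_sum]
  exact sum_const_sixth 1

theorem sum_meas_op (i : Fin n) {P : Fin 4} (hP : P ≠ 0) :
    ∑ a : Fin n → Fin 6 × Bool, ((1 / 6 : ℂ) ^ n * measFactor P (a i)) •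
      eigenProjector (fun l => codeAxis (a l).1) (fun l => (a l).2) = (single i P).op := by
  have h := tensor_sum (fun (l : Fin n) (u : Fin 6 × Bool) => (1 / 6 : ℂ) *
    if l = i then (measFactor P u : ℂ) else 1) fun _ u => proj (codeAxis u.1) u.2
  have h1 : ∀ a : Fin n → Fin 6 × Bool, (1 / 6 : ℂ) ^ n * measFactor P (a i) =
      ∏ l, (1 / 6 : ℂ) * if l = i then (measFactor P (a l) : ℂ) else 1 := by
    intro a
    rw [Finset.prod_mul_distrib, Finset.prod_const, Finset.card_univ, Fintype.card_fin,
      Finset.prod_ite_eq' Finset.univ i, if_pos (Finset.mem_univ _)]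
  simp only [h1, eigenProjector_eq]
  rw [← h, PauliString.op]
  congr 1
  funext l
  by_cases hl : l = i
  · subst hl
    simp only [if_true, sum_measFactor_proj hP, single, Function.update_self]
  · simp only [hl, if_false, mul_one, sum_unit_proj, single]
    rw [Function.update_of_ne hl]
    exact pauli_zero.symm

theorem sum_prep_op (φ : Pattern n) (R : PauliString n) :
    ∑ x : Fin n → Fin 6, (∏ l, (1 / 6 : ℂ) * prepFactor (φ l) (R l) (x l)) •
      eigenProjector (fun l => codeAxis ((φ l).getD (x l))) (fun l => codeSign ((φ l).getD (x l))) =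
    ∑ R' : PauliString n, (∏ l, (1 / 2 : ℂ) * kernel (φ l) (R l) (R' l)) • R'.op := by
  have h := tensor_sum (fun (l : Fin n) (x : Fin 6) => (1 / 6 : ℂ) * prepFactor (φ l) (R l) x)
    fun l x => proj (codeAxis ((φ l).getD x)) (codeSign ((φ l).getD x))
  have h' := tensor_sum (fun (l : Fin n) (a : Fin 4) => (1 / 2 : ℂ) * kernel (φ l) (R l) a)
    fun _ a => pauli a
  simp only [eigenProjector_eq, PauliString.op]
  rw [← h, ← h']
  simp only [sum_prepFactor_proj]

/-- The mean of the statistic. Since the statistic is a product over the qubits, the averages of the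
prepared states and of the measured effects, weighted with its factors, are tensor products. -/
theorem trialMean_eq (Z : Op n) (φ : Pattern n) (i : Fin n) {P : Fin 4} (hP : P ≠ 0)
    (R : PauliString n) :
    ∑ d, trialWeight Z φ d * trialStat φ i P R d = trialMean Z φ i P R := by
  have h1 : ∀ d : Trial n, trialWeight Z φ d * trialStat φ i P R d =
      ((((1 / 6 : ℂ) ^ n * measFactor P (d.2 i)) •
        eigenProjector (fun l => codeAxis (d.2 l).1) (fun l => (d.2 l).2)) * (Z *
        ((∏ l, (1 / 6 : ℂ) * prepFactor (φ l) (R l) (d.1 l)) • eigenProjector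
          (fun l => codeAxis ((φ l).getD (d.1 l))) (fun l => codeSign ((φ l).getD (d.1 l)))) *
        Zᴴ)).trace.re := by
    intro d
    rw [trialWeight, trialStat, Circuit.outcomeProb, Matrix.mul_smul, Matrix.smul_mul,
      Matrix.smul_mul, Matrix.mul_smul, smul_smul, Matrix.trace_smul, smul_eq_mul]
    have : (1 / 6 : ℂ) ^ n * measFactor P (d.2 i) *
        (∏ l, (1 / 6 : ℂ) * prepFactor (φ l) (R l) (d.1 l)) =
        (((1 / 6) ^ n * measFactor P (d.2 i) * ((1 / 6) ^ n *
          ∏ l, prepFactor (φ l) (R l) (d.1 l)) : ℝ) : ℂ) := by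
      push_cast
      rw [Finset.prod_mul_distrib, Finset.prod_const, Finset.card_univ, Fintype.card_fin]
    rw [this, Complex.re_ofReal_mul]
    simp only [trialCircuit, codeCircuit]
    ring
  rw [Finset.sum_congr rfl fun d _ => h1 d, ← Complex.re_sum, ← Matrix.trace_sum,
    Fintype.sum_prod_type]
  simp only [← Finset.sum_mul, ← Finset.mul_sum, sum_meas_op i hP]
  rw [sum_prep_op]
  rw [Finset.mul_sum, Finset.sum_mul, Finset.mul_sum, Matrix.trace_sum, Complex.re_sum, trialMean]
  refine Finset.sum_congr rfl fun R' _ => ?_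
  rw [Matrix.mul_smul, Matrix.smul_mul, Matrix.mul_smul, Matrix.trace_smul, smul_eq_mul]
  have h2 : (∏ l, (1 / 2 : ℂ) * kernel (φ l) (R l) (R' l)) =
      (((1 / 2) ^ n * ∏ l, kernel (φ l) (R l) (R' l) : ℝ) : ℂ) := by
    push_cast
    rw [Finset.prod_mul_distrib, Finset.prod_const, Finset.card_univ, Fintype.card_fin]
  have h3 : ((single i P).op * (Z * R'.op * Zᴴ)).trace = (R'.op * evolved Z i P).trace := by
    rw [evolved, ← Matrix.mul_assoc, ← Matrix.mul_assoc, Matrix.trace_mul_comm, ← Matrix.mul_assoc,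
      ← Matrix.mul_assoc, Matrix.trace_mul_comm]
  rw [h2, Complex.re_ofReal_mul, h3, coeff, one_div, inv_pow]
  ring

/-- The states and the axes of an experiment are independent and uniformly distributed. -/
theorem sum_trialWeight_mul {Z : Op n} (hZ : Z ∈ Matrix.unitaryGroup (Fin n → Fin 2) ℂ)
    (φ : Pattern n) (f g : (Fin n → Fin 6) → ℝ) :
    ∑ d, trialWeight Z φ d * (f d.1 * g fun l => (d.2 l).1) =
      ((1 / 6) ^ n * ∑ x, f x) * ((1 / 6) ^ n * ∑ u, g u) := by
  have h1 : ∀ x, ∑ a : Fin n → Fin 6 × Bool, trialWeight Z φ (x, a) * (f x * g fun l => (a l).1) =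
      ((1 / 6) ^ n * f x) * ((1 / 6) ^ n * ∑ u, g u) := by
    intro x
    rw [← (Equiv.arrowProdEquivProdArrow (Fin n) (fun _ => Fin 6) (fun _ => Bool)).symm.sum_comp,
      Fintype.sum_prod_type]
    simp only [Equiv.arrowProdEquivProdArrow, Equiv.coe_fn_symm_mk, trialWeight, trialCircuit]
    rw [Finset.mul_sum, Finset.mul_sum]
    refine Finset.sum_congr rfl fun u _ => ?_
    rw [← Finset.sum_mul, ← Finset.mul_sum, sum_outcomeProb _ hZ]
    ring
  rw [Fintype.sum_prod_type]
  simp only [h1]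
  rw [← Finset.sum_mul, ← Finset.mul_sum]

theorem sixth_pow_mul_sum_prod (f : Fin n → Fin 6 → ℝ) :
    (1 / 6 : ℝ) ^ n * ∑ x : Fin n → Fin 6, ∏ l, f l (x l) = ∏ l, (1 / 6) * ∑ x, f l x := by
  rw [Finset.prod_mul_distrib, Finset.prod_const, Finset.card_univ, Fintype.card_fin,
    Finset.prod_univ_sum, Fintype.piFinset_univ]

theorem sum_trialWeight {Z : Op n} (hZ : Z ∈ Matrix.unitaryGroup (Fin n → Fin 2) ℂ)
    (φ : Pattern n) : ∑ d, trialWeight Z φ d = 1 := by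
  have h := sum_trialWeight_mul hZ φ (fun _ => 1) fun _ => 1
  simpa using h

theorem sum_prepFactor_sq (φ : Option (Fin 6)) (v : Fin 4) :
    (1 / 6 : ℝ) * ∑ x, prepFactor φ v x ^ 2 = if v = 0 then 1 else if φ = none then 3 else 0 := by
  cases φ with
  | none =>
    fin_cases v <;> simp [Fin.sum_univ_six, prepFactor, seenCode, chi] <;> norm_num
  | some b => fin_cases v <;> simp [prepFactor, seenCode, chi]

/-- The second moment of the statistic does not depend on the unitary. -/
theorem sum_trialWeight_mul_sq {Z : Op n} (hZ : Z ∈ Matrix.unitaryGroup (Fin n → Fin 2) ℂ)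
    (φ : Pattern n) (i : Fin n) {P : Fin 4} (hP : P ≠ 0) (R : PauliString n) :
    ∑ d, trialWeight Z φ d * trialStat φ i P R d ^ 2 =
      3 * ∏ l, if R l = 0 then 1 else if φ l = none then 3 else 0 := by
  have hm : ∀ a : Fin 6 × Bool, measFactor P a ^ 2 = measFactor P (a.1, false) ^ 2 := by
    rintro ⟨u, w⟩
    simp only [measFactor, psi]
    cases w <;> simp
  have hP' : (1 / 6 : ℝ) * ∑ u, measFactor P (u, false) ^ 2 = 3 := by
    fin_cases P
    · exact absurd rfl hP
    all_goals
      simp [Fin.sum_univ_six, measFactor, psi]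
      norm_num
  have h := sum_trialWeight_mul hZ φ (fun x => ∏ l, prepFactor (φ l) (R l) (x l) ^ 2)
    fun u => ∏ l, if l = i then measFactor P (u l, false) ^ 2 else 1
  rw [sixth_pow_mul_sum_prod fun l x => prepFactor (φ l) (R l) x ^ 2,
    sixth_pow_mul_sum_prod fun l x =>
    if l = i then measFactor P (x, false) ^ 2 else 1] at h
  simp only [sum_prepFactor_sq, Finset.prod_ite_eq', Finset.mem_univ, if_true] at h
  have h2 : ∀ l : Fin n, (1 / 6 : ℝ) * ∑ x : Fin 6, (if l = i then measFactor P (x, false) ^ 2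
      else 1) = if l = i then 3 else 1 := by
    intro l
    split_ifs
    · exact hP'
    · simp
  simp only [h2, Finset.prod_ite_eq', Finset.mem_univ, if_true] at h
  rw [mul_comm, ← h]
  refine Finset.sum_congr rfl fun d _ => ?_
  rw [trialStat, mul_pow, hm, Finset.prod_pow]
  ring

theorem abs_trialStat_le (φ : Pattern n) (i : Fin n) (P : Fin 4) (R : PauliString n)
    (d : Trial n) : |trialStat φ i P R d| ≤ 3 ^ (R.weight + 1) := by
  have h1 : |measFactor P (d.2 i)| ≤ 3 := by
    simp only [measFactor, psi]
    split_ifs <;> norm_num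
  have h2 : ∀ l, |prepFactor (φ l) (R l) (d.1 l)| ≤ if R l ≠ 0 then 3 else 1 := by
    intro l
    simp only [prepFactor, chi]
    split_ifs <;> first | contradiction | norm_num
  rw [trialStat, abs_mul, pow_succ, mul_comm, Finset.abs_prod]
  refine mul_le_mul ?_ h1 (abs_nonneg _) (by positivity)
  calc _ ≤ ∏ l, (if R l ≠ 0 then 3 else 1 : ℝ) :=
        Finset.prod_le_prod (fun _ _ => abs_nonneg _) fun l _ => h2 l
    _ = _ := by
        rw [Finset.prod_ite, Finset.prod_const, Finset.prod_const_one, mul_one, PauliString.weight]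

theorem trialWeight_nonneg (Z : Op n) (φ : Pattern n) (d : Trial n) : 0 ≤ trialWeight Z φ d :=
  mul_nonneg (by positivity) (outcomeProb_nonneg _ _ _)

/-! ### The coefficients of the evolved observable -/

theorem coeff_add (A B : Op n) (R : PauliString n) : coeff (A + B) R = coeff A R + coeff B R := by
  rw [coeff, Matrix.mul_add, Matrix.trace_add, Complex.add_re, add_div]
  rfl

theorem weight_single_le (i : Fin n) (P : Fin 4) : (single i P).weight ≤ 1 := by
  rw [PauliString.weight, Finset.card_le_one]
  have h : ∀ a ∈ Finset.univ.filter (fun l => single i P l ≠ 0), a = i := by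
    intro a ha
    by_contra hne
    exact (Finset.mem_filter.mp ha).2 (by rw [single, Function.update_of_ne hne, Pi.zero_apply])
  intro a ha b hb
  rw [h a ha, h b hb]

theorem coeff_op (Q R : PauliString n) : coeff Q.op R = if R = Q then 1 else 0 := by
  rw [coeff, PauliString.op, PauliString.op, tensor_mul, trace_tensor]
  simp only [trace_pauli_mul_pauli, Finset.prod_ite_zero, Finset.mem_univ, true_imp_iff,
    Finset.prod_const, Finset.card_univ, Fintype.card_fin, funext_iff]
  split_ifs
  · have : ((2 : ℂ) ^ n).re = 2 ^ n := by exact_mod_cast Complex.ofReal_re (2 ^ n)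
    rw [this]
    field_simp
  · simp

/-- `R` is the label of the commutator of the Pauli matrices with labels `c` and `P`. -/
def IsCyclic (c P R : Fin 4) : Prop :=
  (c = 1 ∧ P = 2 ∧ R = 3) ∨ (c = 2 ∧ P = 3 ∧ R = 1) ∨ (c = 3 ∧ P = 1 ∧ R = 2)

theorem IsCyclic.ne_zero {c P R : Fin 4} (h : IsCyclic c P R) : c ≠ 0 ∧ P ≠ 0 ∧ R ≠ 0 := by
  rcases h with ⟨rfl, rfl, rfl⟩ | ⟨rfl, rfl, rfl⟩ | ⟨rfl, rfl, rfl⟩ <;> decide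

theorem trace_pauli_commutator {c P R : Fin 4} (h : IsCyclic c P R) (a : Fin 4) :
    Complex.I * ((pauli R * (pauli a * pauli P)).trace - (pauli R * (pauli P * pauli a)).trace) =
      if a = c then -4 else 0 := by
  rcases h with ⟨rfl, rfl, rfl⟩ | ⟨rfl, rfl, rfl⟩ | ⟨rfl, rfl, rfl⟩ <;> fin_cases a <;>
    simp [pauli, Matrix.trace, Fin.sum_univ_two] <;> ring_nf <;> simp

/-- The only term of the Hamiltonian that contributes to the coefficient of `R` in the commutator
with the observable `P` at the qubit `i` is the one that results from `R` by a change of the label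
at `i`. -/
theorem coeff_commutator {c P Rx : Fin 4} (h : IsCyclic c P Rx) (lam : PauliString n → ℝ)
    (i : Fin n) {R : PauliString n} (hR : R i = Rx) :
    coeff ⁅Complex.I • hamiltonian lam, (single i P).op⁆ R = -2 * lam (Function.update R i c) := by
  have htr : ∀ Q : PauliString n, Complex.I * ((R.op * (Q.op * (single i P).op)).trace -
      (R.op * ((single i P).op * Q.op)).trace) =
      if Q = Function.update R i c then -2 * 2 ^ n else 0 := by
    intro Q
    have e1 : ∀ l ∈ Finset.univ.erase i,
        (pauli (R l) * (pauli (Q l) * pauli (single i P l))).trace = if Q l = R l then 2 else 0 := by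
      intro l hl
      rw [single, Function.update_of_ne (Finset.ne_of_mem_erase hl), Pi.zero_apply, pauli_zero,
        mul_one, trace_pauli_mul_pauli]
      simp [eq_comm]
    have e2 : ∀ l ∈ Finset.univ.erase i,
        (pauli (R l) * (pauli (single i P l) * pauli (Q l))).trace = if Q l = R l then 2 else 0 := by
      intro l hl
      rw [single, Function.update_of_ne (Finset.ne_of_mem_erase hl), Pi.zero_apply, pauli_zero,
        one_mul, trace_pauli_mul_pauli]
      simp [eq_comm]
    simp only [PauliString.op, tensor_mul, trace_tensor]
    rw [← Finset.mul_prod_erase _ _ (Finset.mem_univ i), ← Finset.mul_prod_erase _ _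
      (Finset.mem_univ i), Finset.prod_congr rfl e1, Finset.prod_congr rfl e2, ← sub_mul,
      ← mul_assoc, hR]
    have : single i P i = P := by simp [single]
    rw [this, trace_pauli_commutator h, Finset.prod_ite_zero, Finset.prod_const,
      Finset.card_erase_of_mem (Finset.mem_univ i), Finset.card_univ, Fintype.card_fin]
    have hn : (2 : ℂ) ^ n = 2 * 2 ^ (n - 1) := by
      rw [← pow_succ', Nat.sub_add_cancel (Fin.pos i)]
    by_cases hQ : Q = Function.update R i c
    · subst hQ
      rw [if_pos (by simp), if_pos, if_pos rfl, hn]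
      · ring
      · intro l hl
        rw [Function.update_of_ne (Finset.ne_of_mem_erase hl)]
    · rw [if_neg hQ]
      by_cases hc : Q i = c
      · rw [if_neg (c := ∀ l ∈ _, _), mul_zero]
        intro hall
        refine hQ (funext fun l => ?_)
        by_cases hl : l = i
        · subst hl
          simp [hc]
        · rw [Function.update_of_ne hl, hall l (by simp [hl])]
      · rw [if_neg hc, zero_mul]
  have hmain : (R.op * ⁅Complex.I • hamiltonian lam, (single i P).op⁆).trace =
      ((-2 * 2 ^ n * lam (Function.update R i c) : ℝ) : ℂ) := by
    calc _ = ∑ Q : PauliString n, (lam Q : ℂ) * (Complex.I *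
          ((R.op * (Q.op * (single i P).op)).trace - (R.op * ((single i P).op * Q.op)).trace)) := by
          rw [Ring.lie_def, hamiltonian, Matrix.smul_mul, Matrix.mul_smul, ← smul_sub,
            Matrix.mul_smul, Matrix.trace_smul, Matrix.mul_sub, Matrix.trace_sub, Finset.sum_mul,
            Finset.mul_sum, Finset.mul_sum, Finset.mul_sum, Matrix.trace_sum, Matrix.trace_sum,
            ← Finset.sum_sub_distrib, smul_eq_mul, Finset.mul_sum]
          refine Finset.sum_congr rfl fun Q _ => ?_
          rw [Matrix.smul_mul, Matrix.mul_smul, Matrix.mul_smul, Matrix.mul_smul, Matrix.trace_smul,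
            Matrix.trace_smul, smul_eq_mul, smul_eq_mul]
          ring
      _ = _ := by
          simp only [htr, mul_ite, mul_zero, Finset.sum_ite_eq', Finset.mem_univ, if_true]
          push_cast
          ring
  rw [coeff, hmain, Complex.ofReal_re]
  field_simp

/-- Up to an error with small square sum, the coefficients of the evolved observable are those of
the Hamiltonian. -/
theorem exists_error {Z : Op n} {lam : PauliString n → ℝ} {η : ℝ}
    (hZ : FirstOrderApprox Z (hamiltonian lam) η) (i : Fin n) {c P Rx : Fin 4}
    (h : IsCyclic c P Rx) :
    ∃ e : PauliString n → ℝ, ∑ R, e R ^ 2 ≤ η ^ 2 ∧ ∀ R : PauliString n, R i = Rx →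
      coeff (evolved Z i P) R = -2 * lam (Function.update R i c) + e R := by
  obtain ⟨E, hE, hη⟩ := hZ (single i P) (weight_single_le i P)
  refine ⟨coeff E, (sum_coeff_sq_le E).trans ?_, fun R hR => ?_⟩
  · have : 0 ≤ normalizedFrobenius E := div_nonneg (Real.sqrt_nonneg _) (Real.sqrt_nonneg _)
    exact pow_le_pow_left₀ this hη.le 2
  · rw [evolved, hE, coeff_add, coeff_add, coeff_commutator h lam i hR, coeff_op, if_neg, zero_add]
    rintro rfl
    rw [single, Function.update_self] at hR
    rcases h with ⟨rfl, rfl, rfl⟩ | ⟨rfl, rfl, rfl⟩ | ⟨rfl, rfl, rfl⟩ <;> simp at hR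

end Trial

end HamLearn

namespace HamLearn

/-! ### Moments of random multilinear forms -/

section Moments

variable {n : ℕ}

theorem sum_weight_mul_sq_le {Ω : Type*} [Fintype Ω] (μ x y : Ω → ℝ) (hμ : ∀ ω, 0 ≤ μ ω) :
    (∑ ω, μ ω * (x ω * y ω)) ^ 2 ≤ (∑ ω, μ ω * x ω ^ 2) * ∑ ω, μ ω * y ω ^ 2 :=
  Finset.sum_sq_le_sum_mul_sum_of_sq_le_mul _ (fun ω _ => mul_nonneg (hμ ω) (sq_nonneg _))
    (fun ω _ => mul_nonneg (hμ ω) (sq_nonneg _)) fun ω _ => le_of_eq (by ring)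

theorem sum_fin_cons {α : Type*} [Fintype α] (F : (Fin (n + 1) → α) → ℝ) :
    ∑ ω, F ω = ∑ a, ∑ ω, F (Fin.cons a ω) := by
  rw [← (Fin.consEquiv fun _ : Fin (n + 1) => α).sum_comp, Fintype.sum_prod_type]
  rfl

/-- The second moment of a random multilinear form whose coordinates are orthogonal. -/
theorem sum_prod_mul_sq {Ω : Type*} [Fintype Ω] (μ : Fin n → Ω → ℝ) (κ : Fin n → Ω → Fin 4 → ℝ)
    (q : Fin n → Fin 4 → ℝ)
    (h : ∀ l a a', ∑ ω, μ l ω * (κ l ω a * κ l ω a') = if a = a' then q l a else 0)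
    (f : PauliString n → ℝ) :
    ∑ ω : Fin n → Ω, (∏ l, μ l (ω l)) * (∑ R, f R * ∏ l, κ l (ω l) (R l)) ^ 2 =
      ∑ R, f R ^ 2 * ∏ l, q l (R l) := by
  classical
  calc _ = ∑ ω : Fin n → Ω, ∑ R : PauliString n, ∑ R' : PauliString n, (f R * f R') *
        ∏ l, μ l (ω l) * (κ l (ω l) (R l) * κ l (ω l) (R' l)) := by
        refine Finset.sum_congr rfl fun ω _ => ?_
        rw [sq, Finset.sum_mul_sum, Finset.mul_sum]
        refine Finset.sum_congr rfl fun R _ => ?_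
        rw [Finset.mul_sum]
        refine Finset.sum_congr rfl fun R' _ => ?_
        rw [Finset.prod_mul_distrib, Finset.prod_mul_distrib]
        ring
    _ = ∑ R : PauliString n, ∑ R' : PauliString n, (f R * f R') *
        ∏ l, ∑ w, μ l w * (κ l w (R l) * κ l w (R' l)) := by
        rw [Finset.sum_comm]
        refine Finset.sum_congr rfl fun R _ => ?_
        rw [Finset.sum_comm]
        refine Finset.sum_congr rfl fun R' _ => ?_
        rw [← Finset.mul_sum, Finset.prod_univ_sum, Fintype.piFinset_univ]
    _ = _ := by
        refine Finset.sum_congr rfl fun R _ => ?_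
        have hR : ∀ R' : PauliString n, (∀ l, R l = R' l) ↔ R = R' := fun R' => funext_iff.symm
        simp only [h, Finset.prod_ite_zero, Finset.mem_univ, true_imp_iff, hR]
        simp [sq]

/-- A hypercontractive inequality: if every coordinate satisfies a bound for the fourth moment in
terms of a weighted square sum, then so does the whole form. -/
theorem sum_prod_mul_pow_four_le {Ω : Type*} [Fintype Ω] {n : ℕ} (μ : Fin n → Ω → ℝ)
    (κ : Fin n → Ω → Fin 4 → ℝ) (Q : Fin n → Fin 4 → ℝ) (hμ : ∀ l ω, 0 ≤ μ l ω)
    (hQ : ∀ l a, 0 ≤ Q l a)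
    (h : ∀ l (t : Fin 4 → ℝ), ∑ ω, μ l ω * (∑ a, κ l ω a * t a) ^ 4 ≤ (∑ a, Q l a * t a ^ 2) ^ 2)
    (f : PauliString n → ℝ) :
    ∑ ω : Fin n → Ω, (∏ l, μ l (ω l)) * (∑ R, f R * ∏ l, κ l (ω l) (R l)) ^ 4 ≤
      (∑ R, f R ^ 2 * ∏ l, Q l (R l)) ^ 2 := by
  classical
  induction n with
  | zero => simp [← pow_mul]
  | succ n ih =>
    set μ' := fun l : Fin n => μ l.succ
    set κ' := fun l : Fin n => κ l.succ
    set Q' := fun l : Fin n => Q l.succ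
    set M : (Fin n → Ω) → ℝ := fun ω => ∏ l, μ' l (ω l) with hM
    have hM0 : ∀ ω, 0 ≤ M ω := fun ω => Finset.prod_nonneg fun l _ => hμ _ _
    set G : Fin 4 → (Fin n → Ω) → ℝ := fun a ω =>
      ∑ R : PauliString n, f (Fin.cons a R) * ∏ l, κ' l (ω l) (R l) with hG
    set N : Fin 4 → ℝ := fun a =>
      ∑ R : PauliString n, f (Fin.cons a R) ^ 2 * ∏ l, Q' l (R l) with hN
    have hN0 : ∀ a, 0 ≤ N a := fun a => Finset.sum_nonneg fun R _ =>
      mul_nonneg (sq_nonneg _) (Finset.prod_nonneg fun l _ => hQ _ _)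
    have hIH : ∀ a, ∑ ω, M ω * G a ω ^ 4 ≤ N a ^ 2 := fun a =>
      ih μ' κ' Q' (fun l => hμ _) (fun l => hQ _) (fun l => h _) fun R => f (Fin.cons a R)
    -- The mixed moments of the partial forms are controlled by the Cauchy–Schwarz inequality.
    have hcross : ∀ a b, ∑ ω, M ω * (G a ω ^ 2 * G b ω ^ 2) ≤ N a * N b := by
      intro a b
      refine le_of_sq_le_sq ?_ (mul_nonneg (hN0 a) (hN0 b))
      calc _ ≤ (∑ ω, M ω * (G a ω ^ 2) ^ 2) * ∑ ω, M ω * (G b ω ^ 2) ^ 2 :=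
            sum_weight_mul_sq_le M _ _ hM0
        _ = (∑ ω, M ω * G a ω ^ 4) * ∑ ω, M ω * G b ω ^ 4 := by simp only [← pow_mul]
        _ ≤ N a ^ 2 * N b ^ 2 := mul_le_mul (hIH a) (hIH b)
            (Finset.sum_nonneg fun ω _ => mul_nonneg (hM0 ω) (by positivity)) (sq_nonneg _)
        _ = _ := by ring
    have hsplit : ∀ (w : Ω) (ω : Fin n → Ω),
        ∑ R, f R * ∏ l, κ l (Fin.cons (α := fun _ => Ω) w ω l) (R l) = ∑ a, κ 0 w a * G a ω := by
      intro w ω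
      rw [sum_fin_cons]
      refine Finset.sum_congr rfl fun a _ => ?_
      rw [hG, Finset.mul_sum]
      refine Finset.sum_congr rfl fun R _ => ?_
      rw [Fin.prod_univ_succ]
      simp only [Fin.cons_zero, Fin.cons_succ, κ']
      ring
    have hright : ∑ R, f R ^ 2 * ∏ l, Q l (R l) = ∑ a, Q 0 a * N a := by
      rw [sum_fin_cons]
      refine Finset.sum_congr rfl fun a _ => ?_
      rw [hN, Finset.mul_sum]
      refine Finset.sum_congr rfl fun R _ => ?_
      rw [Fin.prod_univ_succ]
      simp only [Fin.cons_zero, Fin.cons_succ, Q']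
      ring
    rw [hright, sum_fin_cons, Finset.sum_comm]
    calc _ = ∑ ω : Fin n → Ω, M ω * ∑ w, μ 0 w * (∑ a, κ 0 w a * G a ω) ^ 4 := by
          refine Finset.sum_congr rfl fun ω _ => ?_
          rw [Finset.mul_sum]
          refine Finset.sum_congr rfl fun w _ => ?_
          rw [hsplit, Fin.prod_univ_succ]
          simp only [Fin.cons_zero, Fin.cons_succ, hM, μ']
          ring
      _ ≤ ∑ ω : Fin n → Ω, M ω * (∑ a, Q 0 a * G a ω ^ 2) ^ 2 :=
          Finset.sum_le_sum fun ω _ => mul_le_mul_of_nonneg_left (h 0 fun a => G a ω) (hM0 ω)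
      _ = ∑ a, ∑ b, Q 0 a * Q 0 b * ∑ ω, M ω * (G a ω ^ 2 * G b ω ^ 2) := by
          have hsq : ∀ ω, M ω * (∑ a, Q 0 a * G a ω ^ 2) ^ 2 =
              ∑ a, ∑ b, Q 0 a * Q 0 b * (M ω * (G a ω ^ 2 * G b ω ^ 2)) := by
            intro ω
            rw [sq, Finset.sum_mul_sum, Finset.mul_sum]
            refine Finset.sum_congr rfl fun a _ => ?_
            rw [Finset.mul_sum]
            exact Finset.sum_congr rfl fun b _ => by ring
          simp only [hsq, Finset.mul_sum]
          rw [Finset.sum_comm]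
          exact Finset.sum_congr rfl fun a _ => Finset.sum_comm
      _ ≤ ∑ a, ∑ b, Q 0 a * Q 0 b * (N a * N b) :=
          Finset.sum_le_sum fun a _ => Finset.sum_le_sum fun b _ =>
            mul_le_mul_of_nonneg_left (hcross a b) (mul_nonneg (hQ 0 a) (hQ 0 b))
      _ = _ := by
          rw [sq, Finset.sum_mul_sum]
          refine Finset.sum_congr rfl fun a _ => Finset.sum_congr rfl fun b _ => by ring

/-- The Paley–Zygmund inequality. -/
theorem paley_zygmund {Ω : Type*} [Fintype Ω] (μ G : Ω → ℝ) (hμ : ∀ ω, 0 ≤ μ ω)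
    (hμ1 : ∑ ω, μ ω = 1) {A K : ℝ} (hA : 0 < A) (hK : 0 < K) (h2 : ∑ ω, μ ω * G ω ^ 2 = A)
    (h4 : ∑ ω, μ ω * G ω ^ 4 ≤ K * A ^ 2) :
    1 / (4 * K) ≤ ∑ ω, μ ω * if A / 2 ≤ G ω ^ 2 then 1 else 0 := by
  set p := ∑ ω, μ ω * if A / 2 ≤ G ω ^ 2 then (1 : ℝ) else 0 with hp
  set B := ∑ ω, μ ω * (G ω ^ 2 * if A / 2 ≤ G ω ^ 2 then (1 : ℝ) else 0) with hB
  have h1 : A ≤ A / 2 + B := by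
    calc A = ∑ ω, μ ω * G ω ^ 2 := h2.symm
      _ ≤ ∑ ω, (μ ω * (A / 2) + μ ω * (G ω ^ 2 * if A / 2 ≤ G ω ^ 2 then (1 : ℝ) else 0)) := by
          refine Finset.sum_le_sum fun ω _ => ?_
          rw [← mul_add]
          refine mul_le_mul_of_nonneg_left ?_ (hμ ω)
          split_ifs with h
          · linarith
          · linarith
      _ = _ := by rw [Finset.sum_add_distrib, ← Finset.sum_mul, hμ1, one_mul]
  have hB2 : B ^ 2 ≤ K * A ^ 2 * p := by
    calc B ^ 2 ≤ (∑ ω, μ ω * (G ω ^ 2) ^ 2) *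
          ∑ ω, μ ω * (if A / 2 ≤ G ω ^ 2 then (1 : ℝ) else 0) ^ 2 := sum_weight_mul_sq_le μ _ _ hμ
      _ = (∑ ω, μ ω * G ω ^ 4) * p := by
          simp only [← pow_mul, ite_pow, one_pow, ne_eq, OfNat.ofNat_ne_zero, not_false_eq_true,
            zero_pow, hp]
      _ ≤ _ := mul_le_mul_of_nonneg_right h4
          (Finset.sum_nonneg fun ω _ => mul_nonneg (hμ ω) (by split_ifs <;> norm_num))
  have hA2 : (A / 2) ^ 2 ≤ B ^ 2 := pow_le_pow_left₀ (by linarith) (by linarith) 2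
  have h3 : A ^ 2 * (1 / 4) ≤ A ^ 2 * (K * p) := by nlinarith
  have h5 := le_of_mul_le_mul_left h3 (by positivity)
  rw [div_le_iff₀ (by positivity)]
  linarith


/-- The second moment of a sum of independent identically distributed random variables. -/
theorem sum_prod_mul_sum_sq {Ω : Type*} [Fintype Ω] (p X : Ω → ℝ) (hp : ∑ ω, p ω = 1) (T : ℕ) :
    ∑ d : Fin T → Ω, (∏ t, p (d t)) * (∑ t, X (d t)) ^ 2 =
      T * ∑ ω, p ω * X ω ^ 2 + T * (T - 1) * (∑ ω, p ω * X ω) ^ 2 := by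
  have h0 : ∀ T : ℕ, ∑ d : Fin T → Ω, ∏ t, p (d t) = 1 := fun T => by
    rw [← Fintype.piFinset_univ, ← Finset.prod_univ_sum]
    simp [hp]
  have h1 : ∀ T : ℕ, ∑ d : Fin T → Ω, (∏ t, p (d t)) * ∑ t, X (d t) = T * ∑ ω, p ω * X ω := by
    intro T
    induction T with
    | zero => simp
    | succ T ih =>
      calc _ = ∑ a, ∑ d : Fin T → Ω, (p a * X a * (∏ t, p (d t)) +
              p a * ((∏ t, p (d t)) * ∑ t, X (d t))) := by
            rw [sum_fin_cons]
            refine Finset.sum_congr rfl fun a _ => Finset.sum_congr rfl fun d _ => ?_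
            simp only [Fin.prod_univ_succ, Fin.sum_univ_succ, Fin.cons_zero, Fin.cons_succ]
            ring
        _ = _ := by
            simp only [Finset.sum_add_distrib, ← Finset.mul_sum, h0, ih, ← Finset.sum_mul, hp]
            push_cast
            ring
  induction T with
  | zero => simp
  | succ T ih =>
    calc _ = ∑ a, ∑ d : Fin T → Ω, (p a * X a ^ 2 * (∏ t, p (d t)) +
              2 * (p a * X a) * ((∏ t, p (d t)) * ∑ t, X (d t)) +
              p a * ((∏ t, p (d t)) * (∑ t, X (d t)) ^ 2)) := by
          rw [sum_fin_cons]
          refine Finset.sum_congr rfl fun a _ => Finset.sum_congr rfl fun d _ => ?_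
          simp only [Fin.prod_univ_succ, Fin.sum_univ_succ, Fin.cons_zero, Fin.cons_succ]
          ring
      _ = _ := by
          simp only [Finset.sum_add_distrib, ← Finset.mul_sum, h0, h1, ih, ← Finset.sum_mul, hp]
          push_cast
          ring

end Moments

/-! ### Random preparation patterns -/

section Pattern

variable {n : ℕ}

/-- The law of the preparation of a qubit. -/
noncomputable def patternLaw (φ : Option (Fin 6)) : ℝ := φ.elim (1 / 3) fun _ => 1 / 9

/-- The law of the preparation of a qubit under the condition that a term with label `r` contributes
with absolute value one to the mean of the statistic of a substring with label `v`. -/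
noncomputable def condLaw (v r : Fin 4) (φ : Option (Fin 6)) : ℝ :=
  φ.elim (if v ≠ 0 then 1 else if r ≠ 0 then 0 else 1 / 3) fun b =>
    if v ≠ 0 then 0 else if r ≠ 0 then (if (codeAxis b).succ = r then 1 / 2 else 0) else 1 / 9

/-- The probability of the condition in `condLaw`. -/
noncomputable def condMass (v r : Fin 4) : ℝ := if v ≠ 0 then 1 / 3 else if r ≠ 0 then 2 / 9 else 1

/-- The squares of the contributions of a label `a` in the mean, averaged over `condLaw`. -/
noncomputable def condMoment (v r a : Fin 4) : ℝ :=
  if v ≠ 0 then (if a = v then 1 else 0)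
  else if r ≠ 0 then (if a = 0 ∨ a = r then 1 else 0)
  else if a = 0 then 1 else 2 / 9

theorem codeAxis_values : codeAxis 0 = 0 ∧ codeAxis 1 = 1 ∧ codeAxis 2 = 2 ∧ codeAxis 3 = 0 ∧
    codeAxis 4 = 1 ∧ codeAxis 5 = 2 := by decide

theorem codeSign_values : codeSign 0 = false ∧ codeSign 1 = false ∧ codeSign 2 = false ∧
    codeSign 3 = true ∧ codeSign 4 = true ∧ codeSign 5 = true := by decide

theorem patternLaw_nonneg (φ : Option (Fin 6)) : 0 ≤ patternLaw φ := by
  cases φ <;> norm_num [patternLaw]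

theorem sum_patternLaw : ∑ φ, patternLaw φ = 1 := by
  norm_num [Fintype.sum_option, patternLaw]

theorem condLaw_nonneg (v r : Fin 4) (φ : Option (Fin 6)) : 0 ≤ condLaw v r φ := by
  cases φ <;> simp only [condLaw, Option.elim] <;> split_ifs <;> norm_num

theorem condMass_nonneg (v r : Fin 4) : 0 ≤ condMass v r := by
  unfold condMass; split_ifs <;> norm_num

theorem condMass_mul_condLaw_le (v r : Fin 4) (φ : Option (Fin 6)) :
    condMass v r * condLaw v r φ ≤ patternLaw φ := by
  cases φ <;> simp only [condMass, condLaw, patternLaw, Option.elim] <;> split_ifs <;> norm_num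

theorem sum_condLaw (v r : Fin 4) : ∑ φ, condLaw v r φ = 1 := by
  obtain ⟨h0, h1, h2, h3, h4, h5⟩ := codeAxis_values
  simp only [Fintype.sum_option, Fin.sum_univ_six, condLaw, Option.elim, h0, h1, h2, h3, h4, h5]
  fin_cases v <;> fin_cases r <;> simp <;> norm_num

theorem condMoment_nonneg (v r a : Fin 4) : 0 ≤ condMoment v r a := by
  unfold condMoment; split_ifs <;> norm_num

theorem condMoment_le_one (v r a : Fin 4) : condMoment v r a ≤ 1 := by
  unfold condMoment; split_ifs <;> norm_num

theorem condMoment_self {v r : Fin 4} (h : v = 0 ∨ v = r) : condMoment v r r = 1 := by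
  unfold condMoment
  split_ifs <;> simp_all

theorem sum_condLaw_mul_kernel (v r a a' : Fin 4) :
    ∑ φ, condLaw v r φ * (kernel φ v a * kernel φ v a') =
      if a = a' then condMoment v r a else 0 := by
  obtain ⟨h0, h1, h2, h3, h4, h5⟩ := codeAxis_values
  obtain ⟨s0, s1, s2, s3, s4, s5⟩ := codeSign_values
  simp only [Fintype.sum_option, Fin.sum_univ_six, condLaw, kernel, condMoment, Option.elim, h0, h1,
    h2, h3, h4, h5, s0, s1, s2, s3, s4, s5]
  by_cases hv : v = 0
  · subst hv
    fin_cases r <;> fin_cases a <;> fin_cases a' <;> simp <;> norm_num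
  · simp [hv]
    split_ifs <;> simp_all

/-- The hypothesis of the hypercontractive inequality: the factor `3` is the fourth moment constant
of a random sign. -/
theorem sum_condLaw_mul_kernel_pow_four_le (v r : Fin 4) (t : Fin 4 → ℝ) :
    ∑ φ, condLaw v r φ * (∑ a, kernel φ v a * t a) ^ 4 ≤
      (∑ a, (if a ≠ 0 then 3 else 1) * condMoment v r a * t a ^ 2) ^ 2 := by
  obtain ⟨h0, h1, h2, h3, h4, h5⟩ := codeAxis_values
  obtain ⟨s0, s1, s2, s3, s4, s5⟩ := codeSign_values
  have p01 := mul_nonneg (sq_nonneg (t 0)) (sq_nonneg (t 1))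
  have p02 := mul_nonneg (sq_nonneg (t 0)) (sq_nonneg (t 2))
  have p03 := mul_nonneg (sq_nonneg (t 0)) (sq_nonneg (t 3))
  have p12 := mul_nonneg (sq_nonneg (t 1)) (sq_nonneg (t 2))
  have p13 := mul_nonneg (sq_nonneg (t 1)) (sq_nonneg (t 3))
  have p23 := mul_nonneg (sq_nonneg (t 2)) (sq_nonneg (t 3))
  have p0 := sq_nonneg (t 0 ^ 2)
  have p1 := sq_nonneg (t 1 ^ 2)
  have p2 := sq_nonneg (t 2 ^ 2)
  have p3 := sq_nonneg (t 3 ^ 2)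
  by_cases hv : v = 0
  · subst hv
    by_cases hr : r = 0
    · subst hr
      simp only [Fintype.sum_option, Fin.sum_univ_six, Fin.sum_univ_four, condLaw, kernel,
        condMoment, Option.elim, h0, h1, h2, h3, h4, h5, s0, s1, s2, s3, s4, s5, ne_eq,
        not_true_eq_false, if_false, if_true]
      simp
      nlinarith only [p01, p02, p03, p12, p13, p23, p0, p1, p2, p3]
    · simp only [Fintype.sum_option, Fin.sum_univ_six, Fin.sum_univ_four, condLaw, kernel,
        condMoment, Option.elim, h0, h1, h2, h3, h4, h5, s0, s1, s2, s3, s4, s5, ne_eq,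
        not_true_eq_false, if_false, if_true, hr, not_false_eq_true]
      fin_cases r
      · exact absurd rfl hr
      · simp
        nlinarith only [p01, p1, p0]
      · simp
        nlinarith only [p02, p2, p0]
      · simp
        nlinarith only [p03, p3, p0]
  · simp only [Fintype.sum_option, condLaw, kernel, condMoment, Option.elim, ne_eq, hv,
      not_false_eq_true, if_true, if_false]
    have := sq_nonneg (t v ^ 2)
    simp [hv]
    nlinarith only [this]

end Pattern

end HamLearn

namespace HamLearn

/-! ### The probability that a group of experiments votes for a string -/

section Vote

variable {n : ℕ}

/-- The probability that the sum of `T` independent copies of `X` has absolute value at least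
`ε * T`. -/
noncomputable def largeProb {Ω : Type*} [Fintype Ω] (p X : Ω → ℝ) (T : ℕ) (ε : ℝ) : ℝ :=
  ∑ d : Fin T → Ω, (∏ t, p (d t)) * if (ε * T) ^ 2 ≤ (∑ t, X (d t)) ^ 2 then 1 else 0

theorem largeProb_nonneg {Ω : Type*} [Fintype Ω] {p : Ω → ℝ} (X : Ω → ℝ) (hp0 : ∀ ω, 0 ≤ p ω)
    (T : ℕ) (ε : ℝ) : 0 ≤ largeProb p X T ε :=
  Finset.sum_nonneg fun d _ => mul_nonneg (Finset.prod_nonneg fun t _ => hp0 _)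
    (by split_ifs <;> norm_num)

theorem sum_pi_prod {ι Ω : Type*} [Fintype ι] [DecidableEq ι] [Fintype Ω] (f : ι → Ω → ℝ) :
    ∑ d : ι → Ω, ∏ l, f l (d l) = ∏ l, ∑ ω, f l ω := by
  rw [Finset.prod_univ_sum, Fintype.piFinset_univ]

theorem sum_prod_eq_one {Ω : Type*} [Fintype Ω] {p : Ω → ℝ} (hp : ∑ ω, p ω = 1) (T : ℕ) :
    ∑ d : Fin T → Ω, ∏ t, p (d t) = 1 := by
  rw [sum_pi_prod fun _ => p]
  simp [hp]

/-- Chebyshev's inequality, in the form that bounds the probability of a large sum. -/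
theorem largeProb_le {Ω : Type*} [Fintype Ω] {p X : Ω → ℝ} (hp0 : ∀ ω, 0 ≤ p ω)
    (hp : ∑ ω, p ω = 1) {T : ℕ} (hT : 0 < T) {ε : ℝ} (hε : 0 < ε) :
    largeProb p X T ε ≤
      ((∑ ω, p ω * X ω ^ 2) / T + (∑ ω, p ω * X ω) ^ 2) / ε ^ 2 := by
  have hT' : (0 : ℝ) < T := by exact_mod_cast hT
  have hc : 0 < (ε * T) ^ 2 := by positivity
  have h1 : largeProb p X T ε * (ε * T) ^ 2 ≤
      ∑ d : Fin T → Ω, (∏ t, p (d t)) * (∑ t, X (d t)) ^ 2 := by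
    rw [largeProb, Finset.sum_mul]
    refine Finset.sum_le_sum fun d _ => ?_
    rw [mul_assoc]
    refine mul_le_mul_of_nonneg_left ?_ (Finset.prod_nonneg fun t _ => hp0 _)
    split_ifs with h
    · rwa [one_mul]
    · rw [zero_mul]; exact sq_nonneg _
  rw [sum_prod_mul_sum_sq p X hp] at h1
  rw [le_div_iff₀ (by positivity), ← mul_le_mul_iff_left₀ (show (0 : ℝ) < T ^ 2 by positivity)]
  have h2 : ((∑ ω, p ω * X ω ^ 2) / T + (∑ ω, p ω * X ω) ^ 2) * (T : ℝ) ^ 2 =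
      T * (∑ ω, p ω * X ω ^ 2) + T ^ 2 * (∑ ω, p ω * X ω) ^ 2 := by field_simp
  rw [h2]
  nlinarith [mul_nonneg hT'.le (sq_nonneg (∑ ω, p ω * X ω))]

/-- Chebyshev's inequality, in the form that bounds the probability of a small sum. -/
theorem le_largeProb {Ω : Type*} [Fintype Ω] {p X : Ω → ℝ} (hp0 : ∀ ω, 0 ≤ p ω)
    (hp : ∑ ω, p ω = 1) {T : ℕ} (hT : 0 < T) {ε : ℝ} (hε : 0 < ε)
    (hg : (6 / 5 * ε) ^ 2 ≤ (∑ ω, p ω * X ω) ^ 2) :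
    1 - 25 * (∑ ω, p ω * X ω ^ 2) / (ε ^ 2 * T) ≤ largeProb p X T ε := by
  have hT' : (0 : ℝ) < T := by exact_mod_cast hT
  set g := ∑ ω, p ω * X ω with hgdef
  have hc : 0 < (ε * T / 5) ^ 2 := by positivity
  have hmean : ∑ ω, p ω * (X ω - g) = 0 := by
    simp only [mul_sub, Finset.sum_sub_distrib, ← Finset.sum_mul, hp, ← hgdef]
    ring
  have hvar : ∑ ω, p ω * (X ω - g) ^ 2 ≤ ∑ ω, p ω * X ω ^ 2 := by
    have : ∑ ω, p ω * (X ω - g) ^ 2 = ∑ ω, p ω * X ω ^ 2 - g ^ 2 := by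
      have : ∀ ω, p ω * (X ω - g) ^ 2 = p ω * X ω ^ 2 - 2 * g * (p ω * X ω) + g ^ 2 * p ω :=
        fun ω => by ring
      simp only [this, Finset.sum_add_distrib, Finset.sum_sub_distrib, ← Finset.mul_sum, hp,
        ← hgdef]
      ring
    linarith [sq_nonneg g]
  have h1 : (1 - largeProb p X T ε) * (ε * T / 5) ^ 2 ≤
      ∑ d : Fin T → Ω, (∏ t, p (d t)) * (∑ t, (X (d t) - g)) ^ 2 := by
    have h0 : (1 : ℝ) - largeProb p X T ε = ∑ d : Fin T → Ω, ((∏ t, p (d t)) -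
        (∏ t, p (d t)) * if (ε * T) ^ 2 ≤ (∑ t, X (d t)) ^ 2 then 1 else 0) := by
      rw [Finset.sum_sub_distrib, sum_prod_eq_one hp T, largeProb]
    rw [h0, Finset.sum_mul]
    refine Finset.sum_le_sum fun d _ => ?_
    have hd : 0 ≤ ∏ t, p (d t) := Finset.prod_nonneg fun t _ => hp0 _
    split_ifs with h
    · simp only [mul_one, sub_self, zero_mul]
      exact mul_nonneg hd (sq_nonneg _)
    · rw [mul_zero, sub_zero]
      refine mul_le_mul_of_nonneg_left ?_ hd
      rw [Finset.sum_sub_distrib, Finset.sum_const, Finset.card_univ, Fintype.card_fin,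
        nsmul_eq_mul]
      have ha := abs_lt_of_sq_lt_sq (not_le.1 h) (by positivity)
      have hb : 6 / 5 * ε ≤ |g| := by
        rw [← abs_of_pos (show 0 < 6 / 5 * ε by positivity)]
        exact sq_le_sq.1 hg
      rw [← sq_abs (_ - _)]
      refine pow_le_pow_left₀ (by positivity) ?_ 2
      have h3 : |(T : ℝ) * g| = T * |g| := by rw [abs_mul, abs_of_pos hT']
      have h4 := abs_sub_abs_le_abs_sub ((T : ℝ) * g) (∑ t, X (d t))
      rw [abs_sub_comm] at h4
      nlinarith [mul_le_mul_of_nonneg_left hb hT'.le]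
  rw [sum_prod_mul_sum_sq p (fun ω => X ω - g) hp, hmean] at h1
  have h2 : (1 - largeProb p X T ε) * (ε ^ 2 * T) ≤ 25 * ∑ ω, p ω * X ω ^ 2 := by
    have : (1 - largeProb p X T ε) * (ε ^ 2 * T) * T ≤ (25 * ∑ ω, p ω * X ω ^ 2) * T := by
      nlinarith [mul_le_mul_of_nonneg_left hvar hT'.le]
    exact le_of_mul_le_mul_right this hT'
  have h3 := (le_div_iff₀ (show 0 < ε ^ 2 * T by positivity)).2 h2
  linarith

/-- The probability that a group with random preparation pattern votes for the string `R`. -/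
noncomputable def voteProb (Z : Op n) (T : ℕ) (ε : ℝ) (i : Fin n) (P : Fin 4)
    (R : PauliString n) : ℝ :=
  ∑ φ : Pattern n, (∏ l, patternLaw (φ l)) *
    largeProb (trialWeight Z φ) (trialStat φ i P R) T ε

theorem sum_patternLaw_mul_kernel (v a a' : Fin 4) :
    ∑ φ, patternLaw φ * (kernel φ v a * kernel φ v a') =
      if a = a' then (if v ≠ 0 then (if a = v then 1 / 3 else 0) else if a = 0 then 1 else 2 / 9)
        else 0 := by
  by_cases hv : v = 0
  · subst hv
    have h := sum_condLaw_mul_kernel 0 0 a a'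
    simp only [condMoment, ne_eq, not_true_eq_false, if_false] at h ⊢
    rw [← h]
    refine Finset.sum_congr rfl fun φ _ => ?_
    cases φ <;> simp [patternLaw, condLaw]
  · simp [Fintype.sum_option, patternLaw, kernel, hv]
    split_ifs <;> simp_all

/-- `R'` agrees with `R` on the support of `R`. -/
def Extends (R R' : PauliString n) : Prop := ∀ l, R l ≠ 0 → R' l = R l

open Classical in
/-- A string without heavy extensions receives few votes. -/
theorem voteProb_le {Z : Op n} (hZ : Z ∈ Matrix.unitaryGroup (Fin n → Fin 2) ℂ) {T : ℕ}
    (hT : 0 < T) {ε : ℝ} (hε : 0 < ε) (i : Fin n) {P : Fin 4} (hP : P ≠ 0) (R : PauliString n) :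
    voteProb Z T ε i P R ≤
      ((∑ R' with Extends R R', coeff (evolved Z i P) R' ^ 2) + 3 / T) / ε ^ 2 := by
  have hT' : (0 : ℝ) < T := by exact_mod_cast hT
  have hlaw : ∀ φ : Pattern n, 0 ≤ ∏ l, patternLaw (φ l) := fun φ =>
    Finset.prod_nonneg fun l _ => patternLaw_nonneg _
  -- The second moment of the mean: fresh qubits select the extensions of the string, and the random
  -- states of the other qubits make different extensions orthogonal.
  have h1 : ∑ φ : Pattern n, (∏ l, patternLaw (φ l)) * trialMean Z φ i P R ^ 2 ≤
      ∑ R' with Extends R R', coeff (evolved Z i P) R' ^ 2 := by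
    simp only [trialMean]
    rw [sum_prod_mul_sq (fun _ => patternLaw) (fun l φ a => kernel φ (R l) a) _
      (fun l a a' => sum_patternLaw_mul_kernel (R l) a a'), Finset.sum_filter]
    refine Finset.sum_le_sum fun R' _ => ?_
    split_ifs with h
    · refine mul_le_of_le_one_right (sq_nonneg _) (Finset.prod_le_one ?_ ?_)
      · intro l _; split_ifs <;> norm_num
      · intro l _; split_ifs <;> norm_num
    · obtain ⟨l, hl⟩ := not_forall.1 h
      obtain ⟨h0, h1⟩ := Classical.not_imp.1 hl
      rw [Finset.prod_eq_zero (Finset.mem_univ l) (by rw [if_pos h0, if_neg h1]), mul_zero]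
  have h2 : ∑ φ : Pattern n, (∏ l, patternLaw (φ l)) *
      (3 * ∏ l, if R l = 0 then 1 else if φ l = none then 3 else 0) = 3 := by
    have h3 : ∀ l, ∑ φ : Option (Fin 6), patternLaw φ *
        (if R l = 0 then 1 else if φ = none then 3 else 0) = 1 := by
      intro l
      split_ifs
      · simpa using sum_patternLaw
      · norm_num [Fintype.sum_option, patternLaw]
    calc _ = 3 * ∑ φ : Pattern n, ∏ l, patternLaw (φ l) *
          (if R l = 0 then 1 else if φ l = none then 3 else 0) := by
          rw [Finset.mul_sum]
          refine Finset.sum_congr rfl fun φ _ => ?_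
          rw [Finset.prod_mul_distrib]
          ring
      _ = _ := by
          rw [sum_pi_prod fun l (φ : Option (Fin 6)) => patternLaw φ *
            if R l = 0 then (1 : ℝ) else if φ = none then 3 else 0]
          rw [Finset.prod_congr rfl fun l _ => h3 l, Finset.prod_const_one, mul_one]
  calc voteProb Z T ε i P R ≤ ∑ φ : Pattern n, (∏ l, patternLaw (φ l)) *
        (((3 * ∏ l, if R l = 0 then 1 else if φ l = none then 3 else 0) / T +
          trialMean Z φ i P R ^ 2) / ε ^ 2) := by
        refine Finset.sum_le_sum fun φ _ => mul_le_mul_of_nonneg_left ?_ (hlaw φ)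
        have := largeProb_le (X := trialStat φ i P R) (trialWeight_nonneg Z φ)
          (sum_trialWeight hZ φ) hT hε
        rwa [sum_trialWeight_mul_sq hZ φ i hP, trialMean_eq Z φ i hP] at this
    _ = ((∑ φ : Pattern n, (∏ l, patternLaw (φ l)) * trialMean Z φ i P R ^ 2) +
        (∑ φ : Pattern n, (∏ l, patternLaw (φ l)) *
          (3 * ∏ l, if R l = 0 then 1 else if φ l = none then 3 else 0)) / T) / ε ^ 2 := by
        rw [Finset.sum_div, ← Finset.sum_add_distrib, Finset.sum_div]
        exact Finset.sum_congr rfl fun φ _ => by ring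
    _ ≤ _ := by
        rw [h2]
        gcongr

theorem weight_update {R : PauliString n} {i : Fin n} {c : Fin 4} (hR : R i ≠ 0) (hc : c ≠ 0) :
    PauliString.weight (Function.update R i c) = R.weight := by
  unfold PauliString.weight
  congr 1
  ext l
  by_cases h : l = i
  · subst h; simp [hR, hc]
  · simp [h]

/-- A string that is contained in a heavy term receives many votes. -/
theorem le_voteProb {Z : Op n} (hZ : Z ∈ Matrix.unitaryGroup (Fin n → Fin 2) ℂ) {k T : ℕ} {ε : ℝ}
    (hε : 0 < ε) (hT : 2000 * 41 ^ k / ε ^ 2 ≤ T) {lam : PauliString n → ℝ}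
    (hlam : IsLocalHamiltonian k lam)
    (happrox : FirstOrderApprox Z (hamiltonian lam) (ε / 20 ^ (k + 2))) {i : Fin n}
    {c P Rx : Fin 4} (hcyc : IsCyclic c P Rx) {α R : PauliString n} (hR : R i = Rx) (hα : α i = Rx)
    (hαR : ∀ l, α l = 0 ∨ α l = R l) (hbig : ε ≤ |lam (Function.update R i c)|) :
    1 / (8 * 41 ^ k) ≤ voteProb Z T ε i P α := by
  classical
  obtain ⟨hc, hP, hRx⟩ := hcyc.ne_zero
  have hTpos : (0 : ℝ) < T := lt_of_lt_of_le (by positivity) hT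
  have hT0 : 0 < T := by exact_mod_cast hTpos
  obtain ⟨e, he, hcoeff⟩ := exists_error happrox i hcyc
  have hweight : ∀ R' : PauliString n, R' i = Rx → lam (Function.update R' i c) ≠ 0 →
      R'.weight ≤ k := by
    intro R' hR' h
    by_contra hw
    exact h (hlam.2 _ (by rw [weight_update (by rwa [hR']) hc]; exact not_le.1 hw))
  have hRw : R.weight ≤ k := hweight R hR (by
    intro h
    rw [h, abs_zero] at hbig
    linarith)
  have hαw : α.weight ≤ k := by
    refine le_trans (Finset.card_le_card fun l hl => ?_) hRw
    simp only [Finset.mem_filter, Finset.mem_univ, true_and] at hl ⊢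
    rcases hαR l with h | h
    · exact absurd h hl
    · rwa [← h]
  -- The mean is split into the contribution of the Hamiltonian and that of the error.
  set fl : PauliString n → ℝ := fun R' =>
    if R' i = Rx then -2 * lam (Function.update R' i c) else 0 with hfl
  set fe : PauliString n → ℝ := fun R' => if R' i = Rx then e R' else 0 with hfe
  set form : (PauliString n → ℝ) → Pattern n → ℝ := fun f φ =>
    ∑ R', f R' * ∏ l, kernel (φ l) (α l) (R' l) with hform
  have hmean : ∀ φ, trialMean Z φ i P α = form fl φ + form fe φ := by
    intro φ
    simp only [trialMean, hform, ← Finset.sum_add_distrib]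
    refine Finset.sum_congr rfl fun R' _ => ?_
    by_cases h : R' i = Rx
    · simp only [hfl, hfe, if_pos h, hcoeff R' h]
      ring
    · have : kernel (φ i) (α i) (R' i) = 0 := by
        rw [hα, kernel]
        cases φ i <;> simp [h, hRx]
      rw [Finset.prod_eq_zero (Finset.mem_univ i) this]
      simp
  -- The pattern is conditioned on an event of probability at least `(2 / 9) ^ k` under which the
  -- term `R` contributes fully to the mean.
  set μ : Pattern n → ℝ := fun φ => ∏ l, condLaw (α l) (R l) (φ l) with hμ
  set mass : ℝ := ∏ l, condMass (α l) (R l) with hmass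
  have hμ0 : ∀ φ, 0 ≤ μ φ := fun φ => Finset.prod_nonneg fun l _ => condLaw_nonneg _ _ _
  have hμ1 : ∑ φ, μ φ = 1 := by
    rw [hμ, sum_pi_prod fun l => condLaw (α l) (R l)]
    exact Finset.prod_eq_one fun l _ => sum_condLaw _ _
  have hmass0 : 0 ≤ mass := Finset.prod_nonneg fun l _ => condMass_nonneg _ _
  have hμle : ∀ φ : Pattern n, mass * μ φ ≤ ∏ l, patternLaw (φ l) := by
    intro φ
    rw [hmass, hμ, ← Finset.prod_mul_distrib]
    exact Finset.prod_le_prod (fun l _ => mul_nonneg (condMass_nonneg _ _) (condLaw_nonneg _ _ _))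
      fun l _ => condMass_mul_condLaw_le _ _ _
  have hmass1 : (2 / 9 : ℝ) ^ k ≤ mass := by
    calc (2 / 9 : ℝ) ^ k ≤ (2 / 9) ^ R.weight :=
          pow_le_pow_of_le_one (by norm_num) (by norm_num) hRw
      _ = ∏ l, if R l ≠ 0 then (2 / 9 : ℝ) else 1 := by
          rw [Finset.prod_ite, Finset.prod_const, Finset.prod_const_one, mul_one,
            PauliString.weight]
      _ ≤ mass := by
          refine Finset.prod_le_prod (fun l _ => by split_ifs <;> norm_num) fun l _ => ?_
          rcases hαR l with h | h
          · rw [h, condMass]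
            split_ifs <;> simp_all
          · rw [h, condMass]
            split_ifs <;> simp_all
            norm_num
  have hmoment : ∀ f : PauliString n → ℝ, ∑ φ, μ φ * form f φ ^ 2 =
      ∑ R', f R' ^ 2 * ∏ l, condMoment (α l) (R l) (R' l) := fun f =>
    sum_prod_mul_sq (fun l => condLaw (α l) (R l)) (fun l φ a => kernel φ (α l) a) _
      (fun l a a' => sum_condLaw_mul_kernel _ _ a a') f
  have hprod0 : ∀ R' : PauliString n, 0 ≤ ∏ l, condMoment (α l) (R l) (R' l) := fun R' =>
    Finset.prod_nonneg fun l _ => condMoment_nonneg _ _ _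
  -- The error is small in mean square.
  have hsmall : ∑ φ, μ φ * form fe φ ^ 2 ≤ (ε / 20 ^ (k + 2)) ^ 2 := by
    rw [hmoment]
    refine le_trans (Finset.sum_le_sum fun R' _ => ?_) he
    refine le_trans (mul_le_of_le_one_right (sq_nonneg _) (Finset.prod_le_one
      (fun l _ => condMoment_nonneg _ _ _) fun l _ => condMoment_le_one _ _ _)) ?_
    simp only [hfe]
    split_ifs
    · exact le_rfl
    · simpa using sq_nonneg (e R')
  -- The main part is large with constant probability, by hypercontractivity.
  set A := ∑ φ, μ φ * form fl φ ^ 2 with hA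
  have hA4 : 4 * ε ^ 2 ≤ A := by
    rw [hA, hmoment]
    have h1 : fl R ^ 2 * ∏ l, condMoment (α l) (R l) (R l) =
        4 * |lam (Function.update R i c)| ^ 2 := by
      rw [Finset.prod_congr rfl fun l _ => condMoment_self (hαR l), Finset.prod_const_one, sq_abs]
      simp only [hfl, if_pos hR]
      ring
    have h2 : ε ^ 2 ≤ |lam (Function.update R i c)| ^ 2 := pow_le_pow_left₀ hε.le hbig 2
    refine le_trans ?_ (Finset.single_le_sum (fun R' _ => mul_nonneg (sq_nonneg _) (hprod0 R'))
      (Finset.mem_univ R))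
    rw [h1]
    linarith
  have hfour : ∑ φ, μ φ * form fl φ ^ 4 ≤ 9 ^ k * A ^ 2 := by
    refine (sum_prod_mul_pow_four_le (fun l => condLaw (α l) (R l))
      (fun l φ a => kernel φ (α l) a) (fun l a => (if a ≠ 0 then 3 else 1) *
        condMoment (α l) (R l) a) (fun l φ => condLaw_nonneg _ _ _)
      (fun l a => mul_nonneg (by split_ifs <;> norm_num) (condMoment_nonneg _ _ _))
      (fun l t => sum_condLaw_mul_kernel_pow_four_le _ _ t) fl).trans ?_
    have h9 : (9 : ℝ) ^ k * A ^ 2 = (3 ^ k * A) ^ 2 := by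
      rw [mul_pow, ← pow_mul, mul_comm k 2, pow_mul]; norm_num
    rw [h9]
    refine pow_le_pow_left₀ (Finset.sum_nonneg fun R' _ => mul_nonneg (sq_nonneg _)
      (Finset.prod_nonneg fun l _ => mul_nonneg (by split_ifs <;> norm_num)
        (condMoment_nonneg _ _ _))) ?_ 2
    rw [hA, hmoment, Finset.mul_sum]
    refine Finset.sum_le_sum fun R' _ => ?_
    rw [Finset.prod_mul_distrib, Finset.prod_ite, Finset.prod_const, Finset.prod_const_one, mul_one]
    -- Only strings of weight at most `k` occur in the form.
    by_cases h : R' i = Rx ∧ lam (Function.update R' i c) ≠ 0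
    · have h3 : (3 : ℝ) ^ (Finset.univ.filter fun l => R' l ≠ 0).card ≤ 3 ^ k :=
        pow_le_pow_right₀ (by norm_num) (hweight R' h.1 h.2)
      calc _ = 3 ^ (Finset.univ.filter fun l => R' l ≠ 0).card *
            (fl R' ^ 2 * ∏ l, condMoment (α l) (R l) (R' l)) := by ring
        _ ≤ _ := mul_le_mul_of_nonneg_right h3 (mul_nonneg (sq_nonneg _) (hprod0 R'))
    · have : fl R' = 0 := by
        simp only [hfl]
        split_ifs with h1
        · rw [not_and, not_not] at h
          rw [h h1, mul_zero]
        · rfl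
      simp [this]
  have hpz := paley_zygmund μ (form fl) hμ0 hμ1 (lt_of_lt_of_le (by positivity) hA4)
    (show (0 : ℝ) < 9 ^ k by positivity) rfl hfour
  have hlow : 1 / (4 * 9 ^ k) - 25 * (ε / 20 ^ (k + 2)) ^ 2 / ε ^ 2 ≤
      ∑ φ, μ φ * if (6 / 5 * ε) ^ 2 ≤ trialMean Z φ i P α ^ 2 then (1 : ℝ) else 0 := by
    have h1 : ∑ φ, μ φ * (if A / 2 ≤ form fl φ ^ 2 then (1 : ℝ) else 0) ≤
        ∑ φ, (μ φ * (if (6 / 5 * ε) ^ 2 ≤ trialMean Z φ i P α ^ 2 then (1 : ℝ) else 0) +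
          25 / ε ^ 2 * (μ φ * form fe φ ^ 2)) := by
      refine Finset.sum_le_sum fun φ _ => ?_
      rw [mul_left_comm, ← mul_add]
      refine mul_le_mul_of_nonneg_left ?_ (hμ0 φ)
      have h0 : 0 ≤ 25 / ε ^ 2 * form fe φ ^ 2 := by positivity
      split_ifs with h2 h3 h3
      · linarith
      · rw [zero_add]
        by_contra h4
        rw [not_le, div_mul_eq_mul_div, div_lt_one (by positivity)] at h4
        have h5 : |form fe φ| < ε / 5 := abs_lt_of_sq_lt_sq (by linarith) (by positivity)
        have h6 : |form fl φ + form fe φ| < 6 / 5 * ε := by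
          rw [← hmean]
          exact abs_lt_of_sq_lt_sq (not_le.1 h3) (by positivity)
        have h7 : |form fl φ| < 7 / 5 * ε := by
          have := abs_sub (form fl φ + form fe φ) (form fe φ)
          rw [add_sub_cancel_right] at this
          linarith
        have h8 : |form fl φ| ^ 2 < (7 / 5 * ε) ^ 2 :=
          pow_lt_pow_left₀ h7 (abs_nonneg _) two_ne_zero
        rw [sq_abs] at h8
        nlinarith [sq_pos_of_pos hε]
      · linarith
      · linarith
    rw [Finset.sum_add_distrib, ← Finset.mul_sum] at h1
    have h2 : 25 / ε ^ 2 * ∑ φ, μ φ * form fe φ ^ 2 ≤ 25 / ε ^ 2 * (ε / 20 ^ (k + 2)) ^ 2 :=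
      mul_le_mul_of_nonneg_left hsmall (by positivity)
    have h3 : 25 / ε ^ 2 * (ε / 20 ^ (k + 2)) ^ 2 = 25 * (ε / 20 ^ (k + 2)) ^ 2 / ε ^ 2 := by ring
    linarith
  -- For a pattern with large mean, Chebyshev's inequality shows that the vote is likely.
  set v : ℝ := 25 * 3 ^ (k + 1) / (ε ^ 2 * T) with hv
  have hlarge : ∀ φ : Pattern n, (if (6 / 5 * ε) ^ 2 ≤ trialMean Z φ i P α ^ 2 then (1 : ℝ) else 0)
      - v ≤ largeProb (trialWeight Z φ) (trialStat φ i P α) T ε := by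
    intro φ
    have h0 := largeProb_nonneg (trialStat φ i P α) (trialWeight_nonneg Z φ) T ε
    have hv0 : 0 ≤ v := by positivity
    split_ifs with h
    · rw [← trialMean_eq Z φ i hP] at h
      have h1 := le_largeProb (trialWeight_nonneg Z φ) (sum_trialWeight hZ φ) hT0 hε h
      refine le_trans (sub_le_sub_left ?_ 1) h1
      rw [hv, sum_trialWeight_mul_sq hZ φ i hP]
      refine div_le_div_of_nonneg_right (mul_le_mul_of_nonneg_left ?_ (by norm_num)) (by positivity)
      rw [pow_succ, mul_comm]
      refine mul_le_mul_of_nonneg_right ?_ (by norm_num)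
      calc _ ≤ ∏ l, (if α l ≠ 0 then (3 : ℝ) else 1) := by
            refine Finset.prod_le_prod (fun l _ => by split_ifs <;> norm_num) fun l _ => ?_
            split_ifs <;> first | contradiction | norm_num
        _ = 3 ^ α.weight := by
            rw [Finset.prod_ite, Finset.prod_const, Finset.prod_const_one, mul_one,
              PauliString.weight]
        _ ≤ 3 ^ k := pow_le_pow_right₀ (by norm_num) hαw
    · linarith
  have hmain : mass * (1 / (4 * 9 ^ k) - 25 * (ε / 20 ^ (k + 2)) ^ 2 / ε ^ 2 - v) ≤
      voteProb Z T ε i P α := by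
    calc _ ≤ mass * ∑ φ, μ φ * largeProb (trialWeight Z φ) (trialStat φ i P α) T ε := by
          refine mul_le_mul_of_nonneg_left ?_ hmass0
          calc _ ≤ (∑ φ, μ φ * if (6 / 5 * ε) ^ 2 ≤ trialMean Z φ i P α ^ 2 then (1 : ℝ) else 0)
                - v * ∑ φ, μ φ := by rw [hμ1, mul_one]; linarith
            _ = ∑ φ, μ φ * ((if (6 / 5 * ε) ^ 2 ≤ trialMean Z φ i P α ^ 2 then (1 : ℝ) else 0)
                - v) := by
                rw [Finset.mul_sum, ← Finset.sum_sub_distrib]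
                exact Finset.sum_congr rfl fun φ _ => by ring
            _ ≤ _ := Finset.sum_le_sum fun φ _ => mul_le_mul_of_nonneg_left (hlarge φ) (hμ0 φ)
      _ ≤ _ := by
          rw [Finset.mul_sum, voteProb]
          refine Finset.sum_le_sum fun φ _ => ?_
          rw [← mul_assoc]
          exact mul_le_mul_of_nonneg_right (hμle φ)
            (largeProb_nonneg _ (trialWeight_nonneg Z φ) T ε)
  have h41 : (0 : ℝ) < 41 ^ k := by positivity
  have hv1 : v ≤ 3 / 80 * (3 / 41) ^ k := by
    have h1 : 2000 * 41 ^ k ≤ ε ^ 2 * T := by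
      rw [div_le_iff₀ (by positivity)] at hT
      linarith
    calc v ≤ 25 * 3 ^ (k + 1) / (2000 * 41 ^ k) := div_le_div_of_nonneg_left (by positivity)
          (by positivity) h1
      _ = _ := by rw [div_pow, pow_succ]; field_simp; norm_num
  have he1 : 25 * (ε / 20 ^ (k + 2)) ^ 2 / ε ^ 2 = 1 / 6400 * (1 / 400) ^ k := by
    rw [div_pow, ← pow_mul, mul_comm (k + 2) 2, pow_mul, pow_add, div_pow, one_pow]
    field_simp
    norm_num
  have ha : (1 / 400 : ℝ) ^ k ≤ (1 / 9) ^ k := pow_le_pow_left₀ (by norm_num) (by norm_num) k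
  have hb : (3 / 41 : ℝ) ^ k ≤ (1 / 9) ^ k := pow_le_pow_left₀ (by norm_num) (by norm_num) k
  have h9 : 1 / (4 * (9 : ℝ) ^ k) = 1 / 4 * (1 / 9) ^ k := by rw [div_pow, one_pow]; field_simp
  have hinner : 1 / 8 * (1 / 9) ^ k ≤
      1 / (4 * (9 : ℝ) ^ k) - 25 * (ε / 20 ^ (k + 2)) ^ 2 / ε ^ 2 - v := by
    rw [he1, h9]
    have : (0 : ℝ) < (1 / 9) ^ k := by positivity
    linarith
  refine le_trans ?_ hmain
  calc 1 / (8 * (41 : ℝ) ^ k) = 1 / 8 * (1 / 41) ^ k := by rw [div_pow, one_pow]; field_simp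
    _ ≤ 1 / 8 * (2 / 81) ^ k := mul_le_mul_of_nonneg_left
        (pow_le_pow_left₀ (by norm_num) (by norm_num) k) (by norm_num)
    _ = (2 / 9) ^ k * (1 / 8 * (1 / 9) ^ k) := by
        rw [show (2 / 81 : ℝ) = 2 / 9 * (1 / 9) by norm_num, mul_pow]; ring
    _ ≤ _ := mul_le_mul hmass1 hinner (by positivity) hmass0

end Vote

end HamLearn

namespace HamLearn

/-! ### Concentration over independent groups -/

section Concentration

/-- The probability of the event `E` under `M` independent copies of the law `p`. -/
noncomputable def iidProb {Ω : Type*} [Fintype Ω] (p : Ω → ℝ) (M : ℕ)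
    (E : (Fin M → Ω) → Prop) : ℝ :=
  open Classical in ∑ d : Fin M → Ω, (∏ m, p (d m)) * if E d then 1 else 0

variable {Ω : Type*} [Fintype Ω] {p : Ω → ℝ} {M : ℕ}

theorem iidProb_mono (hp0 : ∀ ω, 0 ≤ p ω) {E F : (Fin M → Ω) → Prop} (h : ∀ d, E d → F d) :
    iidProb p M E ≤ iidProb p M F := by
  refine Finset.sum_le_sum fun d _ => mul_le_mul_of_nonneg_left ?_
    (Finset.prod_nonneg fun m _ => hp0 _)
  split_ifs with h1 h2
  · exact le_rfl
  · exact absurd (h d h1) h2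
  · norm_num
  · exact le_rfl

theorem iidProb_or_le (hp0 : ∀ ω, 0 ≤ p ω) (E F : (Fin M → Ω) → Prop) :
    iidProb p M (fun d => E d ∨ F d) ≤ iidProb p M E + iidProb p M F := by
  rw [iidProb, iidProb, iidProb, ← Finset.sum_add_distrib]
  refine Finset.sum_le_sum fun d _ => ?_
  rw [← mul_add]
  refine mul_le_mul_of_nonneg_left ?_ (Finset.prod_nonneg fun m _ => hp0 _)
  by_cases h1 : E d <;> by_cases h2 : F d <;> simp [h1, h2]

theorem iidProb_exists_le (hp0 : ∀ ω, 0 ≤ p ω) {ι : Type*} (s : Finset ι)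
    (E : ι → (Fin M → Ω) → Prop) :
    iidProb p M (fun d => ∃ a ∈ s, E a d) ≤ ∑ a ∈ s, iidProb p M (E a) := by
  simp only [iidProb]
  rw [Finset.sum_comm]
  refine Finset.sum_le_sum fun d _ => ?_
  rw [← Finset.mul_sum]
  refine mul_le_mul_of_nonneg_left ?_ (Finset.prod_nonneg fun m _ => hp0 _)
  have h0 : ∀ a ∈ s, (0 : ℝ) ≤ open Classical in if E a d then 1 else 0 := fun a _ => by
    split_ifs <;> norm_num
  split_ifs with h
  · obtain ⟨a, ha, hE⟩ := h
    refine le_trans ?_ (Finset.single_le_sum h0 ha)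
    rw [if_pos hE]
  · exact Finset.sum_nonneg h0

theorem iidProb_not (hp : ∑ ω, p ω = 1) (E : (Fin M → Ω) → Prop) :
    iidProb p M (fun d => ¬ E d) = 1 - iidProb p M E := by
  rw [iidProb, iidProb, eq_sub_iff_add_eq, ← Finset.sum_add_distrib]
  refine (Finset.sum_congr rfl fun d _ => ?_).trans (sum_prod_eq_one hp M)
  by_cases h : E d <;> simp [h]

/-- The exponential Markov inequality. -/
theorem iidProb_le_exp (hp0 : ∀ ω, 0 ≤ p ω) (Y : Ω → ℝ) {c b : ℝ}
    (hY : ∑ ω, p ω * Real.exp (Y ω) ≤ Real.exp b) :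
    iidProb p M (fun d => c ≤ ∑ m, Y (d m)) ≤ Real.exp (M * b - c) := by
  calc iidProb p M (fun d => c ≤ ∑ m, Y (d m))
      ≤ ∑ d : Fin M → Ω, Real.exp (-c) * ∏ m, (p (d m) * Real.exp (Y (d m))) := by
        refine Finset.sum_le_sum fun d _ => ?_
        rw [Finset.prod_mul_distrib, ← Real.exp_sum, mul_left_comm, ← Real.exp_add]
        refine mul_le_mul_of_nonneg_left ?_ (Finset.prod_nonneg fun m _ => hp0 _)
        split_ifs with h
        · exact Real.one_le_exp (by linarith)
        · positivity
    _ = Real.exp (-c) * (∑ ω, p ω * Real.exp (Y ω)) ^ M := by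
        rw [← Finset.mul_sum, sum_pi_prod fun _ ω => p ω * Real.exp (Y ω)]
        simp
    _ ≤ Real.exp (-c) * Real.exp b ^ M := by
        refine mul_le_mul_of_nonneg_left (pow_le_pow_left₀ ?_ hY M) (Real.exp_nonneg _)
        exact Finset.sum_nonneg fun ω _ => mul_nonneg (hp0 ω) (Real.exp_nonneg _)
    _ = _ := by rw [← Real.exp_nat_mul, ← Real.exp_add]; ring_nf

open Classical in
/-- An event of probability at most `θ` is unlikely to occur in a fraction `2 * θ` of the copies. -/
theorem iidProb_many_le (hp0 : ∀ ω, 0 ≤ p ω) (hp : ∑ ω, p ω = 1) (E : Ω → Prop) {θ : ℝ}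
    (hθ : ∑ ω, p ω * (if E ω then 1 else 0) ≤ θ) :
    iidProb p M (fun d => 2 * θ * M ≤ (Finset.univ.filter fun m => E (d m)).card) ≤
      Real.exp (-(Real.log 2 / 2 * (θ * M))) := by
  have hθ0 : 0 ≤ θ := le_trans (Finset.sum_nonneg fun ω _ => mul_nonneg (hp0 ω)
    (by split_ifs <;> norm_num)) hθ
  have h2 : 0 < Real.log 2 := Real.log_pos (by norm_num)
  have hY : ∑ ω, p ω * Real.exp (Real.log 2 * if E ω then 1 else 0) ≤ Real.exp θ := by
    calc _ = ∑ ω, (p ω + p ω * if E ω then 1 else 0) := by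
          refine Finset.sum_congr rfl fun ω _ => ?_
          split_ifs
          · rw [mul_one, Real.exp_log (by norm_num)]; ring
          · simp
      _ ≤ 1 + θ := by rw [Finset.sum_add_distrib, hp]; linarith
      _ ≤ _ := by linarith [Real.add_one_le_exp θ]
  refine ((iidProb_mono hp0 fun d hd => ?_).trans
    (iidProb_le_exp hp0 (M := M) (c := Real.log 2 * (2 * θ * M)) _ hY)).trans ?_
  · rw [← Finset.mul_sum, ← Finset.natCast_card_filter]
    exact mul_le_mul_of_nonneg_left hd h2.le
  · rw [Real.exp_le_exp]
    have h3 : 1 ≤ 3 / 2 * Real.log 2 := by linarith [Real.log_two_gt_d9]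
    have h4 : 0 ≤ θ * M := by positivity
    nlinarith

open Classical in
/-- An event of probability at least `4 * θ` is unlikely to occur in less than a fraction `2 * θ` of
the copies. -/
theorem iidProb_few_le (hp0 : ∀ ω, 0 ≤ p ω) (hp : ∑ ω, p ω = 1) (E : Ω → Prop) {θ : ℝ}
    (hθ0 : 0 ≤ θ) (hθ : 4 * θ ≤ ∑ ω, p ω * (if E ω then 1 else 0)) :
    iidProb p M (fun d => ((Finset.univ.filter fun m => E (d m)).card : ℝ) < 2 * θ * M) ≤
      Real.exp (-(Real.log 2 / 2 * (θ * M))) := by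
  have h2 : 0 < Real.log 2 := Real.log_pos (by norm_num)
  have hY : ∑ ω, p ω * Real.exp (-Real.log 2 * if E ω then 1 else 0) ≤ Real.exp (-(2 * θ)) := by
    calc _ = ∑ ω, (p ω - (p ω * if E ω then 1 else 0) / 2) := by
          refine Finset.sum_congr rfl fun ω _ => ?_
          split_ifs
          · rw [mul_one, Real.exp_neg, Real.exp_log (by norm_num)]; ring
          · simp
      _ ≤ 1 - 2 * θ := by rw [Finset.sum_sub_distrib, hp, ← Finset.sum_div]; linarith
      _ ≤ _ := by linarith [Real.add_one_le_exp (-(2 * θ))]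
  refine ((iidProb_mono hp0 fun d hd => ?_).trans
    (iidProb_le_exp hp0 (M := M) (c := -Real.log 2 * (2 * θ * M)) _ hY)).trans ?_
  · rw [← Finset.mul_sum, ← Finset.natCast_card_filter]
    nlinarith
  · rw [Real.exp_le_exp]
    have h3 : 5 / 2 * Real.log 2 ≤ 2 := by linarith [Real.log_two_lt_d9]
    have h4 : 0 ≤ θ * M := by positivity
    nlinarith

theorem exp_le_one_add_add_sq {x : ℝ} (hx : |x| ≤ 1) : Real.exp x ≤ 1 + x + x ^ 2 := by
  have := (abs_le.1 (Real.abs_exp_sub_one_sub_id_le hx)).2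
  linarith

/-- A bound for the moment generating function of a centred bounded random variable. -/
theorem sum_mul_exp_le (hp0 : ∀ ω, 0 ≤ p ω) (hp : ∑ ω, p ω = 1) {X : Ω → ℝ} {b f s : ℝ}
    (hX : ∀ ω, |X ω| ≤ b) (hmean : ∑ ω, p ω * X ω = f) (h2 : ∑ ω, p ω * X ω ^ 2 ≤ b)
    (hs : |s| * (2 * b) ≤ 1) :
    ∑ ω, p ω * Real.exp (s * (X ω - f)) ≤ Real.exp (s ^ 2 * b) := by
  have hf : |f| ≤ b := by
    rw [← hmean]
    refine (Finset.abs_sum_le_sum_abs _ _).trans ?_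
    calc _ ≤ ∑ ω, p ω * b := Finset.sum_le_sum fun ω _ => by
          rw [abs_mul, abs_of_nonneg (hp0 ω)]
          exact mul_le_mul_of_nonneg_left (hX ω) (hp0 ω)
      _ = b := by rw [← Finset.sum_mul, hp, one_mul]
  calc _ ≤ ∑ ω, (p ω + s * (p ω * X ω - p ω * f) +
        s ^ 2 * (p ω * X ω ^ 2 - 2 * f * (p ω * X ω) + f ^ 2 * p ω)) := by
        refine Finset.sum_le_sum fun ω _ => ?_
        have h : |s * (X ω - f)| ≤ 1 := by
          rw [abs_mul]
          refine le_trans (mul_le_mul_of_nonneg_left ?_ (abs_nonneg s)) hs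
          linarith [abs_sub (X ω) f, hX ω]
        have := mul_le_mul_of_nonneg_left (exp_le_one_add_add_sq h) (hp0 ω)
        refine this.trans (le_of_eq (by ring))
    _ = 1 + s ^ 2 * (∑ ω, p ω * X ω ^ 2 - f ^ 2) := by
        simp only [Finset.sum_add_distrib, Finset.sum_sub_distrib, ← Finset.mul_sum, hmean, hp,
          ← Finset.sum_mul]
        ring
    _ ≤ 1 + s ^ 2 * b := by nlinarith [sq_nonneg s, sq_nonneg (s * f)]
    _ ≤ _ := by linarith [Real.add_one_le_exp (s ^ 2 * b)]

end Concentration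

/-! ### The law of a group of experiments -/

section Group

variable {n : ℕ}

/-- The coins that determine the preparation pattern of a group. -/
abbrev Base (n : ℕ) := Fin n → Fin 6 × Fin 6

/-- The preparation pattern that is determined by the coins of a group: the second coin of a qubit
decides whether its state is fixed, and the first coin is the code of the fixed state. -/
def basePattern (β : Base n) : Pattern n := fun l =>
  if ((β l).2 : ℕ) < 2 then none else some (β l).1

/-- The data of a group: the coins for the pattern, `T` experiments with fresh states, and `T`
experiments with the states of the pattern. -/
abbrev Group (n T : ℕ) := Base n × (Fin T → Trial n) × (Fin T → Trial n)

/-- The pattern in which all states are chosen afresh. -/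
def freshPattern : Pattern n := fun _ => none

/-- The probability of the data of a group. -/
noncomputable def groupWeight {T : ℕ} (Z : Op n) (γ : Group n T) : ℝ :=
  (1 / 36) ^ n * ((∏ t, trialWeight Z freshPattern (γ.2.1 t)) *
    ∏ t, trialWeight Z (basePattern γ.1) (γ.2.2 t))

theorem groupWeight_nonneg {T : ℕ} (Z : Op n) (γ : Group n T) : 0 ≤ groupWeight Z γ :=
  mul_nonneg (by positivity) (mul_nonneg
    (Finset.prod_nonneg fun t _ => trialWeight_nonneg _ _ _)
    (Finset.prod_nonneg fun t _ => trialWeight_nonneg _ _ _))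

theorem sum_basePattern (F : Pattern n → ℝ) :
    (1 / 36) ^ n * ∑ β : Base n, F (basePattern β) =
      ∑ φ : Pattern n, (∏ l, patternLaw (φ l)) * F φ := by
  classical
  have h1 : ∀ φ : Option (Fin 6), ∑ b : Fin 6 × Fin 6,
      (if (if (b.2 : ℕ) < 2 then none else some b.1) = φ then (1 : ℝ) else 0) = 36 * patternLaw φ := by
    intro φ
    have h : ∀ φ : Option (Fin 6), (Finset.univ.filter fun b : Fin 6 × Fin 6 =>
        (if (b.2 : ℕ) < 2 then none else some b.1) = φ).card = φ.elim 12 fun _ => 4 := by decide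
    rw [Finset.sum_boole, h]
    cases φ <;> norm_num [patternLaw]
  have h2 : ∀ φ : Pattern n, ∑ β : Base n, (if basePattern β = φ then (1 : ℝ) else 0) =
      36 ^ n * ∏ l, patternLaw (φ l) := by
    intro φ
    have h3 : ∀ β : Base n, (if basePattern β = φ then (1 : ℝ) else 0) =
        ∏ l, if (if ((β l).2 : ℕ) < 2 then none else some (β l).1) = φ l then (1 : ℝ) else 0 := by
      intro β
      rw [Finset.prod_ite_zero]
      simp only [Finset.mem_univ, true_imp_iff, Finset.prod_const_one]
      exact if_congr funext_iff rfl rfl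
    simp only [h3]
    rw [sum_pi_prod fun l (b : Fin 6 × Fin 6) =>
      if (if (b.2 : ℕ) < 2 then none else some b.1) = φ l then (1 : ℝ) else 0]
    simp only [h1]
    rw [Finset.prod_mul_distrib]
    simp
  calc _ = (1 / 36) ^ n * ∑ β : Base n, ∑ φ : Pattern n,
        (if basePattern β = φ then 1 else 0) * F φ := by
        congr 1
        exact Finset.sum_congr rfl fun β _ => by simp
    _ = ∑ φ : Pattern n, ((1 / 36) ^ n * ∑ β : Base n, (if basePattern β = φ then (1 : ℝ) else 0)) *
        F φ := by
        rw [Finset.sum_comm, Finset.mul_sum]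
        refine Finset.sum_congr rfl fun φ _ => ?_
        rw [← Finset.sum_mul, mul_assoc]
    _ = _ := by
        refine Finset.sum_congr rfl fun φ _ => ?_
        rw [h2, ← mul_assoc, ← mul_pow]
        norm_num

/-- The first half of a group consists of experiments with fresh states. -/
theorem sum_groupWeight_mul_fresh {T : ℕ} {Z : Op n}
    (hZ : Z ∈ Matrix.unitaryGroup (Fin n → Fin 2) ℂ) (F : (Fin T → Trial n) → ℝ) :
    ∑ γ : Group n T, groupWeight Z γ * F γ.2.1 =
      ∑ A, (∏ t, trialWeight Z freshPattern (A t)) * F A := by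
  have h1 : ∀ (β : Base n), ∑ x : (Fin T → Trial n) × (Fin T → Trial n),
      groupWeight Z (β, x) * F x.1 =
      (1 / 36) ^ n * ∑ A, (∏ t, trialWeight Z freshPattern (A t)) * F A := by
    intro β
    rw [Fintype.sum_prod_type, Finset.mul_sum]
    refine Finset.sum_congr rfl fun A _ => ?_
    simp only [groupWeight]
    rw [← Finset.sum_mul, ← Finset.mul_sum, ← Finset.mul_sum,
      sum_prod_eq_one (sum_trialWeight hZ (basePattern β)) T]
    ring
  rw [Fintype.sum_prod_type]
  simp only [h1]
  rw [Finset.sum_const, Finset.card_univ, Fintype.card_fun, Fintype.card_prod, Fintype.card_fin,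
    Fintype.card_fin, nsmul_eq_mul, ← mul_assoc]
  push_cast
  rw [← mul_pow]
  norm_num

/-- The second half of a group consists of experiments with a random pattern. -/
theorem sum_groupWeight_mul_restricted {T : ℕ} {Z : Op n}
    (hZ : Z ∈ Matrix.unitaryGroup (Fin n → Fin 2) ℂ) (F : Pattern n → (Fin T → Trial n) → ℝ) :
    ∑ γ : Group n T, groupWeight Z γ * F (basePattern γ.1) γ.2.2 =
      ∑ φ : Pattern n, (∏ l, patternLaw (φ l)) * ∑ B, (∏ t, trialWeight Z φ (B t)) * F φ B := by
  rw [← sum_basePattern fun φ => ∑ B, (∏ t, trialWeight Z φ (B t)) * F φ B, Fintype.sum_prod_type,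
    Finset.mul_sum]
  refine Finset.sum_congr rfl fun β _ => ?_
  rw [Fintype.sum_prod_type, Finset.sum_comm, Finset.mul_sum]
  refine Finset.sum_congr rfl fun B _ => ?_
  simp only [groupWeight]
  rw [← Finset.sum_mul, ← Finset.mul_sum, ← Finset.sum_mul,
      sum_prod_eq_one (sum_trialWeight hZ freshPattern) T]
  ring

theorem sum_groupWeight {T : ℕ} {Z : Op n} (hZ : Z ∈ Matrix.unitaryGroup (Fin n → Fin 2) ℂ) :
    ∑ γ : Group n T, groupWeight Z γ = 1 := by
  have := sum_groupWeight_mul_fresh (T := T) hZ fun _ => 1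
  simpa [sum_prod_eq_one (sum_trialWeight hZ freshPattern) T] using this

/-- The group `γ` votes for the string `R`. -/
def GroupVotes {T : ℕ} (ε : ℝ) (i : Fin n) (P : Fin 4) (R : PauliString n) (γ : Group n T) : Prop :=
  (ε * T) ^ 2 ≤ (∑ t, trialStat (basePattern γ.1) i P R (γ.2.2 t)) ^ 2

open Classical in
theorem sum_groupWeight_mul_votes {T : ℕ} {Z : Op n}
    (hZ : Z ∈ Matrix.unitaryGroup (Fin n → Fin 2) ℂ) (ε : ℝ) (i : Fin n) (P : Fin 4)
    (R : PauliString n) :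
    ∑ γ : Group n T, groupWeight Z γ * (if GroupVotes ε i P R γ then 1 else 0) =
      voteProb Z T ε i P R := by
  rw [voteProb]
  simp only [largeProb]
  rw [← sum_groupWeight_mul_restricted hZ fun φ B =>
    if (ε * T) ^ 2 ≤ (∑ t, trialStat φ i P R (B t)) ^ 2 then 1 else 0]
  exact Finset.sum_congr rfl fun γ _ => congrArg _ (if_congr Iff.rfl rfl rfl)

theorem trialMean_freshPattern (Z : Op n) (i : Fin n) (P : Fin 4) (R : PauliString n) :
    trialMean Z freshPattern i P R = coeff (evolved Z i P) R := by
  classical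
  have h : ∀ R' : PauliString n, (∏ l, kernel (freshPattern l) (R l) (R' l)) =
      if R' = R then 1 else 0 := by
    intro R'
    simp only [kernel, freshPattern, Option.elim]
    rw [Finset.prod_ite_zero]
    simp only [Finset.mem_univ, true_imp_iff, Finset.prod_const_one]
    exact if_congr funext_iff.symm rfl rfl
  rw [trialMean]
  simp [h]

/-- The empirical mean of the statistic over the experiments with fresh states is close to the
coefficient of the evolved observable. -/
theorem iidProb_mean_le {T M k : ℕ} {Z : Op n} (hZ : Z ∈ Matrix.unitaryGroup (Fin n → Fin 2) ℂ)
    {ε : ℝ} (hε : 0 < ε) (hε1 : ε ≤ 1) (i : Fin n) {P : Fin 4} (hP : P ≠ 0) {R : PauliString n}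
    (hR : R.weight ≤ k) :
    iidProb (groupWeight (T := T) Z) M (fun d => ε * (M * T) ≤
        |∑ m, ∑ t, trialStat freshPattern i P R ((d m).2.1 t) - M * T * coeff (evolved Z i P) R|) ≤
      2 * Real.exp (-(ε ^ 2 * (M * T) / (4 * 3 ^ (k + 1)))) := by
  set f := coeff (evolved Z i P) R with hf
  set b : ℝ := 3 ^ (k + 1) with hb
  have hb0 : 0 < b := by positivity
  have hpow : (3 : ℝ) ^ (R.weight + 1) ≤ b := pow_le_pow_right₀ (by norm_num) (by omega)
  have hX : ∀ d, |trialStat freshPattern i P R d| ≤ b := fun d =>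
    (abs_trialStat_le _ i P R d).trans hpow
  have h2 : ∑ d, trialWeight Z freshPattern d * trialStat freshPattern i P R d ^ 2 ≤ b := by
    rw [sum_trialWeight_mul_sq hZ _ i hP]
    refine le_trans (le_of_eq ?_) hpow
    rw [pow_succ, mul_comm]
    congr 1
    simp only [freshPattern, if_true]
    rw [PauliString.weight, Finset.prod_ite]
    simp
  have hmean : ∑ d, trialWeight Z freshPattern d * trialStat freshPattern i P R d = f := by
    rw [trialMean_eq Z _ i hP, trialMean_freshPattern]
  -- Both tails are bounded by a Chernoff estimate with `|s| = ε / (2 * b)`.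
  have hside : ∀ s : ℝ, |s| = ε / (2 * b) → iidProb (groupWeight (T := T) Z) M (fun d =>
      ε / (2 * b) * (ε * (M * T)) ≤ s *
        (∑ m, ∑ t, trialStat freshPattern i P R ((d m).2.1 t) - M * T * f)) ≤
      Real.exp (-(ε ^ 2 * (M * T) / (4 * b))) := by
    intro s hs
    have hgen : ∑ γ : Group n T, groupWeight Z γ *
        Real.exp (∑ t, s * (trialStat freshPattern i P R (γ.2.1 t) - f)) ≤
        Real.exp (T * (s ^ 2 * b)) := by
      rw [sum_groupWeight_mul_fresh hZ fun A =>
        Real.exp (∑ t, s * (trialStat freshPattern i P R (A t) - f))]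
      simp only [Real.exp_sum, ← Finset.prod_mul_distrib]
      rw [sum_pi_prod fun _ d => trialWeight Z freshPattern d *
        Real.exp (s * (trialStat freshPattern i P R d - f)), Finset.prod_const, Finset.card_univ,
        Fintype.card_fin, Real.exp_nat_mul]
      refine pow_le_pow_left₀ (Finset.sum_nonneg fun d _ => mul_nonneg (trialWeight_nonneg _ _ _)
        (Real.exp_nonneg _)) ?_ T
      refine sum_mul_exp_le (trialWeight_nonneg Z _) (sum_trialWeight hZ _) hX hmean h2 ?_
      rw [hs, div_mul_cancel₀ _ (by positivity)]
      exact hε1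
    refine ((iidProb_mono (groupWeight_nonneg Z) fun d hd => ?_).trans
      (iidProb_le_exp (groupWeight_nonneg Z) (M := M) (c := ε / (2 * b) * (ε * (M * T))) _
        hgen)).trans (le_of_eq ?_)
    · refine hd.trans (le_of_eq ?_)
      simp only [← Finset.mul_sum, Finset.sum_sub_distrib, Finset.sum_const, Finset.card_univ,
        Fintype.card_fin, nsmul_eq_mul]
      ring
    · congr 1
      rw [← sq_abs s, hs]
      field_simp
      ring
  have hs0 : 0 < ε / (2 * b) := by positivity
  refine ((iidProb_mono (groupWeight_nonneg Z) fun d hd => ?_).trans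
    (iidProb_or_le (groupWeight_nonneg Z) _ _)).trans ((add_le_add (hside (ε / (2 * b))
      (abs_of_pos hs0)) (hside (-(ε / (2 * b))) (by rw [abs_neg, abs_of_pos hs0]))).trans
      (le_of_eq (by ring)))
  rcases le_abs.1 hd with h | h
  · exact Or.inl (mul_le_mul_of_nonneg_left h hs0.le)
  · right
    rw [neg_mul, ← mul_neg]
    exact mul_le_mul_of_nonneg_left h hs0.le

open Classical in
/-- The number of groups that vote for the string `R`. -/
noncomputable def voteCount {T M : ℕ} (ε : ℝ) (i : Fin n) (P : Fin 4) (R : PauliString n)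
    (d : Fin M → Group n T) : ℕ :=
  (Finset.univ.filter fun m => GroupVotes ε i P R (d m)).card

/-- The votes and the empirical means agree with the corresponding probabilities and expectations
for all strings of weight at most `k`. -/
def Typical {T M : ℕ} (Z : Op n) (k : ℕ) (ε : ℝ) (d : Fin M → Group n T) : Prop :=
  ∀ (i : Fin n) (P : Fin 4) (R : PauliString n), P ≠ 0 → R.weight ≤ k →
    (voteProb Z T ε i P R ≤ 1 / (32 * 41 ^ k) → (voteCount ε i P R d : ℝ) * 16 * 41 ^ k < M) ∧
    (1 / (8 * 41 ^ k) ≤ voteProb Z T ε i P R → ¬ (voteCount ε i P R d : ℝ) * 16 * 41 ^ k < M) ∧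
    |∑ m, ∑ t, trialStat freshPattern i P R ((d m).2.1 t) - M * T * coeff (evolved Z i P) R| <
      ε * (M * T)

theorem card_weight_le (hn : 0 < n) (k : ℕ) :
    (Finset.univ.filter fun R : PauliString n => R.weight ≤ k).card ≤ (4 * n) ^ k := by
  induction k with
  | zero =>
    rw [pow_zero, Finset.card_le_one]
    have : ∀ R : PauliString n, R.weight ≤ 0 → R = 0 := by
      intro R hR
      ext l : 1
      by_contra h
      have := Finset.card_pos.2 (show (Finset.univ.filter fun l => R l ≠ 0).Nonempty from
        ⟨l, by simpa using h⟩)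
      rw [PauliString.weight] at hR
      omega
    simp only [Finset.mem_filter, Finset.mem_univ, true_and]
    intro a ha b hb
    rw [this a ha, this b hb]
  | succ k ih =>
    have hsub : (Finset.univ.filter fun R : PauliString n => R.weight ≤ k + 1) ⊆
        ((Finset.univ.filter fun R : PauliString n => R.weight ≤ k) ×ˢ
          (Finset.univ : Finset (Fin n × Fin 4))).image
            fun x => Function.update x.1 x.2.1 x.2.2 := by
      intro R hR
      simp only [Finset.mem_filter, Finset.mem_univ, true_and] at hR
      rw [Finset.mem_image]
      by_cases h : ∃ l, R l ≠ 0
      · obtain ⟨l, hl⟩ := h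
        refine ⟨(Function.update R l 0, l, R l), ?_, by simp⟩
        simp only [Finset.mem_product, Finset.mem_filter, Finset.mem_univ, true_and, and_true]
        have hlt : PauliString.weight (Function.update R l 0) < R.weight := by
          refine Finset.card_lt_card ⟨fun m hm => ?_, fun hss => ?_⟩
          · simp only [Finset.mem_filter, Finset.mem_univ, true_and] at hm ⊢
            by_cases hml : m = l
            · subst hml; exact hl
            · simpa [hml] using hm
          · have := hss (Finset.mem_filter.2 ⟨Finset.mem_univ l, hl⟩)
            simp at this
        omega
      · push Not at h
        refine ⟨(R, ⟨0, hn⟩, 0), ?_, ?_⟩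
        · simp [PauliString.weight, h]
        · simp only
          rw [← h ⟨0, hn⟩, Function.update_eq_self]
    refine (Finset.card_le_card hsub).trans (Finset.card_image_le.trans ?_)
    rw [Finset.card_product, Finset.card_univ, Fintype.card_prod, Fintype.card_fin,
      Fintype.card_fin,
      pow_succ]
    calc _ ≤ (4 * n) ^ k * (n * 4) := Nat.mul_le_mul_right _ ih
      _ = _ := by ring

theorem iidProb_false {Ω : Type*} [Fintype Ω] (p : Ω → ℝ) (M : ℕ) :
    iidProb p M (fun _ => False) = 0 := by
  simp [iidProb]

/-- The experiments are typical with high probability. -/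
theorem iidProb_not_typical_le {T M k L : ℕ} {Z : Op n}
    (hZ : Z ∈ Matrix.unitaryGroup (Fin n → Fin 2) ℂ) {ε δ : ℝ} (hε : 0 < ε) (hε1 : ε ≤ 1)
    (hδ : 0 < δ) (hδ1 : δ < 1) (hn : 0 < n) (hL : 1 ≤ L) (hLn : (n : ℝ) / δ ≤ 2 ^ L)
    (hT : 2000 * 41 ^ k / ε ^ 2 ≤ T) (hM : 384 * ((k : ℝ) + 1) * L * 41 ^ k ≤ M) :
    iidProb (groupWeight (T := T) Z) M (fun d => ¬ Typical Z k ε d) ≤ δ := by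
  classical
  have hD : (1 : ℝ) ≤ 41 ^ k := one_le_pow₀ (by norm_num)
  have hn' : (0 : ℝ) < n := by exact_mod_cast hn
  have hL' : (1 : ℝ) ≤ L := by exact_mod_cast hL
  have h2 : 0 < Real.log 2 := Real.log_pos (by norm_num)
  set θ : ℝ := 1 / (32 * 41 ^ k) with hθ
  have hθ0 : 0 ≤ θ := by positivity
  set x : ℝ := Real.exp (-(Real.log 2 / 2 * (θ * M))) with hx
  have hx0 : 0 < x := Real.exp_pos _
  have hp0 := groupWeight_nonneg (T := T) Z
  have hp := sum_groupWeight (T := T) hZ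
  -- The exponent of the tail bounds.
  have hθM : 12 * ((k : ℝ) + 1) * L ≤ θ * M := by
    rw [hθ, one_div_mul_eq_div, le_div_iff₀ (by positivity)]
    linarith
  have hxle : x ≤ (δ / (32 * n)) ^ (k + 1) := by
    have h1 : x ≤ Real.exp (((k + 1 : ℕ) : ℝ) * -(Real.log 2 * (6 * L))) := by
      rw [hx, Real.exp_le_exp]
      push_cast
      nlinarith
    refine h1.trans ?_
    rw [Real.exp_nat_mul]
    refine pow_le_pow_left₀ (Real.exp_nonneg _) ?_ _
    have h3 : Real.log 2 * (6 * L) = ((6 * L : ℕ) : ℝ) * Real.log 2 := by push_cast; ring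
    rw [Real.exp_neg, h3, Real.exp_nat_mul, Real.exp_log (by norm_num), ← one_div,
      div_le_div_iff₀ (by positivity) (by positivity), one_mul]
    have h4 : (32 : ℝ) ≤ 2 ^ (5 * L) := by
      calc (32 : ℝ) = 2 ^ 5 := by norm_num
        _ ≤ _ := pow_le_pow_right₀ (by norm_num) (by omega)
    have h5 : (n : ℝ) ≤ δ * 2 ^ L := by rwa [div_le_iff₀ hδ, mul_comm] at hLn
    calc 32 * (n : ℝ) ≤ 2 ^ (5 * L) * (δ * 2 ^ L) := mul_le_mul h4 h5 hn'.le (by positivity)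
      _ = δ * 2 ^ (6 * L) := by rw [show 6 * L = 5 * L + L by ring, pow_add]; ring
  have hone : ∀ a : Fin n × Fin 4 × PauliString n, a.2.1 ≠ 0 → a.2.2.weight ≤ k →
      iidProb (groupWeight (T := T) Z) M (fun d =>
        (voteProb Z T ε a.1 a.2.1 a.2.2 ≤ θ ∧
          ¬ (voteCount ε a.1 a.2.1 a.2.2 d : ℝ) * 16 * 41 ^ k < M) ∨
        (1 / (8 * 41 ^ k) ≤ voteProb Z T ε a.1 a.2.1 a.2.2 ∧
          (voteCount ε a.1 a.2.1 a.2.2 d : ℝ) * 16 * 41 ^ k < M) ∨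
        ε * (M * T) ≤ |∑ m, ∑ t, trialStat freshPattern a.1 a.2.1 a.2.2 ((d m).2.1 t) -
          M * T * coeff (evolved Z a.1 a.2.1) a.2.2|) ≤ 4 * x := by
    rintro ⟨i, P, R⟩ hP hR
    simp only at hP hR ⊢
    have hvote := sum_groupWeight_mul_votes (T := T) hZ ε i P R
    have hthresh : ∀ v : ℝ, v * 16 * 41 ^ k < M ↔ v < 2 * θ * M := by
      intro v
      have : 2 * θ * M = M / (16 * 41 ^ k) := by rw [hθ]; field_simp; ring
      rw [this, lt_div_iff₀ (by positivity), mul_assoc]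
    have hB1 : iidProb (groupWeight (T := T) Z) M (fun d => voteProb Z T ε i P R ≤ θ ∧
        ¬ (voteCount ε i P R d : ℝ) * 16 * 41 ^ k < M) ≤ x := by
      by_cases h : voteProb Z T ε i P R ≤ θ
      · refine (iidProb_mono hp0 fun d hd => ?_).trans
          (iidProb_many_le hp0 hp (GroupVotes ε i P R) (hvote.trans_le h))
        have := hd.2
        rw [hthresh, not_lt] at this
        exact this
      · refine (iidProb_mono hp0 (F := fun _ => False) fun d hd => h hd.1).trans ?_
        rw [iidProb_false]
        exact hx0.le
    have hB2 : iidProb (groupWeight (T := T) Z) M (fun d =>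
        1 / (8 * 41 ^ k) ≤ voteProb Z T ε i P R ∧ (voteCount ε i P R d : ℝ) * 16 * 41 ^ k < M) ≤ x := by
      by_cases h : 1 / (8 * 41 ^ k) ≤ voteProb Z T ε i P R
      · have h4 : 4 * θ = 1 / (8 * 41 ^ k) := by rw [hθ]; field_simp; norm_num
        refine (iidProb_mono hp0 fun d hd => ?_).trans
          (iidProb_few_le hp0 hp (GroupVotes ε i P R) hθ0 (by rw [hvote, h4]; exact h))
        have := hd.2
        rw [hthresh] at this
        exact this
      · refine (iidProb_mono hp0 (F := fun _ => False) fun d hd => h hd.1).trans ?_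
        rw [iidProb_false]
        exact hx0.le
    have hB3 := iidProb_mean_le (T := T) (M := M) hZ hε hε1 i hP hR
    have hexp : Real.exp (-(ε ^ 2 * (M * T) / (4 * 3 ^ (k + 1)))) ≤ x := by
      rw [hx, Real.exp_le_exp, neg_le_neg_iff]
      have h3 : (3 : ℝ) ^ k ≤ 41 ^ k := pow_le_pow_left₀ (by norm_num) (by norm_num) k
      have hT2 : 2000 * 3 ^ k ≤ ε ^ 2 * T := by
        rw [div_le_iff₀ (by positivity)] at hT
        linarith
      have hM0 : (0 : ℝ) ≤ M := Nat.cast_nonneg M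
      calc Real.log 2 / 2 * (θ * M) ≤ 1 / 2 * (1 / 32 * M) := by
            have hθ1 : θ ≤ 1 / 32 := by
              rw [hθ]
              exact one_div_le_one_div_of_le (by norm_num) (by linarith)
            have hl : Real.log 2 ≤ 1 := by linarith [Real.log_two_lt_d9]
            exact mul_le_mul (by linarith) (mul_le_mul_of_nonneg_right hθ1 hM0)
              (by positivity) (by norm_num)
        _ ≤ 2000 * 3 ^ k * M / (4 * 3 ^ (k + 1)) := by
            rw [pow_succ, le_div_iff₀ (by positivity)]
            have : (0 : ℝ) ≤ 3 ^ k * M := by positivity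
            nlinarith
        _ ≤ _ := by
            refine div_le_div_of_nonneg_right ?_ (by positivity)
            calc _ ≤ ε ^ 2 * T * M := mul_le_mul_of_nonneg_right hT2 hM0
              _ = _ := by ring
    have h1 := iidProb_or_le hp0 (M := M) (fun d => voteProb Z T ε i P R ≤ θ ∧
        ¬ (voteCount ε i P R d : ℝ) * 16 * 41 ^ k < M) (fun d =>
        (1 / (8 * 41 ^ k) ≤ voteProb Z T ε i P R ∧
          (voteCount ε i P R d : ℝ) * 16 * 41 ^ k < M) ∨
        ε * (M * T) ≤ |∑ m, ∑ t, trialStat freshPattern i P R ((d m).2.1 t) -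
          M * T * coeff (evolved Z i P) R|)
    have h2 := iidProb_or_le hp0 (M := M) (fun d => 1 / (8 * 41 ^ k) ≤ voteProb Z T ε i P R ∧
          (voteCount ε i P R d : ℝ) * 16 * 41 ^ k < M) (fun d =>
        ε * (M * T) ≤ |∑ m, ∑ t, trialStat freshPattern i P R ((d m).2.1 t) -
          M * T * coeff (evolved Z i P) R|)
    linarith
  -- The union bound over all strings.
  set S : Finset (Fin n × Fin 4 × PauliString n) := Finset.univ ×ˢ
    ((Finset.univ.filter fun P => P ≠ 0) ×ˢ Finset.univ.filter fun R => R.weight ≤ k) with hS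
  have hcard : (S.card : ℝ) ≤ n * (3 * (4 * n) ^ k) := by
    have h3 : (Finset.univ.filter fun P : Fin 4 => P ≠ 0).card = 3 := by decide
    rw [hS, Finset.card_product, Finset.card_product, h3, Finset.card_univ, Fintype.card_fin]
    exact_mod_cast Nat.mul_le_mul_left n (Nat.mul_le_mul_left 3 (card_weight_le hn k))
  refine (iidProb_mono hp0 fun d hd => ?_).trans ((iidProb_exists_le hp0 S _).trans
    ((Finset.sum_le_card_nsmul S _ (4 * x) fun a ha => hone a ?_ ?_).trans ?_))
  · simp only [Typical, not_forall] at hd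
    obtain ⟨i, P, R, hP, hR, h⟩ := hd
    refine ⟨(i, P, R), by simp [hS, hP, hR], ?_⟩
    by_contra hcon
    simp only [not_or, not_and, not_not, not_le] at hcon
    exact h ⟨hcon.1, hcon.2.1, hcon.2.2⟩
  · simp only [hS, Finset.mem_product, Finset.mem_filter] at ha
    exact ha.2.1.2
  · simp only [hS, Finset.mem_product, Finset.mem_filter] at ha
    exact ha.2.2.2
  · rw [nsmul_eq_mul]
    calc (S.card : ℝ) * (4 * x) ≤ n * (3 * (4 * n) ^ k) * (4 * (δ / (32 * n)) ^ (k + 1)) :=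
          mul_le_mul hcard (mul_le_mul_of_nonneg_left hxle (by norm_num)) (by positivity)
            (by positivity)
      _ = 12 / 32 * δ * (4 * n * (δ / (32 * n))) ^ k := by
          rw [mul_pow (4 * (n : ℝ)), pow_succ]
          field_simp
          norm_num
      _ ≤ 12 / 32 * δ * 1 := by
          refine mul_le_mul_of_nonneg_left (pow_le_one₀ (by positivity) ?_) (by positivity)
          have : 4 * n * (δ / (32 * n)) = δ / 8 := by field_simp; norm_num
          rw [this]
          linarith
      _ ≤ δ := by linarith

end Group

end HamLearn

namespace HamLearn

/-! ### The law of the coins and outcomes -/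

section Law

/-- Finitely many distinct coins are independent and uniformly distributed. -/
theorem lintegral_coinMeasure {ι : Type*} [Fintype ι] [DecidableEq ι] {c : ι → ℕ}
    (hc : Function.Injective c) (F : (ι → Fin 6) → ℝ≥0∞) :
    ∫⁻ ω, F (fun a => ω (c a)) ∂coinMeasure =
      ∑ v, ENNReal.ofReal ((1 / 6) ^ Fintype.card ι) * F v := by
  have hmeas : Measurable fun (ω : ℕ → Fin 6) (a : ι) => ω (c a) :=
    measurable_pi_lambda _ fun a => measurable_pi_apply (c a)
  rw [← lintegral_map (f := F) (g := fun (ω : ℕ → Fin 6) (a : ι) => ω (c a))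
    (measurable_of_countable F) hmeas, lintegral_fintype]
  refine Finset.sum_congr rfl fun v _ => ?_
  rw [mul_comm, Measure.map_apply hmeas (measurableSet_singleton v)]
  congr 1
  have hpre : (fun (ω : ℕ → Fin 6) (a : ι) => ω (c a)) ⁻¹' {v} =
      Set.pi (Finset.univ.image c : Finset ℕ) fun j => {x | ∀ a, c a = j → x = v a} := by
    ext ω
    simp only [Set.mem_preimage, Set.mem_singleton_iff, Set.mem_pi, Finset.coe_image,
      Finset.coe_univ, Set.image_univ, Set.mem_range, forall_exists_index, forall_apply_eq_imp_iff,
      Set.mem_ofPred_eq]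
    constructor
    · rintro rfl a b hb
      simp only [hb]
    · intro h
      funext a
      exact h a a rfl
  rw [hpre, coinMeasure, Measure.infinitePi_pi _ fun _ _ => MeasurableSet.of_discrete,
    Finset.prod_image fun a _ b _ h => hc h]
  have h6 : ∀ a, (PMF.uniformOfFintype (Fin 6)).toMeasure {x | ∀ b, c b = c a → x = v b} =
      ENNReal.ofReal (1 / 6) := by
    intro a
    have : {x | ∀ b, c b = c a → x = v b} = {v a} := by
      ext x
      simp only [Set.mem_ofPred_eq, Set.mem_singleton_iff]
      exact ⟨fun h => h a rfl, fun h b hb => by rw [h, hc hb]⟩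
    rw [this, PMF.toMeasure_apply_singleton _ _ (measurableSet_singleton _),
      PMF.uniformOfFintype_apply, Fintype.card_fin, one_div,
      ENNReal.ofReal_inv_of_pos (by norm_num)]
    norm_num
  rw [Finset.prod_congr rfl fun a _ => h6 a, Finset.prod_const, Finset.card_univ,
    ENNReal.ofReal_pow (by norm_num)]

variable {n T M : ℕ}

/-- The experiments: the number of the group, and the number of the experiment within the half to
which it belongs. -/
abbrev Slot (T M : ℕ) := Fin M × (Fin T ⊕ Fin T)

/-- The number of the experiment within its group. -/
def slotNum : Fin T ⊕ Fin T → ℕ := Sum.elim (fun t => (t : ℕ)) fun t => T + t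

/-- The coins that are used by the design program: for every group, two for every qubit, and two for
every qubit in every experiment. -/
abbrev CoinIdx (n T M : ℕ) := Fin M × ((Fin n ⊕ (Fin T ⊕ Fin T) × Fin n) × Bool)

/-- The position of a coin in the coin sequence. -/
def coinPos (a : CoinIdx n T M) : ℕ :=
  a.2.1.elim (fun i : Fin n => baseCoin n T a.1 i + a.2.2.toNat)
    fun x : (Fin T ⊕ Fin T) × Fin n => trialCoin n T a.1 (slotNum x.1) x.2 + a.2.2.toNat

theorem eq_of_mul_add_eq {N a b r s : ℕ} (hr : r < N) (hs : s < N) (h : a * N + r = b * N + s) :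
    a = b ∧ r = s := by
  have h1 : (a * N + r) / N = a := by
    rw [mul_comm, Nat.mul_add_div (by omega), Nat.div_eq_of_lt hr, add_zero]
  have h2 : (b * N + s) / N = b := by
    rw [mul_comm, Nat.mul_add_div (by omega), Nat.div_eq_of_lt hs, add_zero]
  have h3 : a = b := by rw [← h1, h, h2]
  subst h3
  exact ⟨rfl, by omega⟩

theorem slotNum_lt (s : Fin T ⊕ Fin T) : slotNum s < 2 * T := by
  cases s <;> simp only [slotNum, Sum.elim_inl, Sum.elim_inr] <;> omega

theorem slotNum_injective : Function.Injective (slotNum (T := T)) := by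
  rintro (s | s) (t | t) h <;> simp only [slotNum, Sum.elim_inl, Sum.elim_inr] at h
  · rw [Fin.ext h]
  · omega
  · omega
  · rw [Fin.ext (Nat.add_left_cancel h)]

theorem coinPos_injective : Function.Injective (coinPos (n := n) (T := T) (M := M)) := by
  have hbit : ∀ b : Bool, b.toNat < 2 := fun b => by cases b <;> decide
  have hbitinj : ∀ b b' : Bool, b.toNat = b'.toNat → b = b' := by decide
  -- The position within the coins of the group.
  set off : (Fin n ⊕ (Fin T ⊕ Fin T) × Fin n) × Bool → ℕ := fun x =>
    x.1.elim (fun i : Fin n => (i : ℕ) * 2 + x.2.toNat)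
      fun y : (Fin T ⊕ Fin T) × Fin n =>
        (slotNum y.1 + 1) * (2 * n) + ((y.2 : ℕ) * 2 + x.2.toNat) with hoff
  have hlt : ∀ x, off x < coinsPerGroup n T := by
    rintro ⟨i | ⟨s, i⟩, b⟩
    · have := hbit b
      have := i.2
      simp only [hoff, Sum.elim_inl, coinsPerGroup]
      have : 0 ≤ 2 * T * (2 * n) := Nat.zero_le _
      omega
    · have h1 := hbit b
      have h2 := i.2
      have h3 : (slotNum s + 1) * (2 * n) ≤ 2 * T * (2 * n) :=
        Nat.mul_le_mul_right _ (slotNum_lt s)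
      simp only [hoff, Sum.elim_inr, coinsPerGroup]
      omega
  have hinj : Function.Injective off := by
    rintro ⟨i | ⟨s, i⟩, b⟩ ⟨i' | ⟨s', i'⟩, b'⟩ h <;>
      simp only [hoff, Sum.elim_inl, Sum.elim_inr] at h <;>
      have hb := hbit b <;> have hb' := hbit b' <;> have hi := i.2 <;> have hi' := i'.2
    · obtain ⟨h1, h2⟩ := eq_of_mul_add_eq hb hb' h
      rw [Fin.ext h1, hbitinj _ _ h2]
    · rw [add_mul] at h
      omega
    · rw [add_mul] at h
      omega
    · obtain ⟨h1, h2⟩ := eq_of_mul_add_eq (by omega) (by omega) h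
      obtain ⟨h3, h4⟩ := eq_of_mul_add_eq hb hb' h2
      rw [slotNum_injective (Nat.succ_injective h1), Fin.ext h3, hbitinj _ _ h4]
  have hpos : ∀ a : CoinIdx n T M, coinPos a = a.1 * coinsPerGroup n T + off a.2 := by
    rintro ⟨m, i | ⟨s, i⟩, b⟩
    · simp only [coinPos, baseCoin, hoff, Sum.elim_inl]
      ring
    · simp only [coinPos, trialCoin, hoff, Sum.elim_inr]
      ring
  rintro a b h
  rw [hpos, hpos] at h
  obtain ⟨h1, h2⟩ := eq_of_mul_add_eq (hlt _) (hlt _) h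
  exact Prod.ext (Fin.ext h1) (hinj h2)

/-- The coins and outcomes, arranged as the data of the groups. -/
def groupEquiv : (CoinIdx n T M → Fin 6) × (Slot T M → Fin n → Bool) ≃ (Fin M → Group n T) where
  toFun x m := (fun l => (x.1 (m, .inl l, false), x.1 (m, .inl l, true)),
    fun t => (fun l => x.1 (m, .inr (.inl t, l), false),
      fun l => (x.1 (m, .inr (.inl t, l), true), x.2 (m, .inl t) l)),
    fun t => (fun l => x.1 (m, .inr (.inr t, l), false),
      fun l => (x.1 (m, .inr (.inr t, l), true), x.2 (m, .inr t) l)))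
  invFun d := (fun a => match a with
    | (m, .inl l, false) => ((d m).1 l).1
    | (m, .inl l, true) => ((d m).1 l).2
    | (m, .inr (.inl t, l), false) => ((d m).2.1 t).1 l
    | (m, .inr (.inl t, l), true) => (((d m).2.1 t).2 l).1
    | (m, .inr (.inr t, l), false) => ((d m).2.2 t).1 l
    | (m, .inr (.inr t, l), true) => (((d m).2.2 t).2 l).1,
    fun s l => match s with
    | (m, .inl t) => (((d m).2.1 t).2 l).2
    | (m, .inr t) => (((d m).2.2 t).2 l).2)
  left_inv := by
    rintro ⟨v, w⟩
    refine Prod.ext (funext ?_) (funext fun s => funext fun l => ?_)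
    · rintro ⟨m, l | ⟨t | t, l⟩, _ | _⟩ <;> rfl
    · rcases s with ⟨m, t | t⟩ <;> rfl
  right_inv _ := rfl

/-- The data of an experiment. -/
def slotTrial (d : Fin M → Group n T) (s : Slot T M) : Trial n :=
  s.2.elim (d s.1).2.1 (d s.1).2.2

/-- The preparation pattern of an experiment. -/
def slotPattern (d : Fin M → Group n T) (s : Slot T M) : Pattern n :=
  s.2.elim (fun _ => freshPattern) fun _ => basePattern (d s.1).1

/-- The circuit of an experiment. -/
def slotCircuit (d : Fin M → Group n T) (s : Slot T M) : Circuit n :=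
  trialCircuit (slotPattern d s) (slotTrial d s)

theorem prod_groupWeight (Z : Op n) (x : (CoinIdx n T M → Fin 6) × (Slot T M → Fin n → Bool)) :
    ∏ m, groupWeight Z (groupEquiv x m) = (1 / 6) ^ Fintype.card (CoinIdx n T M) *
      ∏ s, (slotCircuit (groupEquiv x) s).outcomeProb Z (x.2 s) := by
  have hcard : Fintype.card (CoinIdx n T M) = M * (n * 2 + (T * n * 2 + T * n * 2)) := by
    simp only [Fintype.card_prod, Fintype.card_sum, Fintype.card_fin, Fintype.card_bool]
    ring
  have hm : ∀ m, groupWeight Z (groupEquiv x m) = (1 / 6) ^ (n * 2 + (T * n * 2 + T * n * 2)) *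
      ((∏ t, (slotCircuit (groupEquiv x) (m, .inl t)).outcomeProb Z (x.2 (m, .inl t))) *
        ∏ t, (slotCircuit (groupEquiv x) (m, .inr t)).outcomeProb Z (x.2 (m, .inr t))) := by
    intro m
    have h36 : (1 / 36 : ℝ) ^ n = (1 / 6) ^ (n * 2) := by
      rw [mul_comm, pow_mul]; norm_num
    have h1 : ∀ φ : Pattern n, ∀ d : Trial n, trialWeight Z φ d =
        (1 / 6) ^ (n * 2) * (trialCircuit φ d).outcomeProb Z fun l => (d.2 l).2 := by
      intro φ d
      rw [trialWeight, ← pow_add, mul_two]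
    simp only [groupWeight, h1, Finset.prod_mul_distrib, Finset.prod_const, Finset.card_univ,
      Fintype.card_fin, h36, ← pow_mul]
    have e : n * 2 * T = T * n * 2 := by ring
    rw [pow_add, pow_add, e]
    simp only [slotCircuit, slotPattern, slotTrial, Sum.elim_inl, Sum.elim_inr]
    simp only [groupEquiv, Equiv.coe_fn_mk]
    ring
  simp only [hm]
  rw [Finset.prod_mul_distrib, Finset.prod_const, Finset.card_univ, Fintype.card_fin, ← pow_mul,
    hcard, mul_comm M, Fintype.prod_prod_type]
  simp only [Fintype.prod_sum_type]

/-- The record `e` in the memory is a record of the data `d`. -/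
structure Matches (e : Record) (d : Fin M → Group n T) : Prop where
  size : e.n = n
  trials : e.T = T
  groups : e.M = M
  seen : ∀ (m : Fin M) s (l : Fin n), e.y ((m * (2 * T) + slotNum s) * n + l) =
    seenCode (slotPattern d (m, s) l) ((slotTrial d (m, s)).1 l)
  meas : ∀ (m : Fin M) s (l : Fin n), e.u ((m * (2 * T) + slotNum s) * n + l) =
    ((slotTrial d (m, s)).2 l).1
  out : ∀ (m : Fin M) s (l : Fin n), e.o ((m * (2 * T) + slotNum s) * n + l) =
    if ((slotTrial d (m, s)).2 l).2 then 1 else 0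

/-- The memory before the start of the processing program. -/
structure Recorded (n k : ℕ) (ε : ℝ) (d : Fin M → Group n T) (σ : State) (e : Record) : Prop where
  env : Env σ e
  outputs : Outputs σ n []
  locality : e.k = k
  accuracy : e.ε = ε
  scale : e.D = 41 ^ k
  data : Matches e d

/-- The numbering of the experiments. -/
def slotEquiv {N : ℕ} (h : N = M * (2 * T)) : Slot T M ≃ Fin N :=
  (Equiv.prodCongr (Equiv.refl _) (finSumFinEquiv.trans (finCongr (two_mul T).symm))).trans
    (finProdFinEquiv.trans (finCongr h.symm))

theorem slotEquiv_val {N : ℕ} (h : N = M * (2 * T)) (m : Fin M) (s : Fin T ⊕ Fin T) :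
    (slotEquiv h (m, s) : ℕ) = m * (2 * T) + slotNum s := by
  cases s <;> simp [slotEquiv, slotNum] <;> ring

theorem Designed.cell {ω : ℕ → Fin 6} {k : ℕ} {ε : ℝ} {σ : State}
    (h : Designed ω n k ε T M σ) (w : Slot T M → Fin n → Bool) (m : Fin M) (s : Fin T ⊕ Fin T)
    (l : Fin n) :
    let d := groupEquiv (fun a => ω (coinPos a), w)
    let c := (m * (2 * T) + slotNum s) * n + l
    σ.nat 2 c = ((slotPattern d (m, s) l).getD ((slotTrial d (m, s)).1 l) : ℕ) ∧
    σ.nat 3 c = σ.nat 2 c - 2 ∧ σ.nat 4 c = ((slotTrial d (m, s)).2 l).1 ∧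
    σ.nat 8 c = seenCode (slotPattern d (m, s) l) ((slotTrial d (m, s)).1 l) := by
  intro d c
  have hc : (m * (2 * T) + slotNum s) * n + l < M * (2 * T) * n := by
    have h1 := slotNum_lt s
    have h2 : (m : ℕ) + 1 ≤ M := m.2
    calc _ < ((m : ℕ) * (2 * T) + slotNum s + 1) * n := by rw [add_mul _ 1]; have := l.2; omega
      _ ≤ ((m : ℕ) + 1) * (2 * T) * n := Nat.mul_le_mul_right _ (by rw [add_mul]; omega)
      _ ≤ _ := Nat.mul_le_mul_right _ (Nat.mul_le_mul_right _ h2)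
  obtain ⟨h1, h2, h3, h4⟩ := h.cells m (slotNum s) l (slotNum_lt s) l.2 hc
  refine ⟨h1.trans ?_, h2, h3.trans ?_, h4.trans ?_⟩
  · rcases s with t | t
    · rw [if_neg fun hf => absurd hf.1 (by simp [slotNum])]
      rfl
    · by_cases hf : IsFixed ω n T m (slotNum (Sum.inr t)) l
      · rw [if_pos hf]
        have : slotPattern d (m, Sum.inr t) l = some (ω (baseCoin n T m l)) := if_neg (by
          exact not_lt.2 hf.2)
        rw [this]
        rfl
      · rw [if_neg hf]
        have : slotPattern d (m, Sum.inr t) l = none := if_pos (by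
          by_contra hcon
          exact hf ⟨by simp [slotNum], not_lt.1 hcon⟩)
        rw [this]
        rfl
  · rcases s with t | t <;> rfl
  · rcases s with t | t
    · rw [if_neg fun hf => absurd hf.1 (by simp [slotNum])]
      rfl
    · by_cases hf : IsFixed ω n T m (slotNum (Sum.inr t)) l
      · rw [if_pos hf]
        have : slotPattern d (m, Sum.inr t) l = some (ω (baseCoin n T m l)) := if_neg (by
          exact not_lt.2 hf.2)
        rw [this]
        rfl
      · rw [if_neg hf]
        have : slotPattern d (m, Sum.inr t) l = none := if_pos (by
          by_contra hcon
          exact hf ⟨by simp [slotNum], not_lt.1 hcon⟩)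
        rw [this]
        rfl

theorem Designed.circuit_eq {ω : ℕ → Fin 6} {k : ℕ} {ε : ℝ} {σ : State}
    (h : Designed ω n k ε T M σ) (w : Slot T M → Fin n → Bool) (m : Fin M) (s : Fin T ⊕ Fin T) :
    σ.circuit n (m * (2 * T) + slotNum s) =
      slotCircuit (groupEquiv (fun a => ω (coinPos a), w)) (m, s) := by
  simp only [State.circuit, slotCircuit, trialCircuit, codeCircuit, Circuit.mk.injEq]
  refine ⟨funext fun l => ?_, funext fun l => ?_, funext fun l => ?_⟩
  · rw [(h.cell w m s l).1]
    rfl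
  · rw [(h.cell w m s l).2.1, (h.cell w m s l).1, codeSign]
    congr 1
    rw [eq_iff_iff]
    omega
  · rw [(h.cell w m s l).2.2.1]
    rfl

theorem Designed.recorded {ω : ℕ → Fin 6} {k : ℕ} {ε : ℝ} {σ : State}
    (h : Designed ω n k ε T M σ) (w : Slot T M → Fin n → Bool)
    (hN : σ.numExperiments = M * (2 * T)) :
    ∃ e, Recorded n k ε (groupEquiv (fun a => ω (coinPos a), w))
      (σ.record fun j => w ((slotEquiv hN).symm j)) e := by
  set σ' := σ.record fun j => w ((slotEquiv hN).symm j) with hσ'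
  have hne : ∀ a, a ≠ 5 → σ'.nat a = σ.nat a := fun a ha => by
    rw [hσ', State.record]
    exact Function.update_of_ne ha _ _
  refine ⟨⟨n, k, T, M, ε, 41 ^ k, σ'.nat 8, σ'.nat 4, σ'.nat 5⟩,
    ⟨?_, ?_, ?_, ?_, ?_, h.accuracy, h.scale, rfl, rfl, rfl⟩, ⟨?_, ?_, ?_, ?_, ?_⟩, rfl, rfl, rfl,
    ⟨rfl, rfl, rfl, ?_, ?_, ?_⟩⟩
  · rw [hne _ (by decide), h.size]
  · rw [hne _ (by decide), h.locality]
  · rw [hne _ (by decide), h.trials]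
  · rw [hne _ (by decide), h.groups]
  · rw [hne _ (by decide), h.stride]
  · rw [hne _ (by decide), h.count]; rfl
  · rw [hne _ (by decide), h.row]; simp
  · intro r hr; simp at hr
  · intro r hr; simp at hr
  · intro x _; rw [hne _ (by decide), h.string]
  · intro m s l
    simp only
    rw [hne _ (by decide), (h.cell w m s l).2.2.2]
  · intro m s l
    simp only
    rw [hne _ (by decide), (h.cell w m s l).2.2.1]
  · intro m s l
    simp only
    have hn : 0 < n := lt_of_le_of_lt (Nat.zero_le _) l.2
    have hdiv : ((m * (2 * T) + slotNum s) * n + l) / n = m * (2 * T) + slotNum s := by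
      rw [mul_comm, Nat.mul_add_div hn, Nat.div_eq_of_lt l.2, add_zero]
    have hmod : ((m * (2 * T) + slotNum s) * n + l) % n = l := by
      rw [mul_comm, Nat.mul_add_mod, Nat.mod_eq_of_lt l.2]
    have hval := slotEquiv_val hN m s
    have hlt : m * (2 * T) + slotNum s < σ.numExperiments := hval ▸ (slotEquiv hN (m, s)).2
    rw [hσ', State.record]
    simp only [Function.update_self]
    rw [dif_pos ⟨by rw [hdiv]; exact hlt, hn⟩]
    have hj : (⟨((m * (2 * T) + slotNum s) * n + l) / n, by rw [hdiv]; exact hlt⟩ :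
        Fin σ.numExperiments) = slotEquiv hN (m, s) := Fin.ext (by rw [hval]; exact hdiv)
    have hl : (⟨((m * (2 * T) + slotNum s) * n + l) % n, Nat.mod_lt _ hn⟩ : Fin n) = l :=
      Fin.ext hmod
    rw [hj, hl, Equiv.symm_apply_apply]
    rcases s with t | t <;> rfl

set_option synthInstance.maxSize 1000 in
theorem sum_groups (F : (Fin M → Group n T) → ℝ≥0∞) :
    ∑ d, F d = ∑ v : CoinIdx n T M → Fin 6, ∑ w : Slot T M → Fin n → Bool, F (groupEquiv (v, w)) :=
  (groupEquiv.sum_comp F).symm.trans (Fintype.sum_prod_type _)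

/-- The probability of success of the algorithm is at least that of an event on which the processing
program succeeds. -/
theorem le_prob {k : ℕ} {ε δ : ℝ} (hpos : 0 < n / δ) (hT : trialCount k ε = T)
    (hM : groupCount n k δ = M) (Z : Op n)
    (good : (PauliString n → ℝ) → ℕ → Prop)
    (S : (Fin M → Group n T) → Prop)
    (h : ∀ ω t₁ σ e d, t₁ ≤ 1000 * ((M + logCount n δ + k + 1) * ((n + 1) * (T + 1))) →
      Recorded n k ε d σ e → S d →
        ∃ t₂ σ₂, Exec ω processProg σ t₂ σ₂ ∧ good (σ₂.output n) (t₁ + t₂)) :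
    ENNReal.ofReal (iidProb (groupWeight Z) M S) ≤
      Algorithm.prob ⟨designProg, processProg⟩ Z k ε δ good := by
  classical
  set G : (CoinIdx n T M → Fin 6) → ℝ≥0∞ := fun v => ∑ w : Slot T M → Fin n → Bool,
    if S (groupEquiv (v, w)) then
      ∏ s, ENNReal.ofReal ((slotCircuit (groupEquiv (v, w)) s).outcomeProb Z (w s)) else 0 with hG
  have hsum : ENNReal.ofReal (iidProb (groupWeight Z) M S) =
      ∑ v, ENNReal.ofReal ((1 / 6) ^ Fintype.card (CoinIdx n T M)) * G v := by
    rw [iidProb, ENNReal.ofReal_sum_of_nonneg fun d _ => mul_nonneg (Finset.prod_nonneg fun m _ =>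
      groupWeight_nonneg Z _) (by split_ifs <;> norm_num), sum_groups]
    refine Finset.sum_congr rfl fun v _ => ?_
    rw [hG, Finset.mul_sum]
    refine Finset.sum_congr rfl fun w _ => ?_
    by_cases hS : S (groupEquiv (v, w))
    · rw [if_pos hS, if_pos hS, mul_one, prod_groupWeight, ENNReal.ofReal_mul (by positivity),
        ENNReal.ofReal_prod_of_nonneg fun s _ => outcomeProb_nonneg _ _ _]
    · rw [if_neg hS, if_neg hS, mul_zero, ENNReal.ofReal_zero, mul_zero]
  rw [hsum, ← lintegral_coinMeasure coinPos_injective, Algorithm.prob]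
  refine lintegral_mono fun ω => ?_
  obtain ⟨t₁, σ₁, hexec, ht₁, hdes⟩ := wp_designProg (ω := ω) (n := n) (k := k) (ε := ε) hpos
  rw [hT, hM] at ht₁ hdes
  have hN : σ₁.numExperiments = M * (2 * T) := hdes.asked
  refine le_trans ?_ (le_iSup_of_le t₁ (le_iSup_of_le σ₁ (le_iSup_of_le hexec le_rfl)))
  rw [hG, ← (Equiv.arrowCongr (slotEquiv hN) (Equiv.refl (Fin n → Bool))).sum_comp]
  refine Finset.sum_le_sum fun w _ => ?_
  by_cases hS : S (groupEquiv (fun a => ω (coinPos a), w))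
  · obtain ⟨e, hrec⟩ := hdes.recorded w hN
    rw [if_pos hS]
    refine (le_of_eq ?_).trans (le_of_eq (if_pos (h ω t₁ _ e _ ht₁ hrec hS)).symm)
    rw [← (slotEquiv hN).prod_comp]
    refine Finset.prod_congr rfl fun s _ => ?_
    rw [slotEquiv_val, hdes.circuit_eq w]
    simp
  · rw [if_neg hS]
    exact zero_le

end Law

end HamLearn

namespace HamLearn

/-! ### Pauli strings as lists -/

section Strings

variable {n : ℕ}

/-- The Pauli string that is described by a list of pairs of a qubit and a label. -/
def toPauli (n : ℕ) (l : List (ℕ × ℕ)) : PauliString n := fun x => Fin.ofNat 4 (strF l x)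

/-- The list consists of qubits, in decreasing order, with labels of non-identity Pauli matrices. -/
structure IsString (n : ℕ) (l : List (ℕ × ℕ)) : Prop where
  sorted : l.Pairwise fun a b => b.1 < a.1
  upper : ∀ a ∈ l, a.1 < n
  label : ∀ a ∈ l, 1 ≤ a.2 ∧ a.2 ≤ 3

theorem IsTreeString.isString {k i R : ℕ} {l : List (ℕ × ℕ)} (h : IsTreeString k i R n l) :
    IsString n l := ⟨h.sorted, h.upper, h.label⟩

theorem IsString.tail {a : ℕ × ℕ} {l : List (ℕ × ℕ)} (h : IsString n (a :: l)) : IsString n l :=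
  ⟨(List.pairwise_cons.1 h.sorted).2, fun b hb => h.upper b (List.mem_cons_of_mem _ hb),
    fun b hb => h.label b (List.mem_cons_of_mem _ hb)⟩

theorem strF_cons {a : ℕ × ℕ} {l : List (ℕ × ℕ)} (h : ∀ b ∈ l, b.1 ≠ a.1) :
    strF (a :: l) = Function.update (strF l) a.1 a.2 := by
  induction l using List.reverseRecOn with
  | nil => rfl
  | append_singleton l b ih =>
    rw [← List.cons_append, strF_concat, strF_concat, ih fun b hb => h b (by simp [hb]),
      Function.update_comm (h b (by simp)).symm]

theorem toPauli_nil : toPauli n [] = 0 := by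
  ext x
  simp [toPauli, strF]

theorem IsString.toPauli_cons {a : ℕ × ℕ} {l : List (ℕ × ℕ)} (h : IsString n (a :: l)) :
    toPauli n (a :: l) = Function.update (toPauli n l) ⟨a.1, h.upper a (by simp)⟩
      (Fin.ofNat 4 a.2) := by
  have hs := (List.pairwise_cons.1 h.sorted).1
  funext x
  rw [toPauli, strF_cons fun b hb => (hs b hb).ne]
  by_cases hx : (x : ℕ) = a.1
  · have : x = ⟨a.1, h.upper a (by simp)⟩ := Fin.ext hx
    subst this
    simp
  · rw [Function.update_of_ne hx, Function.update_of_ne fun h => hx (by rw [h])]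
    rfl

theorem IsString.toPauli_head {a : ℕ × ℕ} {l : List (ℕ × ℕ)} (h : IsString n (a :: l)) :
    toPauli n l ⟨a.1, h.upper a (by simp)⟩ = 0 := by
  have hs := (List.pairwise_cons.1 h.sorted).1
  rw [toPauli, strF_of_notMem fun b hb => (hs b hb).ne]
  rfl

theorem label_ofNat {v : ℕ} (h : 1 ≤ v ∧ v ≤ 3) : ((Fin.ofNat 4 v : Fin 4) : ℕ) = v := by
  simp only [Fin.ofNat, Nat.mod_eq_of_lt (show v < 4 by omega)]

theorem label_ofNat_ne {v : ℕ} (h : 1 ≤ v ∧ v ≤ 3) : (Fin.ofNat 4 v : Fin 4) ≠ 0 := by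
  intro h0
  have := label_ofNat h
  rw [h0] at this
  simp at this
  omega

theorem IsString.mem_iff {l : List (ℕ × ℕ)} (h : IsString n l) (x : Fin n) {v : Fin 4}
    (hv : v ≠ 0) : ((x : ℕ), (v : ℕ)) ∈ l ↔ toPauli n l x = v := by
  induction l with
  | nil => simp [toPauli_nil, hv.symm]
  | cons a l ih =>
    have hs := (List.pairwise_cons.1 h.sorted).1
    rw [List.mem_cons, ih h.tail, h.toPauli_cons]
    by_cases hx : (x : ℕ) = a.1
    · have hx' : x = ⟨a.1, h.upper a (by simp)⟩ := Fin.ext hx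
      subst hx'
      rw [Function.update_self, h.toPauli_head]
      constructor
      · rintro (h1 | h1)
        · rw [← h1]
          ext
          simp
        · exact absurd h1.symm hv
      · intro h1
        left
        refine Prod.ext rfl ?_
        rw [← h1, label_ofNat (h.label a (by simp))]
    · rw [Function.update_of_ne fun h => hx (by rw [h])]
      constructor
      · rintro (h1 | h1)
        · exact absurd (congrArg Prod.fst h1) hx
        · exact h1
      · exact Or.inr

theorem weight_toPauli {l : List (ℕ × ℕ)} (h : IsString n l) :
    (toPauli n l).weight = l.length := by
  induction l with
  | nil => simp [toPauli_nil, PauliString.weight]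
  | cons a l ih =>
    rw [List.length_cons, ← ih h.tail, h.toPauli_cons, PauliString.weight, PauliString.weight]
    set x : Fin n := ⟨a.1, h.upper a (by simp)⟩
    have hx : x ∉ Finset.univ.filter fun y => toPauli n l y ≠ 0 := by
      simpa using h.toPauli_head
    rw [← Finset.card_insert_of_notMem hx]
    congr 1
    ext y
    by_cases hy : y = x
    · subst hy
      simp [label_ofNat_ne (h.label a (by simp)), -Fin.ofNat_eq_cast]
    · simp [hy]

theorem prod_map_eq {l : List (ℕ × ℕ)} (h : IsString n l) (F : ℕ → ℕ → ℝ) :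
    (l.map fun a => F a.1 a.2).prod =
      ∏ x : Fin n, if toPauli n l x = 0 then 1 else F x (toPauli n l x) := by
  induction l with
  | nil => simp [toPauli_nil]
  | cons a l ih =>
    rw [List.map_cons, List.prod_cons, ih h.tail, h.toPauli_cons]
    set x : Fin n := ⟨a.1, h.upper a (by simp)⟩ with hx
    conv_lhs => rw [← Finset.mul_prod_erase _ _ (Finset.mem_univ x)]
    conv_rhs => rw [← Finset.mul_prod_erase _ _ (Finset.mem_univ x)]
    rw [if_pos h.toPauli_head, one_mul, Function.update_self,
      if_neg (label_ofNat_ne (h.label a (by simp))), label_ofNat (h.label a (by simp))]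
    congr 1
    refine Finset.prod_congr rfl fun y hy => ?_
    rw [Function.update_of_ne (Finset.ne_of_mem_erase hy)]

theorem toPauli_injective {l l' : List (ℕ × ℕ)} (h : IsString n l) (h' : IsString n l')
    (heq : toPauli n l = toPauli n l') : l = l' := by
  have hnd : ∀ {m : List (ℕ × ℕ)}, IsString n m → m.Nodup := fun hm =>
    hm.sorted.imp fun hab h => by rw [h] at hab; exact lt_irrefl _ hab
  have key : ∀ {m m' : List (ℕ × ℕ)}, IsString n m → IsString n m' → toPauli n m = toPauli n m' →
      ∀ a ∈ m, a ∈ m' := by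
    rintro m m' hm hm' hmm ⟨x, v⟩ ha
    have hv := hm.label _ ha
    have hv' := label_ofNat hv
    have h1 := hm.mem_iff ⟨x, hm.upper _ ha⟩ (label_ofNat_ne hv)
    have h2 := hm'.mem_iff ⟨x, hm.upper _ ha⟩ (label_ofNat_ne hv)
    rw [hv'] at h1 h2
    rw [← hmm] at h2
    exact h2.2 (h1.1 ha)
  refine List.Perm.eq_of_pairwise (le := fun a b => b.1 < a.1) (fun a b _ _ h1 h2 => ?_) h.sorted
    h'.sorted ((List.perm_ext_iff_of_nodup (hnd h) (hnd h')).2 fun a =>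
      ⟨key h h' heq a, key h' h heq.symm a⟩)
  omega

variable {T M k : ℕ} {ε : ℝ} {σ : State} {e : Record} {d : Fin M → Group n T}

theorem Matches.statF_eq (hd : Matches e d) (m : Fin M) (s : Fin T ⊕ Fin T) (i : Fin n) (P : Fin 4)
    {l : List (ℕ × ℕ)} (hl : IsString n l) :
    statF e.y e.u e.o i P ((m * (2 * T) + slotNum s) * n) l =
      trialStat (slotPattern d (m, s)) i P (toPauli n l) (slotTrial d (m, s)) := by
  rw [statF, trialStat, hd.meas, hd.out, prod_map_eq hl fun x v =>
    chi (e.y ((m * (2 * T) + slotNum s) * n + x)) v, measFactor]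
  congr 1
  refine Finset.prod_congr rfl fun x _ => ?_
  rw [hd.seen, prepFactor]

theorem Matches.trialSum_eq (hd : Matches e d) (m : Fin M) (i : Fin n) (P : Fin 4)
    {l : List (ℕ × ℕ)} (hl : IsString n l) :
    e.trialSum i P (m * (2 * T)) l =
        ∑ t, trialStat freshPattern i P (toPauli n l) ((d m).2.1 t) ∧
      e.trialSum i P (m * (2 * T) + T) l =
        ∑ t, trialStat (basePattern (d m).1) i P (toPauli n l) ((d m).2.2 t) := by
  rw [Record.trialSum, Record.trialSum, hd.trials, hd.size, Finset.sum_range, Finset.sum_range]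
  constructor
  · exact Finset.sum_congr rfl fun t _ => hd.statF_eq m (.inl t) i P hl
  · refine Finset.sum_congr rfl fun t _ => ?_
    have := hd.statF_eq m (.inr t) i P hl
    rw [slotNum, Sum.elim_inr, ← add_assoc] at this
    exact this

theorem Recorded.votes_eq (h : Recorded n k ε d σ e) (i : Fin n) (P : Fin 4) {l : List (ℕ × ℕ)}
    (hl : IsString n l) : e.votes i P l = voteCount ε i P (toPauli n l) d := by
  classical
  rw [Record.votes, voteCount, h.data.trials, h.data.groups, h.accuracy, Finset.card_filter,
    Finset.card_filter, Finset.sum_range]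
  refine Finset.sum_congr rfl fun m _ => if_congr ?_ rfl rfl
  rw [(h.data.trialSum_eq m i P hl).2, not_lt, GroupVotes, sq, sq]

theorem Recorded.live_iff (h : Recorded n k ε d σ e) (i : Fin n) (P : Fin 4) {l : List (ℕ × ℕ)}
    (hl : IsString n l) :
    e.live i P l ↔ ¬ (voteCount ε i P (toPauli n l) d : ℝ) * 16 * 41 ^ k < M := by
  rw [Record.live, h.votes_eq i P hl, h.scale, h.data.groups]

theorem Recorded.totalSum_eq (h : Recorded n k ε d σ e) (i : Fin n) (P : Fin 4)
    {l : List (ℕ × ℕ)} (hl : IsString n l) : e.totalSum i P l =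
      ∑ m, ∑ t, trialStat freshPattern i P (toPauli n l) ((d m).2.1 t) := by
  rw [Record.totalSum, h.data.groups, h.data.trials, Finset.sum_range]
  exact Finset.sum_congr rfl fun m _ => (h.data.trialSum_eq m i P hl).1

end Strings

end HamLearn

namespace HamLearn

/-! ### The number of strings that receive many votes -/

section Counting

variable {n : ℕ}

theorem clip_sq {ε : ℝ} (hε : 0 ≤ ε) (x : ℝ) : clip ε x ^ 2 = min (x ^ 2) (ε ^ 2) := by
  rw [clip]
  rcases le_total x ε with h1 | h1
  · rw [min_eq_left h1]
    rcases le_total (-ε) x with h2 | h2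
    · rw [max_eq_right h2, min_eq_left (sq_le_sq' h2 h1)]
    · rw [max_eq_left h2, neg_sq, min_eq_right]
      nlinarith
  · rw [min_eq_right h1, max_eq_right (by linarith), min_eq_right (pow_le_pow_left₀ hε h1 2)]

/-- Clipping does not spoil a lower bound for a sum of squares that is below the clipping level: if
one summand is clipped, then it suffices alone. -/
theorem le_sum_clip_sq {ι : Type*} (s : Finset ι) (x : ι → ℝ) {ε τ : ℝ} (hε : 0 ≤ ε)
    (h1 : τ ≤ ε ^ 2) (h2 : τ ≤ ∑ j ∈ s, x j ^ 2) : τ ≤ ∑ j ∈ s, clip ε (x j) ^ 2 := by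
  by_cases h : ∃ j ∈ s, ε ^ 2 ≤ x j ^ 2
  · obtain ⟨j, hj, hx⟩ := h
    refine h1.trans (le_trans (le_of_eq ?_)
      (Finset.single_le_sum (fun j _ => sq_nonneg (clip ε (x j))) hj))
    rw [clip_sq hε, min_eq_right hx]
  · push Not at h
    refine h2.trans (le_of_eq (Finset.sum_congr rfl fun j hj => ?_))
    rw [clip_sq hε, min_eq_left (h j hj).le]

theorem sum_clip_sq_le {ε : ℝ} (hε : 0 < ε) (lam : PauliString n → ℝ) (i : Fin n) :
    ∑ Q : PauliString n with Q i ≠ 0, clip ε (lam Q) ^ 2 ≤ effSparsity ε lam * ε ^ 2 := by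
  set v : PauliString n → ℝ := fun Q => clip ε (lam Q) with hv
  have h1 : √(∑ Q : PauliString n with Q i ≠ 0, v Q ^ 2) ≤ localTwoNorm v := by
    rw [localTwoNorm]
    exact le_ciSup (f := fun i : Fin n => √(∑ Q : PauliString n with Q i ≠ 0, v Q ^ 2))
      (Set.finite_range _).bddAbove i
  have h2 : ∑ Q : PauliString n with Q i ≠ 0, v Q ^ 2 ≤ localTwoNorm v ^ 2 := by
    rw [← Real.sq_sqrt (Finset.sum_nonneg fun Q _ => sq_nonneg (v Q))]
    exact pow_le_pow_left₀ (Real.sqrt_nonneg _) h1 2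
  refine h2.trans ?_
  rw [← div_le_iff₀ (by positivity), effSparsity]
  exact le_max_right _ _

theorem one_le_effSparsity (ε : ℝ) (lam : PauliString n → ℝ) : 1 ≤ effSparsity ε lam :=
  le_max_left _ _

open Classical in
theorem card_extends_le (R : PauliString n) :
    (Finset.univ.filter fun α => Extends α R).card ≤ 2 ^ R.weight := by
  rw [PauliString.weight, ← Finset.card_powerset]
  refine Finset.card_le_card_of_injOn (fun α => Finset.univ.filter fun l => α l ≠ 0) ?_ ?_
  · intro α hα
    have hα' : Extends α R := by simpa using hα
    rw [Finset.mem_coe, Finset.mem_powerset]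
    intro l hl
    simp only [Finset.mem_filter, Finset.mem_univ, true_and] at hl ⊢
    rwa [hα' l hl]
  · intro α hα β hβ h
    have hα' : Extends α R := by simpa using hα
    have hβ' : Extends β R := by simpa using hβ
    funext l
    have hl : (α l ≠ 0) ↔ (β l ≠ 0) := by
      have := Finset.ext_iff.1 h l
      simpa using this
    by_cases h0 : α l = 0
    · rw [h0]
      by_contra h1
      exact hl.2 (fun h2 => h1 h2.symm) h0
    · rw [← hα' l h0, ← hβ' l (hl.1 h0)]

/-- Only few strings receive many votes: each of them is contained in terms of the Hamiltonian with
a large sum of squares, and every term contains only few strings. -/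
theorem card_heavy_le {Z : Op n} (hZ : Z ∈ Matrix.unitaryGroup (Fin n → Fin 2) ℂ) {k T : ℕ} {ε : ℝ}
    (hε : 0 < ε) (hT : 2000 * 41 ^ k / ε ^ 2 ≤ T) {lam : PauliString n → ℝ}
    (hlam : IsLocalHamiltonian k lam)
    (happrox : FirstOrderApprox Z (hamiltonian lam) (ε / 20 ^ (k + 2))) (i : Fin n)
    {c P Rx : Fin 4} (hcyc : IsCyclic c P Rx) (S : Finset (PauliString n))
    (hS : ∀ α ∈ S, α i = Rx ∧ 1 / (32 * 41 ^ k) < voteProb Z T ε i P α) :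
    (S.card : ℝ) ≤ 1024 * 82 ^ k * effSparsity ε lam := by
  classical
  obtain ⟨hc, hP, hRx⟩ := hcyc.ne_zero
  have hTpos : (0 : ℝ) < T := lt_of_lt_of_le (by positivity) hT
  have hT0 : 0 < T := by exact_mod_cast hTpos
  obtain ⟨e, he, hcoeff⟩ := exists_error happrox i hcyc
  set τ : ℝ := ε ^ 2 / (1024 * 41 ^ k) with hτ
  have hD : (1 : ℝ) ≤ 41 ^ k := one_le_pow₀ (by norm_num)
  have hext : ∀ α ∈ S, ∀ R, Extends α R → R i = Rx := fun α hα R hR => by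
    rw [hR i (by rw [(hS α hα).1]; exact hRx), (hS α hα).1]
  have hheavy : ∀ α ∈ S,
      τ ≤ ∑ R with Extends α R, clip ε (lam (Function.update R i c)) ^ 2 := by
    intro α hα
    refine le_sum_clip_sq _ _ hε.le ?_ ?_
    · rw [hτ, div_le_iff₀ (by positivity)]
      nlinarith [sq_pos_of_pos hε]
    · have h1 := (hS α hα).2.trans_le (voteProb_le hZ hT0 hε i hP α)
      rw [lt_div_iff₀ (by positivity)] at h1
      have h2 : ∑ R with Extends α R, coeff (evolved Z i P) R ^ 2 ≤
          8 * ∑ R with Extends α R, lam (Function.update R i c) ^ 2 +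
            2 * (ε / 20 ^ (k + 2)) ^ 2 := by
        calc _ ≤ ∑ R with Extends α R, (8 * lam (Function.update R i c) ^ 2 + 2 * e R ^ 2) := by
              refine Finset.sum_le_sum fun R hR => ?_
              rw [hcoeff R (hext α hα R (Finset.mem_filter.1 hR).2)]
              nlinarith [sq_nonneg (2 * lam (Function.update R i c) + e R)]
          _ ≤ _ := by
              rw [Finset.sum_add_distrib, ← Finset.mul_sum, ← Finset.mul_sum]
              have : ∑ R with Extends α R, e R ^ 2 ≤ ∑ R, e R ^ 2 :=
                Finset.sum_le_sum_of_subset_of_nonneg (Finset.filter_subset _ _)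
                  fun R _ _ => sq_nonneg _
              linarith
      have h3 : 3 / (T : ℝ) ≤ 3 / 2000 * (ε ^ 2 / 41 ^ k) := by
        rw [div_le_iff₀ (by positivity)] at hT
        have h0 : 2000 ≤ ε ^ 2 / 41 ^ k * T := by
          rw [div_mul_eq_mul_div, le_div_iff₀ (by positivity)]
          linarith
        rw [div_le_iff₀ hTpos]
        linarith
      have h4 : (ε / 20 ^ (k + 2)) ^ 2 ≤ 1 / 160000 * (ε ^ 2 / 41 ^ k) := by
        rw [div_pow, ← pow_mul, mul_comm (k + 2) 2, pow_mul, pow_add, div_mul_div_comm, one_mul]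
        refine div_le_div_of_nonneg_left (by positivity) (by positivity) ?_
        have : (41 : ℝ) ^ k ≤ (20 ^ 2) ^ k := pow_le_pow_left₀ (by norm_num) (by norm_num) k
        linarith
      have h5 : 1 / (32 * 41 ^ k) * ε ^ 2 = 1 / 32 * (ε ^ 2 / 41 ^ k) := by field_simp
      have h6 : τ = 1 / 1024 * (ε ^ 2 / 41 ^ k) := by rw [hτ]; field_simp
      have h7 : 0 < ε ^ 2 / 41 ^ k := by positivity
      rw [h5] at h1
      rw [h6]
      linarith
  -- Double counting: a string of weight at most `k` extends at most `2 ^ k` strings.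
  have hsum : (S.card : ℝ) * τ ≤ 2 ^ k * (effSparsity ε lam * ε ^ 2) := by
    calc (S.card : ℝ) * τ ≤ ∑ α ∈ S, ∑ R with Extends α R,
          clip ε (lam (Function.update R i c)) ^ 2 := by
          rw [← nsmul_eq_mul]
          exact Finset.card_nsmul_le_sum _ _ _ hheavy
      _ = ∑ R, ∑ α ∈ S, if Extends α R then clip ε (lam (Function.update R i c)) ^ 2 else 0 := by
          simp only [Finset.sum_filter]
          exact Finset.sum_comm
      _ ≤ ∑ R with R i = Rx, 2 ^ k * clip ε (lam (Function.update R i c)) ^ 2 := by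
          rw [Finset.sum_filter]
          refine Finset.sum_le_sum fun R _ => ?_
          rw [← Finset.sum_filter, Finset.sum_const, nsmul_eq_mul]
          split_ifs with hR
          · by_cases h0 : lam (Function.update R i c) = 0
            · rw [h0, clip_sq hε.le]
              simp [sq_nonneg]
            · refine mul_le_mul_of_nonneg_right ?_ (sq_nonneg _)
              have hw : R.weight ≤ k := by
                by_contra hw
                exact h0 (hlam.2 _ (by
                  rw [weight_update (by rwa [hR]) hc]
                  exact not_le.1 hw))
              have h1 : (S.filter fun α => Extends α R).card ≤ 2 ^ k :=
                (Finset.card_le_card (Finset.filter_subset_filter _ (Finset.subset_univ S))).trans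
                  ((card_extends_le R).trans (Nat.pow_le_pow_right (by norm_num) hw))
              exact_mod_cast h1
          · rw [Finset.filter_eq_empty_iff.2 fun α hα h => hR (hext α hα R h)]
            simp
      _ = 2 ^ k * ∑ R with R i = Rx, clip ε (lam (Function.update R i c)) ^ 2 := by
          rw [Finset.mul_sum]
      _ ≤ 2 ^ k * ∑ Q : PauliString n with Q i ≠ 0, clip ε (lam Q) ^ 2 := by
          refine mul_le_mul_of_nonneg_left ?_ (by positivity)
          rw [← Finset.sum_image (s := Finset.univ.filter fun R : PauliString n => R i = Rx)
            (g := fun R => Function.update R i c) (f := fun Q => clip ε (lam Q) ^ 2)]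
          · refine Finset.sum_le_sum_of_subset_of_nonneg (fun Q hQ => ?_) fun _ _ _ => sq_nonneg _
            obtain ⟨R, -, rfl⟩ := Finset.mem_image.1 hQ
            simp [hc]
          · intro R hR R' hR' h
            have h1 : R i = Rx := by simpa using hR
            have h2 : R' i = Rx := by simpa using hR'
            funext l
            by_cases hl : l = i
            · rw [hl, h1, h2]
            · have := congrFun h l
              simpa [hl] using this
      _ ≤ _ := mul_le_mul_of_nonneg_left (sum_clip_sq_le hε lam i) (by positivity)
  have h82 : (82 : ℝ) ^ k = 2 ^ k * 41 ^ k := by rw [← mul_pow]; norm_num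
  rw [hτ, mul_div_assoc', div_le_iff₀ (by positivity)] at hsum
  have hε2 : 0 < ε ^ 2 := by positivity
  have : (S.card : ℝ) * ε ^ 2 ≤ (1024 * 82 ^ k * effSparsity ε lam) * ε ^ 2 := by
    rw [h82]
    linarith
  exact le_of_mul_le_mul_right this hε2

end Counting

end HamLearn

namespace HamLearn

/-! ### Correctness of the processing program -/

section Correctness

variable {n k T M : ℕ} {ε : ℝ} {σ : State} {e : Record} {d : Fin M → Group n T} {Z : Op n}
  {lam : PauliString n → ℝ}

theorem exists_isCyclic {c : Fin 4} (hc : c ≠ 0) : ∃ P R, IsCyclic c P R := by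
  fin_cases c
  · exact absurd rfl hc
  · exact ⟨2, 3, Or.inl ⟨rfl, rfl, rfl⟩⟩
  · exact ⟨3, 1, Or.inr (Or.inl ⟨rfl, rfl, rfl⟩)⟩
  · exact ⟨1, 2, Or.inr (Or.inr ⟨rfl, rfl, rfl⟩)⟩

theorem label_range {R : Fin 4} (h : R ≠ 0) : 1 ≤ (R : ℕ) ∧ (R : ℕ) ≤ 3 := by
  have h1 : (R : ℕ) ≠ 0 := fun h0 => h (Fin.ext h0)
  have h2 := R.2
  omega

/-- The search trees are small: for typical experiments, a string that gets many votes has a vote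
probability that is not small, and there are few such strings. -/
theorem Recorded.tree_length_le (h : Recorded n k ε d σ e) (htyp : Typical Z k ε d)
    (hZ : Z ∈ Matrix.unitaryGroup (Fin n → Fin 2) ℂ) (hε : 0 < ε)
    (hT : 2000 * 41 ^ k / ε ^ 2 ≤ T) (hlam : IsLocalHamiltonian k lam)
    (happrox : FirstOrderApprox Z (hamiltonian lam) (ε / 20 ^ (k + 2))) (hk : 0 < k) (i : Fin n)
    {c P Rx : Fin 4} (hcyc : IsCyclic c P Rx) :
    ((e.tree i P Rx n).length : ℝ) ≤ 1 + 1024 * 82 ^ k * effSparsity ε lam := by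
  classical
  obtain ⟨hc, hP, hRx⟩ := hcyc.ne_zero
  have hk' : 0 < e.k := by rw [h.locality]; exact hk
  have hmem : ∀ l ∈ e.tree i P Rx n, IsTreeString e.k i Rx n l ∧
      (l = [((i : ℕ), (Rx : ℕ))] ∨ e.live i P l) := fun l hl =>
    Record.mem_tree hk' (label_range hRx) i.2 hl
  set F := (e.tree i P Rx n).toFinset.erase [((i : ℕ), (Rx : ℕ))] with hF
  have hlen : (e.tree i P Rx n).length ≤ F.card + 1 := by
    rw [← List.toFinset_card_of_nodup (Record.nodup_tree hk' (label_range hRx) i.2)]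
    exact Nat.sub_le_iff_le_add.1 Finset.pred_card_le_card_erase
  have hcard : (F.image (toPauli n)).card = F.card := by
    refine Finset.card_image_of_injOn fun l hl l' hl' heq => ?_
    have h1 := (hmem l (List.mem_toFinset.1 (Finset.mem_of_mem_erase hl))).1.isString
    have h2 := (hmem l' (List.mem_toFinset.1 (Finset.mem_of_mem_erase hl'))).1.isString
    exact toPauli_injective h1 h2 heq
  have hheavy := card_heavy_le hZ hε hT hlam happrox i hcyc (F.image (toPauli n)) (by
    intro α hα
    obtain ⟨l, hl, rfl⟩ := Finset.mem_image.1 hα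
    obtain ⟨h1, h2⟩ := hmem l (List.mem_toFinset.1 (Finset.mem_of_mem_erase hl))
    have hs := h1.isString
    refine ⟨(hs.mem_iff i hRx).1 h1.root_mem, ?_⟩
    have hlive := (h.live_iff i P hs).1 (h2.resolve_left (Finset.ne_of_mem_erase hl))
    by_contra hcon
    have hw : (toPauli n l).weight ≤ k := by
      rw [weight_toPauli hs, ← h.locality]
      exact h1.length_le
    exact hlive ((htyp i P _ hP hw).1 (not_lt.1 hcon)))
  rw [hcard] at hheavy
  have : ((e.tree i P Rx n).length : ℝ) ≤ F.card + 1 := by exact_mod_cast hlen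
  linarith

/-- Every large term of the Hamiltonian is found: all its initial parts receive many votes. -/
theorem Recorded.exists_mem_tree (h : Recorded n k ε d σ e) (htyp : Typical Z k ε d)
    (hZ : Z ∈ Matrix.unitaryGroup (Fin n → Fin 2) ℂ) (hε : 0 < ε)
    (hT : 2000 * 41 ^ k / ε ^ 2 ≤ T) (hlam : IsLocalHamiltonian k lam)
    (happrox : FirstOrderApprox Z (hamiltonian lam) (ε / 20 ^ (k + 2))) {Q : PauliString n}
    (hQ : ε ≤ |lam Q|) :
    0 < k ∧ ∃ (i : Fin n) (c P Rx : Fin 4), IsCyclic c P Rx ∧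
      ∃ l ∈ e.tree i P Rx n, Function.update (toPauli n l) i c = Q := by
  classical
  have hne : lam Q ≠ 0 := fun h0 => by rw [h0, abs_zero] at hQ; linarith
  have hQw : Q.weight ≤ k := by
    by_contra hw
    exact hne (hlam.2 Q (not_le.1 hw))
  have hsupp : (Finset.univ.filter fun l => Q l ≠ 0).Nonempty := by
    by_contra hempty
    rw [Finset.not_nonempty_iff_eq_empty, Finset.filter_eq_empty_iff] at hempty
    have : Q = 0 := funext fun l => not_not.1 (hempty (Finset.mem_univ l))
    exact hne (this ▸ hlam.1)
  -- The term is found in the search that starts at its first qubit.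
  set i := (Finset.univ.filter fun l => Q l ≠ 0).min' hsupp with hi
  have hQi : Q i ≠ 0 := (Finset.mem_filter.1 (Finset.min'_mem _ hsupp)).2
  have hmin : ∀ l, Q l ≠ 0 → i ≤ l := fun l hl =>
    Finset.min'_le _ _ (Finset.mem_filter.2 ⟨Finset.mem_univ l, hl⟩)
  obtain ⟨P, Rx, hcyc⟩ := exists_isCyclic hQi
  obtain ⟨-, hP, hRx⟩ := hcyc.ne_zero
  set R : PauliString n := Function.update Q i Rx with hR
  have hRi : R i = Rx := by rw [hR, Function.update_self]
  have hRQ : Function.update R i (Q i) = Q := by rw [hR]; simp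
  have hRw : R.weight ≤ k := by
    rw [hR, weight_update hQi hRx]
    exact hQw
  have hk : 0 < k := lt_of_lt_of_le (Finset.card_pos.2 hsupp) hQw
  have hk' : 0 < e.k := by rw [h.locality]; exact hk
  refine ⟨hk, i, Q i, P, Rx, hcyc, ?_⟩
  have hlow : ∀ x, x < i → R x = 0 := by
    intro x hx
    rw [hR, Function.update_of_ne hx.ne]
    by_contra h0
    exact not_lt.2 (hmin x h0) hx
  -- The restriction of the string to the first `j` qubits is found at stage `j`.
  have hstage : ∀ j, (i : ℕ) + 1 ≤ j → j ≤ n → ∃ l ∈ e.tree i P Rx j,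
      ∀ x : Fin n, toPauli n l x = if (x : ℕ) < j then R x else 0 := by
    intro j hj
    induction j, hj using Nat.le_induction with
    | base =>
      intro _
      refine ⟨[((i : ℕ), (Rx : ℕ))], by rw [e.tree_start]; simp, fun x => ?_⟩
      have hs : IsString n [((i : ℕ), (Rx : ℕ))] :=
        ⟨by simp, by simp, by simpa using label_range hRx⟩
      by_cases hx : x = i
      · rw [hx, if_pos (Nat.lt_succ_self _), hRi]
        exact (hs.mem_iff i hRx).1 (by simp)
      · rw [hs.toPauli_cons, Function.update_of_ne (by exact hx), toPauli_nil]
        split_ifs with hlt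
        · rw [hlow x (lt_of_le_of_ne (Nat.lt_succ_iff.1 hlt) hx)]
          rfl
        · rfl
    | succ j hj ih =>
      intro hjn
      obtain ⟨l, hl, hval⟩ := ih (by omega)
      rw [e.tree_succ i P Rx hj]
      have ht := (Record.mem_tree hk' (label_range hRx) hj hl).1
      set x₀ : Fin n := ⟨j, by omega⟩ with hx₀
      by_cases h0 : R x₀ = 0
      · refine ⟨l, List.mem_append_left _ hl, fun x => ?_⟩
        rw [hval]
        by_cases hx : x = x₀
        · rw [hx, h0]
          simp
        · have : (x : ℕ) ≠ j := fun h => hx (Fin.ext h)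
          simp only [show (x : ℕ) < j + 1 ↔ (x : ℕ) < j by omega]
      · set l' := (j, (R x₀ : ℕ)) :: l with hl'
        have hs' : IsString n l' := by
          refine ⟨List.pairwise_cons.2 ⟨fun b hb => ht.upper b hb, ht.sorted⟩, ?_, ?_⟩
          · intro a ha
            rcases List.mem_cons.1 ha with rfl | ha
            · exact x₀.2
            · have := ht.upper a ha
              omega
          · intro a ha
            rcases List.mem_cons.1 ha with rfl | ha
            · exact label_range h0
            · exact ht.label a ha
        have hval' : ∀ x : Fin n, toPauli n l' x = if (x : ℕ) < j + 1 then R x else 0 := by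
          intro x
          rw [hs'.toPauli_cons]
          by_cases hx : x = x₀
          · subst hx
            rw [Function.update_self, if_pos (Nat.lt_succ_self _)]
            ext
            exact label_ofNat (label_range h0)
          · have : (x : ℕ) ≠ j := fun h => hx (Fin.ext h)
            rw [Function.update_of_ne (by exact hx), hval]
            simp only [show (x : ℕ) < j + 1 ↔ (x : ℕ) < j by omega]
        have hαR : ∀ x, toPauli n l' x = 0 ∨ toPauli n l' x = R x := by
          intro x
          rw [hval']
          split_ifs
          · exact Or.inr rfl
          · exact Or.inl rfl
        have hw : (toPauli n l').weight ≤ k := by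
          refine le_trans (Finset.card_le_card fun x hx => ?_) hRw
          simp only [Finset.mem_filter, Finset.mem_univ, true_and] at hx ⊢
          rwa [← (hαR x).resolve_left hx]
        have hαi : toPauli n l' i = Rx := by
          rw [hval', if_pos (by omega), hRi]
        have hvote := le_voteProb hZ hε hT hlam happrox hcyc hRi hαi hαR (by rw [hRQ]; exact hQ)
        have hlive := (h.live_iff i P hs').2 ((htyp i P _ hP hw).2.1 hvote)
        have hlen : l.length < e.k := by
          rw [weight_toPauli hs', ← h.locality] at hw
          exact hw
        refine ⟨l', List.mem_append_right _ (List.mem_flatMap.2 ⟨l, hl, ?_⟩), hval'⟩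
        exact Record.mem_children.2 ⟨hlen, R x₀, label_range h0, rfl, hlive⟩
  obtain ⟨l, hl, hval⟩ := hstage n i.2 le_rfl
  refine ⟨l, hl, ?_⟩
  have : toPauli n l = R := funext fun x => by rw [hval, if_pos x.2]
  rw [this, hRQ]

/-- The estimates are accurate. -/
theorem Recorded.abs_estimate_lt (h : Recorded n k ε d σ e) (htyp : Typical Z k ε d) (hε : 0 < ε)
    (hT : 0 < T) (hM : 0 < M)
    (happrox : FirstOrderApprox Z (hamiltonian lam) (ε / 20 ^ (k + 2))) {i : Fin n}
    {c P Rx : Fin 4} (hcyc : IsCyclic c P Rx) {l : List (ℕ × ℕ)}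
    (hl : IsTreeString e.k i Rx n l) :
    |lam (Function.update (toPauli n l) i c) - e.estimate i P l| < ε := by
  obtain ⟨hc, hP, hRx⟩ := hcyc.ne_zero
  have hs := hl.isString
  have hi : toPauli n l i = Rx := (hs.mem_iff i hRx).1 hl.root_mem
  have hw : (toPauli n l).weight ≤ k := by
    rw [weight_toPauli hs, ← h.locality]
    exact hl.length_le
  obtain ⟨err, herr, hcoeff⟩ := exists_error happrox i hcyc
  have hmean := (htyp i P _ hP hw).2.2
  rw [hcoeff _ hi, ← h.totalSum_eq i P hs] at hmean
  set x := lam (Function.update (toPauli n l) i c)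
  set η := err (toPauli n l)
  have hη : |η| ≤ ε / 400 := by
    refine abs_le_of_sq_le_sq ?_ (by positivity)
    calc η ^ 2 ≤ ∑ R, err R ^ 2 :=
          Finset.single_le_sum (fun R _ => sq_nonneg (err R)) (Finset.mem_univ _)
      _ ≤ (ε / 20 ^ (k + 2)) ^ 2 := herr
      _ ≤ (ε / 400) ^ 2 := by
          refine pow_le_pow_left₀ (by positivity)
            (div_le_div_of_nonneg_left hε.le (by norm_num) ?_) 2
          calc (400 : ℝ) = 20 ^ 2 := by norm_num
            _ ≤ _ := pow_le_pow_right₀ (by norm_num) (by omega)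
  have hMT : (0 : ℝ) < M * T := by positivity
  rw [Record.estimate, h.data.groups, h.data.trials]
  have hrw : x - (0 - e.totalSum i P l) / (2 * (M * T)) =
      ((e.totalSum i P l - M * T * (-2 * x + η)) / (M * T) + η) / 2 := by
    field_simp
    ring
  rw [hrw, abs_div, abs_two, div_lt_iff₀ (by norm_num)]
  have h1 : |(e.totalSum i P l - M * T * (-2 * x + η)) / (M * T)| < ε := by
    rw [abs_div, abs_of_pos hMT, div_lt_iff₀ hMT]
    exact hmean
  have h2 := abs_add_le ((e.totalSum i P l - M * T * (-2 * x + η)) / (M * T)) η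
  linarith

/-- After a list of assignments, an entry has the value of one of the assignments to it, or it is
zero and there is no assignment to it. -/
theorem foldl_update_spec {α : Type*} [DecidableEq α] (L : List (α × ℝ)) (Q : α) :
    (∃ a ∈ L, a.1 = Q ∧ L.foldl (fun f a => Function.update f a.1 a.2) (0 : α → ℝ) Q = a.2) ∨
      ((∀ a ∈ L, a.1 ≠ Q) ∧ L.foldl (fun f a => Function.update f a.1 a.2) (0 : α → ℝ) Q = 0) := by
  induction L using List.reverseRecOn with
  | nil => right; simp
  | append_singleton L b ih =>
    rw [List.foldl_append, List.foldl_cons, List.foldl_nil]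
    by_cases hb : b.1 = Q
    · exact Or.inl ⟨b, by simp, hb, by rw [← hb, Function.update_self]⟩
    · rw [Function.update_of_ne (Ne.symm hb)]
      rcases ih with ⟨a, ha, h1, h2⟩ | ⟨h1, h2⟩
      · exact Or.inl ⟨a, by simp [ha], h1, h2⟩
      · refine Or.inr ⟨fun a ha => ?_, h2⟩
        rcases List.mem_append.1 ha with ha | ha
        · exact h1 a ha
        · rw [List.mem_singleton.1 ha]
          exact hb

/-- The list of assignments that the memory holds, as Pauli strings with values. -/
def assignments (n : ℕ) (LO : List ((ℕ → ℕ) × ℝ)) : List (PauliString n × ℝ) :=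
  LO.map fun a => ((fun x : Fin n => Fin.ofNat 4 (a.1 x)), a.2)

theorem Outputs.output_eq {τ : State} {LO : List ((ℕ → ℕ) × ℝ)} (h : Outputs τ n LO) :
    τ.output n = (assignments n LO).foldl (fun f a => Function.update f a.1 a.2)
      (0 : PauliString n → ℝ) := by
  have hmap : assignments n LO = (List.range LO.length).map fun r =>
      ((fun i : Fin n => Fin.ofNat 4 (τ.nat 7 (r * n + i))), τ.real 1 r) := by
    refine List.ext_getElem (by simp [assignments]) fun r h1 h2 => ?_
    have hr : r < LO.length := by simpa [assignments] using h1
    simp only [assignments, List.getElem_map, List.getElem_range]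
    refine Prod.ext (funext fun x => ?_) (h.value r hr).symm
    exact congrArg (Fin.ofNat 4) (h.string r hr x x.2).symm
  rw [State.output, hmap, List.foldl_map]
  exact congrArg (fun N => List.foldl _ _ (List.range N)) h.count

theorem sparsity_output_le {τ : State} {LO : List ((ℕ → ℕ) × ℝ)} (h : Outputs τ n LO) :
    sparsity (τ.output n) ≤ LO.length := by
  classical
  have hsub : {Q | τ.output n Q ≠ 0} ⊆ ((assignments n LO).map Prod.fst).toFinset := by
    intro Q hQ
    rw [Set.mem_ofPred_eq, h.output_eq] at hQ
    rcases foldl_update_spec (assignments n LO) Q with ⟨a, ha, h1, -⟩ | ⟨-, h2⟩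
    · rw [Finset.mem_coe, List.mem_toFinset, List.mem_map]
      exact ⟨a, ha, h1⟩
    · exact absurd h2 hQ
  calc sparsity (τ.output n) ≤ Set.ncard (((assignments n LO).map Prod.fst).toFinset : Set _) :=
        Set.ncard_le_ncard hsub (Finset.finite_toSet _)
    _ ≤ ((assignments n LO).map Prod.fst).length := by
        rw [Set.ncard_coe_finset]
        exact List.toFinset_card_le _
    _ = LO.length := by simp [assignments]

theorem Record.mem_branches {i : ℕ} {a : (ℕ → ℕ) × ℝ} :
    a ∈ e.branches i ↔ 0 < e.k ∧ ∃ c P Rx : Fin 4, IsCyclic c P Rx ∧ ∃ l ∈ e.tree i P Rx e.n,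
      a = (Function.update (strF l) i c, e.estimate i P l) := by
  rw [Record.branches]
  split_ifs with hk
  · simp only [hk, true_and, List.mem_append, Record.branch, List.mem_map]
    constructor
    · rintro (⟨l, hl, rfl⟩ | ⟨l, hl, rfl⟩ | ⟨l, hl, rfl⟩)
      · exact ⟨1, 2, 3, Or.inl ⟨rfl, rfl, rfl⟩, l, hl, rfl⟩
      · exact ⟨2, 3, 1, Or.inr (Or.inl ⟨rfl, rfl, rfl⟩), l, hl, rfl⟩
      · exact ⟨3, 1, 2, Or.inr (Or.inr ⟨rfl, rfl, rfl⟩), l, hl, rfl⟩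
    · rintro ⟨c, P, Rx, ⟨rfl, rfl, rfl⟩ | ⟨rfl, rfl, rfl⟩ | ⟨rfl, rfl, rfl⟩, l, hl, rfl⟩
      · exact Or.inl ⟨l, hl, rfl⟩
      · exact Or.inr (Or.inl ⟨l, hl, rfl⟩)
      · exact Or.inr (Or.inr ⟨l, hl, rfl⟩)
  · simp [hk]

theorem toPauli_update (l : List (ℕ × ℕ)) (i : Fin n) (c : Fin 4) :
    (fun x : Fin n => Fin.ofNat 4 (Function.update (strF l) (i : ℕ) (c : ℕ) x)) =
      Function.update (toPauli n l) i c := by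
  funext x
  by_cases hx : x = i
  · subst hx
    rw [Function.update_self, Function.update_self]
    exact Fin.ext (Nat.mod_eq_of_lt c.2)
  · rw [Function.update_of_ne hx, Function.update_of_ne fun h => hx (Fin.ext h)]
    rfl

/-- The output approximates the coefficients of the Hamiltonian: the coefficients that are output
are estimated accurately, and the others are small because every large one is found. -/
theorem Recorded.abs_output_lt (h : Recorded n k ε d σ e) (htyp : Typical Z k ε d)
    (hZ : Z ∈ Matrix.unitaryGroup (Fin n → Fin 2) ℂ) (hε : 0 < ε)
    (hT : 2000 * 41 ^ k / ε ^ 2 ≤ T) (hM : 0 < M) (hlam : IsLocalHamiltonian k lam)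
    (happrox : FirstOrderApprox Z (hamiltonian lam) (ε / 20 ^ (k + 2))) {τ : State}
    (hO : Outputs τ n ((List.range n).flatMap e.branches)) (Q : PauliString n) :
    |lam Q - τ.output n Q| < ε := by
  classical
  have hTpos : (0 : ℝ) < T := lt_of_lt_of_le (by positivity) hT
  have hT0 : 0 < T := by exact_mod_cast hTpos
  rw [hO.output_eq]
  rcases foldl_update_spec (assignments n ((List.range n).flatMap e.branches)) Q with
    ⟨a, ha, h1, h2⟩ | ⟨h1, h2⟩
  · rw [h2]
    rw [assignments, List.mem_map] at ha
    obtain ⟨b, hb, rfl⟩ := ha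
    obtain ⟨i, hi, hb⟩ := List.mem_flatMap.1 hb
    obtain ⟨hk, c, P, Rx, hcyc, l, hl, rfl⟩ := Record.mem_branches.1 hb
    have hin : i < n := List.mem_range.1 hi
    rw [h.data.size] at hl
    have hl' := (Record.mem_tree hk (label_range hcyc.ne_zero.2.2) hin hl).1
    simp only at h1 ⊢
    have h3 := toPauli_update l (⟨i, hin⟩ : Fin n) c
    simp only at h3
    rw [← h1, h3]
    exact h.abs_estimate_lt htyp hε hT0 hM happrox (i := ⟨i, hin⟩) hcyc hl'
  · rw [h2, sub_zero]
    by_contra hcon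
    obtain ⟨hk, i, c, P, Rx, hcyc, l, hl, hQ⟩ :=
      h.exists_mem_tree htyp hZ hε hT hlam happrox (not_lt.1 hcon)
    refine h1 (Function.update (toPauli n l) i c, e.estimate i P l) ?_ hQ
    rw [assignments, List.mem_map]
    refine ⟨(Function.update (strF l) i c, e.estimate i P l), List.mem_flatMap.2
      ⟨i, List.mem_range.2 i.2, Record.mem_branches.2 ⟨by rw [h.locality]; exact hk, c, P, Rx, hcyc,
        l, by rw [h.data.size]; exact hl, rfl⟩⟩, ?_⟩
    rw [toPauli_update]

theorem length_branches_le {len : ℕ} (hlen : 0 < e.k → ∀ i < n, (e.tree i 2 3 e.n).length ≤ len ∧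
      (e.tree i 3 1 e.n).length ≤ len ∧ (e.tree i 1 2 e.n).length ≤ len) :
    ((List.range n).flatMap e.branches).length ≤ n * (3 * len) := by
  rw [List.length_flatMap]
  refine (List.sum_le_card_nsmul _ (3 * len) fun x hx => ?_).trans (by simp)
  obtain ⟨i, hi, rfl⟩ := List.mem_map.1 hx
  rw [Record.branches]
  split_ifs with hk
  · obtain ⟨h1, h2, h3⟩ := hlen hk i (List.mem_range.1 hi)
    simp only [List.length_append, Record.branch, List.length_map]
    omega
  · simp

end Correctness

end HamLearn

namespace HamLearn

/-! ### Resource bounds -/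

theorem logCount_bounds {n : ℕ} {δ : ℝ} (hx : 2 ≤ (n : ℝ) / δ) :
    1 ≤ logCount n δ ∧ (n : ℝ) / δ ≤ 2 ^ logCount n δ ∧
      (logCount n δ : ℝ) ≤ 3 * Real.log (n / δ) := by
  have hx0 : 0 < (n : ℝ) / δ := by linarith
  have h2 : (2 / 3 : ℝ) ≤ Real.log 2 := by linarith [Real.log_two_gt_d9]
  have hlogb : 1 ≤ Real.logb 2 (n / δ) := by
    rw [Real.le_logb_iff_rpow_le (by norm_num) hx0, Real.rpow_one]
    exact hx
  have hle : Real.logb 2 (n / δ) ≤ logCount n δ := Nat.le_ceil _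
  have hlt : (logCount n δ : ℝ) < Real.logb 2 (n / δ) + 1 := Nat.ceil_lt_add_one (by linarith)
  refine ⟨by exact_mod_cast hlogb.trans hle, ?_, ?_⟩
  · rwa [Real.logb_le_iff_le_rpow (by norm_num) hx0, Real.rpow_natCast] at hle
  · have hmul : Real.logb 2 (n / δ) * Real.log 2 = Real.log (n / δ) :=
      div_mul_cancel₀ _ (by linarith)
    nlinarith

/-- The form in which numerical bases are compared with powers of `e`. -/
theorem pow_le_exp {b : ℝ} (hb : 0 ≤ b) {c : ℕ} (h : b ≤ 2.7 ^ c) (k : ℕ) :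
    b ^ k ≤ Real.exp (c * k) := by
  have he : (2.7 : ℝ) ≤ Real.exp 1 := by linarith [Real.exp_one_gt_d9]
  calc b ^ k ≤ (Real.exp 1 ^ c) ^ k :=
        pow_le_pow_left₀ hb (h.trans (pow_le_pow_left₀ (by norm_num) he c)) k
    _ = Real.exp (c * k) := by
        rw [← pow_mul, ← Real.exp_nat_mul, mul_one, Nat.cast_mul]

theorem succ_le_pow (k : ℕ) : (k : ℝ) + 1 ≤ 5 / 2 * 1.4 ^ k := by
  have h := one_add_mul_le_pow (a := (0.4 : ℝ)) (by norm_num) k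
  have h' : (1 + 0.4 : ℝ) = 1.4 := by norm_num
  rw [h'] at h
  linarith

/-- Bounds on the number of groups and on the number of experiments in a group. -/
theorem counts_le {n k : ℕ} {ε δ : ℝ} (hε : 0 < ε) (hε1 : ε ≤ 1) (hL : 1 ≤ logCount n δ) :
    (groupCount n k δ : ℝ) ≤ 385 * ((k : ℝ) + 1) * logCount n δ * 41 ^ k ∧
      (trialCount k ε : ℝ) ≤ 2001 * (41 ^ k / ε ^ 2) ∧ (1 : ℝ) ≤ 41 ^ k / ε ^ 2 ∧
      (1 : ℝ) ≤ ((k : ℝ) + 1) * logCount n δ * 41 ^ k := by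
  have hD : (1 : ℝ) ≤ 41 ^ k := one_le_pow₀ (by norm_num)
  have hL' : (1 : ℝ) ≤ logCount n δ := by exact_mod_cast hL
  have hk : (1 : ℝ) ≤ (k : ℝ) + 1 := by linarith [(Nat.cast_nonneg k : (0 : ℝ) ≤ k)]
  have hone : (1 : ℝ) ≤ ((k : ℝ) + 1) * logCount n δ * 41 ^ k :=
    one_le_mul_of_one_le_of_one_le (one_le_mul_of_one_le_of_one_le hk hL') hD
  have hq : (1 : ℝ) ≤ 41 ^ k / ε ^ 2 := by
    rw [le_div_iff₀ (by positivity), one_mul]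
    exact (pow_le_one₀ hε.le hε1).trans hD
  refine ⟨?_, ?_, hq, hone⟩
  · refine (Nat.ceil_lt_add_one (by positivity)).le.trans ?_
    linarith
  · refine (Nat.ceil_lt_add_one (by positivity)).le.trans ?_
    have : 2000 * 41 ^ k / (ε * ε) = 2000 * (41 ^ k / ε ^ 2) := by ring
    rw [this]
    linarith

theorem experiments_le {n k : ℕ} {ε δ : ℝ} (hε : 0 < ε) (hε1 : ε ≤ 1) (hx : 2 ≤ (n : ℝ) / δ) :
    ((groupCount n k δ * (2 * trialCount k ε) : ℕ) : ℝ) ≤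
      10 ^ 15 * (Real.exp (8 * k) / ε ^ 2 * Real.log (n / δ)) := by
  obtain ⟨hL, -, hLX⟩ := logCount_bounds hx
  obtain ⟨hM, hT, hq, hone⟩ := counts_le (k := k) hε hε1 hL
  have hL0 : (0 : ℝ) ≤ logCount n δ := Nat.cast_nonneg _
  have hX : 0 ≤ Real.log (n / δ) := Real.log_nonneg (by linarith)
  have hexp : ((k : ℝ) + 1) * 41 ^ k * 41 ^ k ≤ 5 / 2 * Real.exp (8 * k) := by
    calc ((k : ℝ) + 1) * 41 ^ k * 41 ^ k ≤ 5 / 2 * 1.4 ^ k * 41 ^ k * 41 ^ k := by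
          gcongr
          exact succ_le_pow k
      _ = 5 / 2 * (1.4 * 41 * 41) ^ k := by rw [mul_pow, mul_pow]; ring
      _ ≤ 5 / 2 * Real.exp (8 * k) := by
          gcongr
          exact_mod_cast pow_le_exp (by norm_num) (c := 8) (by norm_num) k
  push_cast
  calc (groupCount n k δ : ℝ) * (2 * trialCount k ε)
      ≤ 385 * ((k : ℝ) + 1) * logCount n δ * 41 ^ k * (2 * (2001 * (41 ^ k / ε ^ 2))) := by gcongr
    _ = 1540770 * (((k : ℝ) + 1) * 41 ^ k * 41 ^ k) * logCount n δ / ε ^ 2 := by ring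
    _ ≤ 1540770 * (5 / 2 * Real.exp (8 * k)) * (3 * Real.log (n / δ)) / ε ^ 2 := by gcongr
    _ = 11555775 * (Real.exp (8 * k) / ε ^ 2 * Real.log (n / δ)) := by ring
    _ ≤ 10 ^ 15 * (Real.exp (8 * k) / ε ^ 2 * Real.log (n / δ)) := by
        gcongr
        norm_num

/-- The running time of the design and of the processing, when all search trees have at most
`len` nodes. -/
theorem time_le {n k len t₁ t₂ : ℕ} {ε δ s : ℝ} (hε : 0 < ε) (hε1 : ε ≤ 1) (hn : 0 < n)
    (hx : 2 ≤ (n : ℝ) / δ) (hs : 1 ≤ s) (hlen : (len : ℝ) ≤ 1025 * 82 ^ k * s)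
    (ht₁ : t₁ ≤ 1000 * ((groupCount n k δ + logCount n δ + k + 1) *
      ((n + 1) * (trialCount k ε + 1))))
    (ht₂ : t₂ ≤ 30 * ((n + 1) * ((n + 1) * ((len + 1) *
      (500 * ((groupCount n k δ + 1) * ((trialCount k ε + 1) * (k + 1)))))))) :
    ((t₁ + t₂ : ℕ) : ℝ) ≤ 10 ^ 15 *
      ((n : ℝ) ^ 2 * s * (Real.exp (15 * k) / ε ^ 2) * Real.log (n / δ)) := by
  obtain ⟨hL, -, hLX⟩ := logCount_bounds hx
  obtain ⟨hM, hT, hq, hone⟩ := counts_le (k := k) hε hε1 hL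
  have hL1 : (1 : ℝ) ≤ logCount n δ := by exact_mod_cast hL
  have hX : 0 ≤ Real.log (n / δ) := Real.log_nonneg (by linarith)
  have hn1 : (1 : ℝ) ≤ n := by exact_mod_cast hn
  have hk1 : (1 : ℝ) ≤ (k : ℝ) + 1 := by linarith [(Nat.cast_nonneg k : (0 : ℝ) ≤ k)]
  have hD : (1 : ℝ) ≤ 41 ^ k := one_le_pow₀ (by norm_num)
  have hB : (1 : ℝ) ≤ 82 ^ k := one_le_pow₀ (by norm_num)
  have hBs : (1 : ℝ) ≤ 82 ^ k * s := one_le_mul_of_one_le_of_one_le hB hs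
  set a : ℝ := (k : ℝ) + 1 with ha
  set L : ℝ := (logCount n δ : ℝ) with hLdef
  set D : ℝ := (41 : ℝ) ^ k with hDdef
  set B : ℝ := (82 : ℝ) ^ k with hBdef
  have hLa : L ≤ a * L * D := by
    calc L = 1 * L * 1 := by ring
      _ ≤ a * L * D := by gcongr
  have haL : a ≤ a * L * D := by
    calc a = a * 1 * 1 := by ring
      _ ≤ a * L * D := by gcongr
  have hT' : (trialCount k ε : ℝ) + 1 ≤ 2002 * (D / ε ^ 2) := by linarith
  have hM' : (groupCount n k δ : ℝ) + 1 ≤ 386 * (a * L * D) := by linarith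
  have hsum : (groupCount n k δ : ℝ) + L + k + 1 ≤ 388 * (a * L * D) := by linarith
  have hn2 : (n : ℝ) + 1 ≤ 2 * n := by linarith
  have hlen' : (len : ℝ) + 1 ≤ 1026 * (B * s) := by linarith
  have hexp : B * (D * a) * (D * a) ≤ 25 / 4 * Real.exp (15 * k) := by
    calc B * (D * a) * (D * a) ≤ B * (D * (5 / 2 * 1.4 ^ k)) * (D * (5 / 2 * 1.4 ^ k)) := by
          have := succ_le_pow k
          gcongr
      _ = 25 / 4 * (82 * 41 * 41 * 1.4 * 1.4) ^ k := by
          rw [mul_pow, mul_pow, mul_pow, mul_pow]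
          ring
      _ ≤ 25 / 4 * Real.exp (15 * k) := by
          gcongr
          exact_mod_cast pow_le_exp (by norm_num) (c := 15) (by norm_num) k
  have h₁ : (t₁ : ℝ) ≤ 1553552000 * (n * (a * L * D) * (D / ε ^ 2)) := by
    calc (t₁ : ℝ) ≤ 1000 * ((groupCount n k δ + L + k + 1) * ((n + 1) * (trialCount k ε + 1))) := by
          have h := (Nat.cast_le (α := ℝ)).2 ht₁
          push_cast at h
          exact h
      _ ≤ 1000 * (388 * (a * L * D) * (2 * n * (2002 * (D / ε ^ 2)))) := by gcongr
      _ = 1553552000 * (n * (a * L * D) * (D / ε ^ 2)) := by ring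
  have h₁' : n * (a * L * D) * (D / ε ^ 2) ≤
      (n : ℝ) ^ 2 * (B * s) * (a * L * D) * (D / ε ^ 2) * a := by
    have hn' : (n : ℝ) ≤ (n : ℝ) ^ 2 := le_self_pow₀ hn1 two_ne_zero
    calc n * (a * L * D) * (D / ε ^ 2) = n * 1 * (a * L * D) * (D / ε ^ 2) * 1 := by ring
      _ ≤ _ := by gcongr
  have h₂ : (t₂ : ℝ) ≤ 47571844320000 *
      ((n : ℝ) ^ 2 * (B * s) * (a * L * D) * (D / ε ^ 2) * a) := by
    calc (t₂ : ℝ) ≤ 30 * ((n + 1) * ((n + 1) * ((len + 1) *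
          (500 * ((groupCount n k δ + 1) * ((trialCount k ε + 1) * a)))))) := by
          have h := (Nat.cast_le (α := ℝ)).2 ht₂
          push_cast at h
          exact h
      _ ≤ 30 * (2 * n * (2 * n * (1026 * (B * s) *
          (500 * (386 * (a * L * D) * (2002 * (D / ε ^ 2) * a)))))) := by gcongr
      _ = 47571844320000 * ((n : ℝ) ^ 2 * (B * s) * (a * L * D) * (D / ε ^ 2) * a) := by ring
  push_cast
  calc (t₁ : ℝ) + t₂ ≤ 47576000000000 *
        ((n : ℝ) ^ 2 * (B * s) * (a * L * D) * (D / ε ^ 2) * a) := by linarith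
    _ = 47576000000000 * ((n : ℝ) ^ 2 * s * ((B * (D * a) * (D * a)) / ε ^ 2) * L) := by ring
    _ ≤ 47576000000000 * ((n : ℝ) ^ 2 * s * ((25 / 4 * Real.exp (15 * k)) / ε ^ 2) *
        (3 * Real.log (n / δ))) := by gcongr
    _ = 892050000000000 *
        ((n : ℝ) ^ 2 * s * (Real.exp (15 * k) / ε ^ 2) * Real.log (n / δ)) := by ring
    _ ≤ 10 ^ 15 * ((n : ℝ) ^ 2 * s * (Real.exp (15 * k) / ε ^ 2) * Real.log (n / δ)) := by
        gcongr
        norm_num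

/-- The probability of success, the accuracy and the resources of the algorithm on a unitary that
is close to the exponential of a local Hamiltonian. -/
theorem le_prob_good {n k : ℕ} {ε δ : ℝ} (hε : 0 < ε) (hε1 : ε ≤ 1) (hδ : 0 < δ) (hδ1 : δ < 1)
    (hnδ : 2 * δ ≤ n) {Z : Op n} (hZ : Z ∈ Matrix.unitaryGroup (Fin n → Fin 2) ℂ)
    {lam : PauliString n → ℝ} (hlam : IsLocalHamiltonian k lam)
    (happrox : FirstOrderApprox Z (hamiltonian lam) (ε / 20 ^ (k + 2))) :
    ENNReal.ofReal (1 - δ) ≤ Algorithm.prob ⟨designProg, processProg⟩ Z k ε δ fun lamEst time =>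
      (∀ Q, |lam Q - lamEst Q| < ε) ∧
      (time : ℝ) ≤ 10 ^ 15 * ((n : ℝ) ^ 2 * effSparsity ε lam *
        (Real.exp (15 * k) / ε ^ 2) * Real.log (n / δ)) ∧
      (sparsity lamEst : ℝ) ≤ 10 ^ 15 * (Real.exp (7 * k) * effSparsity ε lam * n) := by
  have hx : 2 ≤ (n : ℝ) / δ := by rwa [le_div_iff₀ hδ]
  have hn : 0 < n := by
    have : (0 : ℝ) < n := by linarith
    exact_mod_cast this
  obtain ⟨hL, hLx, -⟩ := logCount_bounds hx
  obtain ⟨-, -, -, hone⟩ := counts_le (k := k) hε hε1 hL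
  have hT : 2000 * 41 ^ k / ε ^ 2 ≤ trialCount k ε := by
    rw [sq]
    exact Nat.le_ceil _
  have hM : 384 * ((k : ℝ) + 1) * logCount n δ * 41 ^ k ≤ groupCount n k δ := Nat.le_ceil _
  have hM0 : 0 < groupCount n k δ := by
    have : (0 : ℝ) < groupCount n k δ := by linarith
    exact_mod_cast this
  have hs := one_le_effSparsity ε lam
  have hbad := iidProb_not_typical_le hZ hε hε1 hδ hδ1 hn hL hLx hT hM
  rw [iidProb_not (sum_groupWeight hZ)] at hbad
  refine (ENNReal.ofReal_le_ofReal (by linarith)).trans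
    (le_prob (by linarith) rfl rfl Z _ (Typical Z k ε) fun ω t₁ σ e d ht₁ hrec htyp => ?_)
  set len := ⌊1 + 1024 * 82 ^ k * effSparsity ε lam⌋₊ with hlen
  have hlen_le : (len : ℝ) ≤ 1025 * 82 ^ k * effSparsity ε lam := by
    have h1 : (1 : ℝ) ≤ 82 ^ k * effSparsity ε lam :=
      one_le_mul_of_one_le_of_one_le (one_le_pow₀ (by norm_num)) hs
    exact (Nat.floor_le (by positivity)).trans (by linarith)
  have htree : 0 < e.k → ∀ i < n, (e.tree i 2 3 e.n).length ≤ len ∧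
      (e.tree i 3 1 e.n).length ≤ len ∧ (e.tree i 1 2 e.n).length ≤ len := by
    intro hk i hi
    rw [hrec.locality] at hk
    have h : ∀ (c P Rx : Fin 4) (p r : ℕ), (P : ℕ) = p → (Rx : ℕ) = r → IsCyclic c P Rx →
        (e.tree i p r e.n).length ≤ len := by
      rintro c P Rx p r rfl rfl hcyc
      rw [hrec.data.size]
      exact Nat.le_floor (hrec.tree_length_le htyp hZ hε hT hlam happrox hk ⟨i, hi⟩ hcyc)
    exact ⟨h 1 2 3 2 3 rfl rfl (Or.inl ⟨rfl, rfl, rfl⟩),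
      h 2 3 1 3 1 rfl rfl (Or.inr (Or.inl ⟨rfl, rfl, rfl⟩)),
      h 3 1 2 1 2 rfl rfl (Or.inr (Or.inr ⟨rfl, rfl, rfl⟩))⟩
  obtain ⟨t₂, τ, hexec, ht₂, hO⟩ := wp_processProg (ω := ω) hrec.env (len := len)
    (by rw [hrec.data.size]; rw [hrec.data.size] at htree; exact htree)
    (by rw [hrec.data.size]; exact hrec.outputs)
  rw [hrec.data.size] at hO
  refine ⟨t₂, τ, hexec, fun Q => hrec.abs_output_lt htyp hZ hε hT hM0 hlam happrox hO Q, ?_, ?_⟩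
  · refine time_le hε hε1 hn hx hs hlen_le ht₁ ?_
    rw [Record.passTime, hrec.data.size, hrec.data.groups, hrec.data.trials, hrec.locality] at ht₂
    exact ht₂
  · have h1 : sparsity (τ.output n) ≤ n * (3 * len) :=
      (sparsity_output_le hO).trans (length_branches_le htree)
    have h7 : (82 : ℝ) ^ k ≤ Real.exp (7 * k) := by
      simpa using pow_le_exp (b := 82) (by norm_num) (c := 7) (by norm_num) k
    calc (sparsity (τ.output n) : ℝ) ≤ n * (3 * len) := by exact_mod_cast h1
      _ ≤ n * (3 * (1025 * Real.exp (7 * k) * effSparsity ε lam)) := by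
          have : 1025 * 82 ^ k * effSparsity ε lam ≤
              1025 * Real.exp (7 * k) * effSparsity ε lam := by gcongr
          gcongr
          exact hlen_le.trans this
      _ = 3075 * (Real.exp (7 * k) * effSparsity ε lam * n) := by ring
      _ ≤ 10 ^ 15 * (Real.exp (7 * k) * effSparsity ε lam * n) := by
          gcongr
          norm_num

end HamLearn

theorem mainTheorem3 :
    ∃ (C : ℝ) (alg : Algorithm), 0 < C ∧
      ∀ (n k : ℕ) (ε δ : ℝ), 0 < ε → ε ≤ 1 → 0 < δ → δ < 1 → 2 * δ ≤ n →
        (∀ ω : ℕ → Fin 6, ∃ (t : ℕ) (σ : State),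
          Exec ω alg.design (initState n k ε δ) t σ ∧
          (σ.numExperiments : ℝ) ≤
            C * (Real.exp (8 * k) / ε ^ 2 * Real.log (n / δ))) ∧
        ∀ Z ∈ Matrix.unitaryGroup (Fin n → Fin 2) ℂ, ∀ lam : PauliString n → ℝ,
          IsLocalHamiltonian k lam →
          FirstOrderApprox Z (hamiltonian lam) (ε / 20 ^ (k + 2)) →
          ENNReal.ofReal (1 - δ) ≤ alg.prob Z k ε δ fun lamEst time =>
            (∀ Q, |lam Q - lamEst Q| < ε) ∧
            (time : ℝ) ≤ C * ((n : ℝ) ^ 2 * effSparsity ε lam *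
              (Real.exp (15 * k) / ε ^ 2) * Real.log (n / δ)) ∧
            (sparsity lamEst : ℝ) ≤ C * (Real.exp (7 * k) * effSparsity ε lam * n) := by
  refine ⟨10 ^ 15, ⟨designProg, processProg⟩, by norm_num, fun n k ε δ hε hε1 hδ hδ1 hnδ =>
    ⟨fun ω => ?_, fun Z hZ lam hlam happrox => le_prob_good hε hε1 hδ hδ1 hnδ hZ hlam happrox⟩⟩
  have hx : 2 ≤ (n : ℝ) / δ := by rwa [le_div_iff₀ hδ]
  obtain ⟨t, σ, hexec, -, hσ⟩ := wp_designProg (ω := ω) (n := n) (k := k) (ε := ε) (δ := δ)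
    (by linarith)
  refine ⟨t, σ, hexec, ?_⟩
  rw [State.numExperiments, show σ.nat 1 0 = _ from hσ.asked]
  exact experiments_le hε hε1 hx
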